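/- **Setting.** An ordered $n$-linkoid diagram $L$ is a generic smooth immersion in the plane $\mathbb R^2$ of $n$ unit intervals, numbered $1,\dots,n$ and oriented from their initial point (leg) to their terminal point (head), together with finitely many oriented circles: its only multiple points are finitely many transverse double points (crossings), none of which is a leg or a head, and at each crossing one of the two branches is marked as the upper and the other as the lower one. An arc of $L$ is a maximal connected piece of a component that contains no undercrossing point. The fundamental quandle $Q(L)$ is the quandle generated by the arcs of $L$ with one relation $z = x \triangleright y$ for each crossing, where $y$ is the upper arc and $x$, $z$ are the lower arcs to the right and to the left of $y$ (with respect to the orientation of $y$). The fundamental pointed quandle of $L$ is the $2n$-pointed quandle $$P(L) = (Q(L), l_1, h_1, \dots, l_n, h_n),$$ where $l_i$ and $h_i$ are the generators corresponding to the arcs adjacent to the leg and to the head of the $i$-th open component. An isomorphism of $2n$-pointed quandles is a quandle isomorphism that maps the $j$-th basepoint to the $j$-th basepoint for every $j$. **Theorem.** Let $L$ and $L'$ be ordered $n$-linkoid diagrams that are connected by a finite sequence of planar isotopies (including orientation-preserving reparametrizations), Reidemeister moves of the first, second and third kind (performed inside a disc that contains no leg or head) and spherical moves (pulling a strand across the point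 at infinity of $S^2 = \mathbb R^2 \cup \{\infty\}$), and inverses of these. Then $P(L)$ and $P(L')$ are isomorphic as $2n$-pointed quandles. -/

import Mathlib

open Set
open scoped ContDiff

/-! ## Quandles given by generators and relations

Mathlib's `Quandle` is used; `Shelf.act x y` is "`x` acts on `y`", that is `y ▷ x` in the
right-handed notation. -/

/-- Words in the two quandle operations over a set `A` of generators. -/
inductive QuandleWord (A : Type) : Type
  | of : A → QuandleWord A
  | act : QuandleWord A → QuandleWord A → QuandleWord A
  | invAct : QuandleWord A → QuandleWord A → QuandleWord A

/-- The smallest congruence on words that contains `r` and all instances of the quandle axioms. -/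
inductive QuandleCongr {A : Type} (r : QuandleWord A → QuandleWord A → Prop) :
    QuandleWord A → QuandleWord A → Prop
  | rel {x y : QuandleWord A} : r x y → QuandleCongr r x y
  | refl (x : QuandleWord A) : QuandleCongr r x x
  | symm {x y : QuandleWord A} : QuandleCongr r x y → QuandleCongr r y x
  | trans {x y z : QuandleWord A} : QuandleCongr r x y → QuandleCongr r y z → QuandleCongr r x z
  | congr_act {x x' y y' : QuandleWord A} : QuandleCongr r x x' → QuandleCongr r y y' →
      QuandleCongr r (x.act y) (x'.act y')
  | congr_invAct {x x' y y' : QuandleWord A} : QuandleCongr r x x' → QuandleCongr r y y' →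
      QuandleCongr r (x.invAct y) (x'.invAct y')
  | self_distrib (x y z : QuandleWord A) :
      QuandleCongr r (x.act (y.act z)) ((x.act y).act (x.act z))
  | left_inv (x y : QuandleWord A) : QuandleCongr r (x.invAct (x.act y)) y
  | right_inv (x y : QuandleWord A) : QuandleCongr r (x.act (x.invAct y)) y
  | fix (x : QuandleWord A) : QuandleCongr r (x.act x) x

/-- The congruence as a setoid. -/
def quandleSetoid {A : Type} (r : QuandleWord A → QuandleWord A → Prop) :
    Setoid (QuandleWord A) where
  r := QuandleCongr r
  iseqv := ⟨QuandleCongr.refl, QuandleCongr.symm, QuandleCongr.trans⟩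

/-- The quandle with generators `A` and relations `r`. -/
def PresentedQuandle {A : Type} (r : QuandleWord A → QuandleWord A → Prop) : Type :=
  Quotient (quandleSetoid r)

instance PresentedQuandle.instQuandle {A : Type} (r : QuandleWord A → QuandleWord A → Prop) :
    Quandle (PresentedQuandle r) where
  act := Quotient.map₂ QuandleWord.act fun _ _ h _ _ h' => QuandleCongr.congr_act h h'
  invAct := Quotient.map₂ QuandleWord.invAct fun _ _ h _ _ h' => QuandleCongr.congr_invAct h h'
  self_distrib := by
    rintro ⟨x⟩ ⟨y⟩ ⟨z⟩
    exact Quotient.sound (QuandleCongr.self_distrib x y z)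
  left_inv := by
    rintro ⟨x⟩ ⟨y⟩
    exact Quotient.sound (QuandleCongr.left_inv x y)
  right_inv := by
    rintro ⟨x⟩ ⟨y⟩
    exact Quotient.sound (QuandleCongr.right_inv x y)
  fix := by
    rintro ⟨x⟩
    exact Quotient.sound (QuandleCongr.fix x)

/-- The class of a generator. -/
def PresentedQuandle.of {A : Type} (r : QuandleWord A → QuandleWord A → Prop) (a : A) :
    PresentedQuandle r :=
  Quotient.mk (quandleSetoid r) (QuandleWord.of a)

/-! ## Pointed quandles -/

/-- An `N`-pointed quandle: a quandle with an ordered `N`-tuple of elements. -/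
structure PointedQuandle (N : ℕ) where
  carrier : Type
  [quandle : Quandle carrier]
  basepoint : Fin N → carrier

attribute [instance] PointedQuandle.quandle

/-- Homomorphisms of pointed quandles: quandle homomorphisms that preserve each basepoint. -/
structure PointedQuandle.Hom {N : ℕ} (X Y : PointedQuandle N) where
  toFun : X.carrier → Y.carrier
  map_act : ∀ x y, toFun (Shelf.act x y) = Shelf.act (toFun x) (toFun y)
  map_basepoint : ∀ i, toFun (X.basepoint i) = Y.basepoint i

/-- Isomorphism of pointed quandles: there are mutually inverse homomorphisms. -/
def PointedQuandle.IsIsomorphic {N : ℕ} (X Y : PointedQuandle N) : Prop :=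
  ∃ (f : X.Hom Y) (g : Y.Hom X),
    Function.LeftInverse g.toFun f.toFun ∧ Function.RightInverse g.toFun f.toFun

/-! ## Linkoid diagrams in the plane

The plane is `ℂ`. The open components are indexed (hence ordered) by `Fin n`, the closed ones
by `Fin m`. Open components are parametrized by `[0,1]`, from the leg at `0` to the head at `1`;
closed components are parametrized by `ℝ` modulo `1`. -/

/-- Pairs of a component and a real parameter on it. -/
abbrev StrandParam (n m : ℕ) : Type := (Fin n ⊕ Fin m) × ℝ

/-- The parameter belongs to the parameter domain of its component. -/
def StrandParam.InDomain {n m : ℕ} (p : StrandParam n m) : Prop :=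
  p.1.isLeft → p.2 ∈ Icc (0 : ℝ) 1

/-- Two parameters name the same point of the (abstract) 1-manifold: they are equal, or they
lie on the same closed component and differ by an integer. -/
def StrandParam.Same {n m : ℕ} (p q : StrandParam n m) : Prop :=
  p.1 = q.1 ∧ (p.2 = q.2 ∨ (p.1.isRight ∧ ∃ z : ℤ, q.2 = p.2 + z))

/-- The determinant of two plane vectors; it is positive when `w` points to the left of `v`. -/
def planeDet (v w : ℂ) : ℝ := v.re * w.im - v.im * w.re

/-- An (oriented) ordered `n`-linkoid diagram with `m` closed components in the plane: a generic
smooth immersion of `n` intervals and `m` circles, with over/under information at the double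
points. For an open component only the restriction of `curve` to `[0,1]` is meaningful. -/
structure LinkoidDiagram (n m : ℕ) where
  curve : Fin n ⊕ Fin m → ℝ → ℂ
  /-- `under k t`: the point with parameter `t` on component `k` is the lower of the two points
  over a crossing. -/
  under : Fin n ⊕ Fin m → ℝ → Prop
  smooth : ∀ k, ContDiff ℝ ∞ (curve k)
  immersed : ∀ p : StrandParam n m, p.InDomain → deriv (curve p.1) p.2 ≠ 0
  curve_periodic : ∀ j t, curve (Sum.inr j) (t + 1) = curve (Sum.inr j) t
  under_periodic : ∀ j t, under (Sum.inr j) (t + 1) ↔ under (Sum.inr j) t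
  /-- Legs and heads are not double points. -/
  endpoint_simple : ∀ (i : Fin n) (t : ℝ), t = 0 ∨ t = 1 → ∀ q : StrandParam n m, q.InDomain →
    curve q.1 q.2 = curve (Sum.inl i) t → q = (Sum.inl i, t)
  transverse : ∀ p q : StrandParam n m, p.InDomain → q.InDomain → ¬ p.Same q →
    curve p.1 p.2 = curve q.1 q.2 →
      planeDet (deriv (curve p.1) p.2) (deriv (curve q.1) q.2) ≠ 0
  no_triple : ∀ p q r : StrandParam n m, p.InDomain → q.InDomain → r.InDomain →
    curve p.1 p.2 = curve q.1 q.2 → curve p.1 p.2 = curve r.1 r.2 →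
      p.Same q ∨ p.Same r ∨ q.Same r
  /-- Exactly one of the two points over a crossing is the lower one. -/
  under_xor : ∀ p q : StrandParam n m, p.InDomain → q.InDomain → ¬ p.Same q →
    curve p.1 p.2 = curve q.1 q.2 → (under p.1 p.2 ↔ ¬ under q.1 q.2)
  /-- Only crossings carry over/under information. -/
  under_double : ∀ p : StrandParam n m, under p.1 p.2 → p.InDomain ∧
    ∃ q : StrandParam n m, q.InDomain ∧ ¬ p.Same q ∧ curve p.1 p.2 = curve q.1 q.2
  finite_crossings : {p : StrandParam n m | p.2 ∈ Icc (0 : ℝ) 1 ∧ under p.1 p.2}.Finite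

namespace LinkoidDiagram

/-- The points of the 1-manifold that are not undercrossing points. -/
def ArcPoint {n m : ℕ} (L : LinkoidDiagram n m) : Type :=
  {p : StrandParam n m // p.InDomain ∧ ¬ L.under p.1 p.2}

/-- Two such points are joined if they name the same point, or if one can move along the
component from the first one to the second one without meeting an undercrossing point. -/
def Joined {n m : ℕ} (L : LinkoidDiagram n m) (p q : L.ArcPoint) : Prop :=
  p.1.Same q.1 ∨
    (p.1.1 = q.1.1 ∧ p.1.2 ≤ q.1.2 ∧ ∀ t ∈ Icc p.1.2 q.1.2, ¬ L.under p.1.1 t)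

/-- The arcs of the diagram: classes for the equivalence relation generated by `Joined`. -/
def Arc {n m : ℕ} (L : LinkoidDiagram n m) : Type := Quot L.Joined

/-- The arc through a point. -/
def arcOf {n m : ℕ} (L : LinkoidDiagram n m) (p : L.ArcPoint) : L.Arc := Quot.mk _ p

/-- `L.IsCrossingAt b a c d`: at some crossing, `b` is a point on the upper branch, `a` and `c` are
points of the lower component just before and just after the crossing, and `d` is the
determinant of (upper velocity, lower velocity); the crossing is positive iff `0 < d`. -/
def IsCrossingAt {n m : ℕ} (L : LinkoidDiagram n m) (b a c : L.ArcPoint) (d : ℝ) : Prop :=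
  ∃ t : ℝ, L.under a.1.1 t ∧ c.1.1 = a.1.1 ∧ a.1.2 < t ∧ t < c.1.2 ∧
    (∀ s ∈ Icc a.1.2 c.1.2, L.under a.1.1 s → s = t) ∧
    L.curve b.1.1 b.1.2 = L.curve a.1.1 t ∧
    d = planeDet (deriv (L.curve b.1.1) b.1.2) (deriv (L.curve a.1.1) t)

/-- The crossing relations. If `x` and `z` are the lower arcs to the right and to the left of the
upper arc `y` (with respect to the orientation of `y`), the relation is `z = x ▷ y`. -/
inductive CrossingRel {n m : ℕ} (L : LinkoidDiagram n m) :
    QuandleWord L.Arc → QuandleWord L.Arc → Prop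
  | pos (b a c : L.ArcPoint) (d : ℝ) : L.IsCrossingAt b a c d → 0 < d →
      CrossingRel L (.of (L.arcOf c)) (.act (.of (L.arcOf b)) (.of (L.arcOf a)))
  | neg (b a c : L.ArcPoint) (d : ℝ) : L.IsCrossingAt b a c d → d < 0 →
      CrossingRel L (.of (L.arcOf a)) (.act (.of (L.arcOf b)) (.of (L.arcOf c)))

/-- The fundamental quandle `Q(L)`: generated by the arcs, one relation for each crossing. -/
abbrev fundamentalQuandle {n m : ℕ} (L : LinkoidDiagram n m) : Type :=
  PresentedQuandle L.CrossingRel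

theorem not_under_endpoint {n m : ℕ} (L : LinkoidDiagram n m) (i : Fin n) (t : ℝ)
    (ht : t = 0 ∨ t = 1) : ¬ L.under (Sum.inl i) t := by
  intro h
  obtain ⟨-, q, hq, hne, he⟩ := L.under_double (Sum.inl i, t) h
  have := L.endpoint_simple i t ht q hq he.symm
  exact hne ⟨by rw [this], Or.inl (by rw [this])⟩

/-- The leg of the `i`-th open component. -/
def leg {n m : ℕ} (L : LinkoidDiagram n m) (i : Fin n) : L.ArcPoint :=
  ⟨(Sum.inl i, 0), fun _ => by simp, L.not_under_endpoint i 0 (Or.inl rfl)⟩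

/-- The head of the `i`-th open component. -/
def head {n m : ℕ} (L : LinkoidDiagram n m) (i : Fin n) : L.ArcPoint :=
  ⟨(Sum.inl i, 1), fun _ => by simp, L.not_under_endpoint i 1 (Or.inr rfl)⟩

/-- The fundamental pointed quandle `P(L) = (Q(L), l₁, h₁, …, lₙ, hₙ)`. -/
def fundamentalPointedQuandle {n m : ℕ} (L : LinkoidDiagram n m) : PointedQuandle (2 * n) where
  carrier := L.fundamentalQuandle
  basepoint j :=
    PresentedQuandle.of L.CrossingRel <| L.arcOf <|
      if j.1 % 2 = 0 then L.leg ⟨j.1 / 2, by omega⟩ else L.head ⟨j.1 / 2, by omega⟩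

end LinkoidDiagram

/-! ## Moves -/

/-- Orientation-preserving diffeomorphisms of the plane. -/
structure PlaneDiffeo where
  toEquiv : ℂ ≃ ℂ
  smooth : ContDiff ℝ ∞ toEquiv
  smooth_symm : ContDiff ℝ ∞ toEquiv.symm
  orientation : ∀ z, 0 < (fderiv ℝ toEquiv z).det

namespace LinkoidDiagram

/-- Planar isotopy (together with orientation-preserving reparametrization of the components and
renumbering of the closed components): `L'` is the image of `L` under an orientation-preserving
diffeomorphism of the plane. -/
def PlanarIsotopy {n m : ℕ} (L L' : LinkoidDiagram n m) : Prop :=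
  ∃ (F : PlaneDiffeo) (e : Equiv.Perm (Fin m)) (ρ : Fin n ⊕ Fin m → ℝ ≃o ℝ),
    (∀ k, ContDiff ℝ ∞ (ρ k)) ∧ (∀ k t, 0 < deriv (ρ k) t) ∧
    (∀ i, ρ (Sum.inl i) 0 = 0 ∧ ρ (Sum.inl i) 1 = 1) ∧
    (∀ j t, ρ (Sum.inr j) (t + 1) = ρ (Sum.inr j) t + 1) ∧
    ∀ p : StrandParam n m, p.InDomain →
      L'.curve (Sum.map id e p.1) p.2 = F.toEquiv (L.curve p.1 (ρ p.1 p.2)) ∧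
      (L'.under (Sum.map id e p.1) p.2 ↔ L.under p.1 (ρ p.1 p.2))

/-- The spherical move: on the sphere `ℂ ∪ {∞}`, rotate the diagram so that a point `z` off the
diagram goes to `∞`. Thus the region of `z` becomes the unbounded region, which (up to planar
isotopy) is what pulling strands across `∞` achieves. -/
def SphericalMove {n m : ℕ} (L L' : LinkoidDiagram n m) : Prop :=
  ∃ z : ℂ, ∀ p : StrandParam n m, p.InDomain →
    L.curve p.1 p.2 ≠ z ∧
    L'.curve p.1 p.2 = (L.curve p.1 p.2 - z)⁻¹ ∧
    (L'.under p.1 p.2 ↔ L.under p.1 p.2)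

end LinkoidDiagram

/-- A closed proper subinterval of a component, away from the endpoints of that component. -/
structure StrandInterval (n m : ℕ) where
  comp : Fin n ⊕ Fin m
  lo : ℝ
  hi : ℝ
  lo_lt_hi : lo < hi
  open_proper : comp.isLeft → 0 < lo ∧ hi < 1
  closed_proper : comp.isRight → hi < lo + 1

/-- The point named by `p` lies on the interval `J`. -/
def StrandInterval.Mem {n m : ℕ} (J : StrandInterval n m) (p : StrandParam n m) : Prop :=
  ∃ t ∈ Icc J.lo J.hi, StrandParam.Same (J.comp, t) p

namespace LinkoidDiagram

/-- `L` restricted to the interval `J`, in the coordinates `φ` of the plane. -/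
def inChart {n m : ℕ} (L : LinkoidDiagram n m) (φ : PlaneDiffeo) (J : StrandInterval n m)
    (t : ℝ) : ℂ :=
  φ.toEquiv (L.curve J.comp t)

/-- The interval `J` has no self-crossing. -/
def EmbeddedOn {n m : ℕ} (L : LinkoidDiagram n m) (J : StrandInterval n m) : Prop :=
  InjOn (L.curve J.comp) (Icc J.lo J.hi)

/-- `L` and `L'` are equal outside a disc (the unit disc in the coordinates `φ`), and each of them
meets the disc precisely in the `r` disjoint strands `J 0, …, J (r-1)`. -/
structure DifferInDisc {n m r : ℕ} (L L' : LinkoidDiagram n m) (φ : PlaneDiffeo)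
    (J : Fin r → StrandInterval n m) : Prop where
  disjoint : ∀ i j p, (J i).Mem p → (J j).Mem p → i = j
  mem_disc : ∀ p : StrandParam n m, p.InDomain →
    (φ.toEquiv (L.curve p.1 p.2) ∈ Metric.closedBall 0 1 ↔ ∃ i, (J i).Mem p)
  mem_disc' : ∀ p : StrandParam n m, p.InDomain →
    (φ.toEquiv (L'.curve p.1 p.2) ∈ Metric.closedBall 0 1 ↔ ∃ i, (J i).Mem p)
  agree : ∀ p : StrandParam n m, p.InDomain → (¬ ∃ i, (J i).Mem p) →
    L.curve p.1 p.2 = L'.curve p.1 p.2 ∧ (L.under p.1 p.2 ↔ L'.under p.1 p.2)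

/-- First Reidemeister move: a single strand without crossing in a disc is replaced by a strand
with exactly one (arbitrary) crossing, a self-crossing. -/
def ReidemeisterOne {n m : ℕ} (L L' : LinkoidDiagram n m) : Prop :=
  ∃ (φ : PlaneDiffeo) (J : Fin 1 → StrandInterval n m), L.DifferInDisc L' φ J ∧
    L.EmbeddedOn (J 0) ∧
    ∃ s ∈ Ioo (J 0).lo (J 0).hi, ∃ t ∈ Ioo (J 0).lo (J 0).hi, s < t ∧
      ∀ x ∈ Icc (J 0).lo (J 0).hi, ∀ y ∈ Icc (J 0).lo (J 0).hi, x < y →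
        (L'.curve (J 0).comp x = L'.curve (J 0).comp y ↔ x = s ∧ y = t)

/-- Second Reidemeister move: in suitable coordinates of a disc, the strand `J 0` is a diameter,
and the strand `J 1`, which lies on one side of it, is pushed under it, so that it crosses
`J 0` exactly twice. -/
def ReidemeisterTwo {n m : ℕ} (L L' : LinkoidDiagram n m) : Prop :=
  ∃ (φ : PlaneDiffeo) (J : Fin 2 → StrandInterval n m), L.DifferInDisc L' φ J ∧
    (∀ i, L.EmbeddedOn (J i) ∧ L'.EmbeddedOn (J i)) ∧
    (∀ t ∈ Icc (J 0).lo (J 0).hi,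
      L.curve (J 0).comp t = L'.curve (J 0).comp t ∧ (L.inChart φ (J 0) t).im = 0) ∧
    (∀ t ∈ Icc (J 1).lo (J 1).hi, 0 < (L.inChart φ (J 1) t).im) ∧
    ∃ s ∈ Icc (J 1).lo (J 1).hi, ∃ t ∈ Icc (J 1).lo (J 1).hi, s < t ∧
      (∀ x ∈ Icc (J 1).lo (J 1).hi, (L'.inChart φ (J 1) x).im = 0 ↔ x = s ∨ x = t) ∧
      L'.under (J 1).comp s ∧ L'.under (J 1).comp t

/-- In the coordinates `φ`, the strand `J` crosses the real axis exactly once and the imaginary axis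
exactly once, both times as the lower strand; `σ = 1`: on the positive half-axes,
`σ = -1`: on the negative ones. -/
def PassesUnderAxes {n m : ℕ} (L : LinkoidDiagram n m) (φ : PlaneDiffeo)
    (J : StrandInterval n m) (σ : ℝ) : Prop :=
  ∃ s ∈ Icc J.lo J.hi, ∃ t ∈ Icc J.lo J.hi,
    (∀ x ∈ Icc J.lo J.hi, (L.inChart φ J x).im = 0 ↔ x = s) ∧ 0 < σ * (L.inChart φ J s).re ∧
    (∀ x ∈ Icc J.lo J.hi, (L.inChart φ J x).re = 0 ↔ x = t) ∧ 0 < σ * (L.inChart φ J t).im ∧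
    L.under J.comp s ∧ L.under J.comp t

/-- Third Reidemeister move: in suitable coordinates of a disc, `J 0` and `J 1` are the horizontal
and the vertical diameter, either of which may be the upper one, and the strand `J 2`, which
passes under both of them on one side of their crossing, is pushed under that crossing to the
other side. -/
def ReidemeisterThree {n m : ℕ} (L L' : LinkoidDiagram n m) : Prop :=
  ∃ (φ : PlaneDiffeo) (J : Fin 3 → StrandInterval n m), L.DifferInDisc L' φ J ∧
    (∀ i, L.EmbeddedOn (J i) ∧ L'.EmbeddedOn (J i)) ∧
    (∀ t ∈ Icc (J 0).lo (J 0).hi,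
      L.curve (J 0).comp t = L'.curve (J 0).comp t ∧ (L.inChart φ (J 0) t).im = 0 ∧
      (L.inChart φ (J 0) t = 0 → (L.under (J 0).comp t ↔ L'.under (J 0).comp t))) ∧
    (∀ t ∈ Icc (J 1).lo (J 1).hi,
      L.curve (J 1).comp t = L'.curve (J 1).comp t ∧ (L.inChart φ (J 1) t).re = 0) ∧
    L.PassesUnderAxes φ (J 2) 1 ∧ L'.PassesUnderAxes φ (J 2) (-1)

/-- A single move. -/
inductive Move {n m : ℕ} : LinkoidDiagram n m → LinkoidDiagram n m → Prop
  | isotopy {L L' : LinkoidDiagram n m} : L.PlanarIsotopy L' → Move L L'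
  | one {L L' : LinkoidDiagram n m} : L.ReidemeisterOne L' → Move L L'
  | two {L L' : LinkoidDiagram n m} : L.ReidemeisterTwo L' → Move L L'
  | three {L L' : LinkoidDiagram n m} : L.ReidemeisterThree L' → Move L L'
  | spherical {L L' : LinkoidDiagram n m} : L.SphericalMove L' → Move L L'

/-- Two diagrams are equivalent if they are connected by a finite sequence of moves and inverses
of moves. -/
def Equivalent {n m : ℕ} (L L' : LinkoidDiagram n m) : Prop := Relation.EqvGen Move L L'

end LinkoidDiagram

open Filter Topology Quandles
open scoped Pointwise

/-! ## Presented quandles -/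

/-! The fundamental quandle is determined by what it represents: a homomorphism from `Q(L)` to a
quandle `X` is the same thing as a colouring of `L` by `X`, that is, a function on the components
that is constant along arcs and that changes at every undercrossing by the action of the colour of
the upper branch, or by the inverse of that action, according to the sign of the crossing
(`isColoring_universalColoring`, `IsColoring.exists_hom`). Hence it suffices to match the colourings
of `L` and `L'` by all quandles. `isIsomorphic_of_isColoring` does this by restriction to a common
set of points: if colourings are determined by their restriction to that set, and the same
restrictions occur for both diagrams, then the universal colourings yield mutually inverse
homomorphisms. Legs and heads belong to the set, so the homomorphisms respect the basepoints.

Planar isotopies and spherical moves apply an injective map with orientation-preserving derivative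
to the diagram (for the spherical move a holomorphic one, `w ↦ (w - z)⁻¹`). Crossings and their
signs correspond, and colourings are transported by reparametrization: `isIsomorphic_of_transform`.

For a Reidemeister move the common set consists of the points off the strands in the disc.
`DifferInDisc.isIsomorphic` reduces the claim to the disc: local colourings of the two pictures must
realize the same colours at the ends of the strands, and must be determined by the colours at the
incoming ends. Each move then uses one quandle axiom. In the first, idempotence makes the jump at a
self-crossing trivial (`crossingPerm_self`). In the second, the two crossings have opposite signs,
so the jumps cancel (`crossingPerm_eq_inv`). In the third, self-distributivity, read as conjugation
of the action maps (`act'_signPerm`), makes the two orders of passing under the upper strands agree.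

The moves are given geometrically, without crossing signs. These are recovered from signs of
derivatives at transverse zeros of the coordinate functions (`sign_deriv_eq_left`,
`sign_deriv_eq_right`). Colourings are left-continuous functions of the real parameter, so all
conditions are one-sided and local; constancy along arcs is connectedness of intervals
(`eqOn_Ioc_of_eventually`). -/

/-- Evaluation of a word in a quandle. -/
def QuandleWord.eval {A X : Type} [Quandle X] (f : A → X) : QuandleWord A → X
  | .of a => f a
  | .act x y => x.eval f ◃ y.eval f
  | .invAct x y => x.eval f ◃⁻¹ y.eval f

theorem QuandleCongr.eval_eq {A X : Type} [Quandle X] {f : A → X}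
    {r : QuandleWord A → QuandleWord A → Prop} (h : ∀ x y, r x y → x.eval f = y.eval f)
    {x y : QuandleWord A} (hxy : QuandleCongr r x y) : x.eval f = y.eval f := by
  induction hxy with
  | rel hr => exact h _ _ hr
  | refl => rfl
  | symm _ ih => exact ih.symm
  | trans _ _ ih ih' => exact ih.trans ih'
  | congr_act _ _ ih ih' => simp only [QuandleWord.eval, ih, ih']
  | congr_invAct _ _ ih ih' => simp only [QuandleWord.eval, ih, ih']
  | self_distrib x y z => exact Shelf.self_distrib
  | left_inv x y => exact Rack.left_inv _ _
  | right_inv x y => exact Rack.right_inv _ _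
  | fix x => exact Quandle.fix

/-- Acting by `f x` is injective, and it sends both sides to `f y`. -/
theorem ShelfHom.map_invAct {X Y : Type} [Quandle X] [Quandle Y] (f : X →◃ Y) (x y : X) :
    f (x ◃⁻¹ y) = f x ◃⁻¹ f y := by
  rw [← Rack.left_cancel (f x), ← ShelfHom.map_act, Rack.act_invAct_eq, Rack.act_invAct_eq]

namespace PresentedQuandle

/-- The homomorphism out of a presented quandle given by the images of the generators. -/
def lift {A X : Type} [Quandle X] (r : QuandleWord A → QuandleWord A → Prop) (f : A → X)
    (h : ∀ x y, r x y → x.eval f = y.eval f) : PresentedQuandle r →◃ X where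
  toFun := Quotient.lift (QuandleWord.eval f) fun _ _ hxy => QuandleCongr.eval_eq h hxy
  map_act' := by
    rintro ⟨x⟩ ⟨y⟩
    rfl

theorem hom_ext {A X : Type} [Quandle X] {r : QuandleWord A → QuandleWord A → Prop}
    {f g : PresentedQuandle r →◃ X} (h : ∀ a, f (of r a) = g (of r a)) (x : PresentedQuandle r) :
    f x = g x := by
  obtain ⟨w⟩ := x
  induction w with
  | of a => exact h a
  | act x y ihx ihy =>
    refine (f.map_act (x := Quotient.mk _ x) (y := Quotient.mk _ y)).trans
      (Eq.trans ?_ (g.map_act (x := Quotient.mk _ x) (y := Quotient.mk _ y)).symm)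
    exact congrArg₂ _ ihx ihy
  | invAct x y ihx ihy =>
    refine (f.map_invAct (Quotient.mk _ x) (Quotient.mk _ y)).trans
      (Eq.trans ?_ (g.map_invAct (Quotient.mk _ x) (Quotient.mk _ y)).symm)
    exact congrArg₂ _ ihx ihy

theorem of_eq_act {A : Type} {r : QuandleWord A → QuandleWord A → Prop} {a b c : A}
    (h : r (.of a) (.act (.of b) (.of c))) : of r a = of r b ◃ of r c :=
  Quotient.sound (s := quandleSetoid r) (QuandleCongr.rel h)

end PresentedQuandle

/-! ## Locally constant functions on intervals -/

/-- With the discrete topology on `X` the one-sided conditions say that `g` is continuous on an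
interval, which is preconnected. The value at `a` itself plays no role, so `a` may be a jump. -/
theorem eqOn_Ioc_of_eventually {X : Type} {g : ℝ → X} {a b : ℝ} {v : X}
    (hl : ∀ t ∈ Ioc a b, ∀ᶠ s in 𝓝[<] t, g s = g t)
    (hr : ∀ t ∈ Ioo a b, ∀ᶠ s in 𝓝[>] t, g s = g t)
    (ha : ∀ᶠ s in 𝓝[>] a, g s = v) : ∀ t ∈ Ioc a b, g t = v := by
  intro t ht
  let _ : TopologicalSpace X := ⊥
  have : DiscreteTopology X := ⟨rfl⟩
  have hc : ContinuousOn g (Ioc a b) := by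
    intro x hx
    rw [ContinuousWithinAt, nhds_discrete, tendsto_pure]
    have h1 : ∀ᶠ s in 𝓝[≤] x, g s = g x := by
      rw [← Iio_insert, nhdsWithin_insert, eventually_sup]
      exact ⟨by simp, hl x hx⟩
    rcases hx.2.lt_or_eq with h | h
    · have h2 : ∀ᶠ s in 𝓝 x, g s = g x := by
        rw [← nhdsLE_sup_nhdsGT, eventually_sup]
        exact ⟨h1, hr x ⟨hx.1, h⟩⟩
      exact h2.filter_mono nhdsWithin_le_nhds
    · exact h1.filter_mono (nhdsWithin_mono _ fun s hs => h ▸ hs.2)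
  obtain ⟨s, hs, hs'⟩ := (ha.and (Ioc_mem_nhdsGT ht.1)).exists
  rw [← hs]
  exact isPreconnected_Ioc.constant hc ht ⟨hs'.1, hs'.2.trans ht.2⟩

theorem eqOn_Icc_of_eventually {X : Type} {g : ℝ → X} {a b : ℝ}
    (hl : ∀ t ∈ Ioc a b, ∀ᶠ s in 𝓝[<] t, g s = g t)
    (hr : ∀ t ∈ Ico a b, ∀ᶠ s in 𝓝[>] t, g s = g t) : ∀ t ∈ Icc a b, g t = g a := by
  intro t ht
  rcases ht.1.eq_or_lt with h | h
  · rw [h]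
  · exact eqOn_Ioc_of_eventually hl (fun s hs => hr s ⟨hs.1.le, hs.2⟩)
      (hr a ⟨le_rfl, h.trans_le ht.2⟩) t ⟨h, ht.2⟩

/-! ## Colourings of diagrams by quandles -/

/-- The permutation `y ▷ ·` or its inverse, according to the sign of `d`. -/
noncomputable def crossingPerm {X : Type} [Quandle X] (d : ℝ) (y : X) : Equiv.Perm X :=
  Rack.act' y ^ ((SignType.sign d : SignType) : ℤ)

theorem crossingPerm_of_pos {X : Type} [Quandle X] {d : ℝ} (hd : 0 < d) (y x : X) :
    crossingPerm d y x = y ◃ x := by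
  simp [crossingPerm, sign_pos hd]

theorem crossingPerm_of_neg {X : Type} [Quandle X] {d : ℝ} (hd : d < 0) (y x : X) :
    crossingPerm d y x = y ◃⁻¹ x := by
  simp [crossingPerm, sign_neg hd]

/-- Only signs of determinants matter, so velocities may be rescaled and transformed by
orientation-preserving maps. -/
theorem crossingPerm_congr {X : Type} [Quandle X] {d d' : ℝ}
    (h : SignType.sign d = SignType.sign d') (y : X) : crossingPerm d y = crossingPerm d' y := by
  rw [crossingPerm, crossingPerm, h]

theorem ShelfHom.map_crossingPerm {X Y : Type} [Quandle X] [Quandle Y] (f : X →◃ Y) (d : ℝ)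
    (y x : X) : f (crossingPerm d y x) = crossingPerm d (f y) (f x) := by
  rcases lt_trichotomy d 0 with h | h | h
  · rw [crossingPerm_of_neg h, crossingPerm_of_neg h, f.map_invAct]
  · simp [crossingPerm, h]
  · rw [crossingPerm_of_pos h, crossingPerm_of_pos h, f.map_act]

namespace LinkoidDiagram

variable {n m : ℕ}

/-- A colouring of the diagram `L` by a quandle. The colour of an undercrossing point is that of the
incoming lower arc, and the colour of an open component is extended beyond its endpoints. -/
structure IsColoring (L : LinkoidDiagram n m) {X : Type} [Quandle X]
    (c : Fin n ⊕ Fin m → ℝ → X) : Prop where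
  periodic : ∀ j t, c (Sum.inr j) (t + 1) = c (Sum.inr j) t
  left : ∀ k t, ∀ᶠ s in 𝓝[<] t, c k s = c k t
  right : ∀ k t, ¬ L.under k t → ∀ᶠ s in 𝓝[>] t, c k s = c k t
  cross : ∀ k t, L.under k t → ∀ q : StrandParam n m, q.InDomain →
    ¬ StrandParam.Same (k, t) q → L.curve q.1 q.2 = L.curve k t →
    ∀ᶠ s in 𝓝[>] t,
      c k s = crossingPerm (planeDet (deriv (L.curve q.1) q.2) (deriv (L.curve k) t)) (c q.1 q.2)
        (c k t)

theorem under_add_int (L : LinkoidDiagram n m) (j : Fin m) (t : ℝ) (z : ℤ) :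
    L.under (Sum.inr j) (t + z) ↔ L.under (Sum.inr j) t := by
  have h : Function.Periodic (L.under (Sum.inr j)) 1 := fun t => propext (L.under_periodic j t)
  have := h.int_mul z t
  rw [mul_one] at this
  rw [this]

theorem curve_add_int (L : LinkoidDiagram n m) (j : Fin m) (t : ℝ) (z : ℤ) :
    L.curve (Sum.inr j) (t + z) = L.curve (Sum.inr j) t := by
  have h : Function.Periodic (L.curve (Sum.inr j)) 1 := L.curve_periodic j
  have := h.int_mul z t
  rwa [mul_one] at this

theorem IsColoring.add_int {L : LinkoidDiagram n m} {X : Type} [Quandle X]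
    {c : Fin n ⊕ Fin m → ℝ → X} (hc : L.IsColoring c) (j : Fin m) (t : ℝ) (z : ℤ) :
    c (Sum.inr j) (t + z) = c (Sum.inr j) t := by
  have h : Function.Periodic (c (Sum.inr j)) 1 := hc.periodic j
  have := h.int_mul z t
  rwa [mul_one] at this

theorem mem_Ioo_of_under (L : LinkoidDiagram n m) {i : Fin n} {t : ℝ}
    (h : L.under (Sum.inl i) t) : t ∈ Ioo (0 : ℝ) 1 := by
  have h1 := (L.under_double (Sum.inl i, t) h).1 rfl
  refine ⟨lt_of_le_of_ne h1.1 ?_, lt_of_le_of_ne h1.2 ?_⟩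
  · rintro rfl
    exact L.not_under_endpoint i 0 (Or.inl rfl) h
  · rintro rfl
    exact L.not_under_endpoint i 1 (Or.inr rfl) h

/-- On a closed component a parameter is its fractional part, which has finitely many choices by
`finite_crossings`, plus an integer between `⌊a⌋` and `⌊b⌋`. -/
theorem finite_under (L : LinkoidDiagram n m) (k : Fin n ⊕ Fin m) (a b : ℝ) :
    {t | t ∈ Icc a b ∧ L.under k t}.Finite := by
  rcases k with i | j
  · refine (L.finite_crossings.image Prod.snd).subset ?_
    rintro t ⟨-, ht⟩
    exact ⟨(Sum.inl i, t), ⟨Ioo_subset_Icc_self (L.mem_Ioo_of_under ht), ht⟩, rfl⟩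
  · refine ((L.finite_crossings.prod (finite_Icc ⌊a⌋ ⌊b⌋)).image
      fun x => x.1.2 + (x.2 : ℝ)).subset ?_
    rintro t ⟨ht, hu⟩
    refine ⟨((Sum.inr j, Int.fract t), ⌊t⌋), ⟨⟨⟨Int.fract_nonneg t, (Int.fract_lt_one t).le⟩, ?_⟩,
      Int.floor_le_floor ht.1, Int.floor_le_floor ht.2⟩, Int.fract_add_floor t⟩
    rwa [← L.under_add_int j _ ⌊t⌋, Int.fract_add_floor]

theorem eventually_not_under (L : LinkoidDiagram n m) (k : Fin n ⊕ Fin m) (t : ℝ) :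
    ∀ᶠ s in 𝓝[≠] t, ¬ L.under k s := by
  have h1 : ({s | s ∈ Icc (t - 1) (t + 1) ∧ L.under k s} \ {t})ᶜ ∈ 𝓝 t :=
    ((L.finite_under k (t - 1) (t + 1)).subset sdiff_subset).isClosed.isOpen_compl.mem_nhds
      fun h => h.2 rfl
  have h2 : Icc (t - 1) (t + 1) ∈ 𝓝 t := Icc_mem_nhds (by linarith) (by linarith)
  filter_upwards [nhdsWithin_le_nhds h1, nhdsWithin_le_nhds h2, self_mem_nhdsWithin] with s h1 h2 h3
  exact fun h => h1 ⟨⟨h2, h⟩, h3⟩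

theorem exists_not_under_left (L : LinkoidDiagram n m) (k : Fin n ⊕ Fin m) (t : ℝ) :
    ∃ l < t, ∀ r ∈ Ico l t, ¬ L.under k r := by
  have h := (L.eventually_not_under k t).filter_mono
    (nhdsWithin_mono t fun s (hs : s < t) => hs.ne)
  obtain ⟨l, hl, h⟩ := mem_nhdsLT_iff_exists_Ico_subset.1 h
  exact ⟨l, hl, h⟩

theorem exists_not_under_right (L : LinkoidDiagram n m) (k : Fin n ⊕ Fin m) (t : ℝ) :
    ∃ u > t, ∀ r ∈ Ioc t u, ¬ L.under k r := by
  have h := (L.eventually_not_under k t).filter_mono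
    (nhdsWithin_mono t fun s (hs : t < s) => hs.ne')
  obtain ⟨l, hl, h⟩ := mem_nhdsGT_iff_exists_Ioc_subset.1 h
  exact ⟨l, hl, h⟩

/-- Colours do not change along an interval without undercrossing points. -/
theorem IsColoring.eq_of_not_under {L : LinkoidDiagram n m} {X : Type} [Quandle X]
    {c : Fin n ⊕ Fin m → ℝ → X} (hc : L.IsColoring c) {k : Fin n ⊕ Fin m} {a b : ℝ} (hab : a ≤ b)
    (h : ∀ t ∈ Ico a b, ¬ L.under k t) : c k b = c k a :=
  eqOn_Icc_of_eventually (fun t _ => hc.left k t) (fun t ht => hc.right k t (h t ht)) b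
    ⟨hab, le_rfl⟩

/-- The nearest parameter in the domain of the component. -/
def clampParam : Fin n ⊕ Fin m → ℝ → ℝ
  | Sum.inl _, t => max 0 (min 1 t)
  | Sum.inr _, t => t

theorem inDomain_clampParam (k : Fin n ⊕ Fin m) (t : ℝ) :
    StrandParam.InDomain ((k, clampParam k t) : StrandParam n m) := by
  intro hk
  rcases k with i | j
  · exact ⟨le_max_left _ _, max_le zero_le_one (min_le_left _ _)⟩
  · simp at hk

theorem clampParam_eq {k : Fin n ⊕ Fin m} {t : ℝ}
    (h : StrandParam.InDomain ((k, t) : StrandParam n m)) : clampParam k t = t := by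
  rcases k with i | j
  · have := h rfl
    simp only [clampParam]
    rw [min_eq_right this.2, max_eq_right this.1]
  · rfl

theorem clampParam_mono (k : Fin n ⊕ Fin m) : Monotone (clampParam k) := by
  intro s t h
  rcases k with i | j
  · exact max_le_max le_rfl (min_le_min le_rfl h)
  · exact h

/-- A point between clamped parameters is between the original ones or beyond an endpoint. -/
theorem mem_Icc_of_clampParam (L : LinkoidDiagram n m) {k : Fin n ⊕ Fin m} {a b r : ℝ}
    (hr : r ∈ Icc (clampParam k a) (clampParam k b)) (hu : L.under k r) : r ∈ Icc a b := by
  rcases k with i | j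
  · have h1 := L.mem_Ioo_of_under hu
    obtain ⟨h2, h3⟩ := hr
    simp only [clampParam] at h2 h3
    constructor
    · have := (le_max_right _ _).trans h2
      rcases min_le_iff.1 this with h | h
      · linarith [h1.2]
      · exact h
    · rcases le_max_iff.1 h3 with h | h
      · linarith [h1.1]
      · exact (le_min_iff.1 h).2
  · exact hr

theorem not_under_clampParam (L : LinkoidDiagram n m) {k : Fin n ⊕ Fin m} {t : ℝ}
    (h : ¬ L.under k t) : ¬ L.under k (clampParam k t) := by
  intro hu
  have := L.mem_Icc_of_clampParam (a := t) (b := t) ⟨le_rfl, le_rfl⟩ hu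
  rw [le_antisymm this.2 this.1] at hu
  exact h hu

/-- There are no undercrossings outside `(0,1)` on an open component, so the colour is constant
beyond the endpoints. -/
theorem IsColoring.clampParam_eq {L : LinkoidDiagram n m} {X : Type} [Quandle X]
    {c : Fin n ⊕ Fin m → ℝ → X} (hc : L.IsColoring c) (k : Fin n ⊕ Fin m) (t : ℝ) :
    c k (clampParam k t) = c k t := by
  rcases k with i | j
  · have h0 : ∀ r, ¬ r ∈ Ioo (0 : ℝ) 1 → ¬ L.under (Sum.inl i) r :=
      fun r hr hu => hr (L.mem_Ioo_of_under hu)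
    rcases le_total t 0 with h | h
    · have : clampParam (Sum.inl i : Fin n ⊕ Fin m) t = 0 :=
        max_eq_left ((min_le_right _ _).trans h)
      rw [this]
      exact hc.eq_of_not_under h fun r hr => h0 r fun h' => by linarith [h'.1, hr.2]
    · rcases le_total t 1 with h' | h'
      · rw [LinkoidDiagram.clampParam_eq fun _ => ⟨h, h'⟩]
      · have : clampParam (Sum.inl i : Fin n ⊕ Fin m) t = 1 := by
          simp only [clampParam]
          rw [min_eq_left h', max_eq_right zero_le_one]
        rw [this]
        exact (hc.eq_of_not_under h' fun r hr => h0 r fun h' => by linarith [h'.2, hr.1]).symm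
  · rfl

/-! ### The universal colouring and its universal property -/

/-- The class in the fundamental quandle of the arc through a point. -/
def arcClass (L : LinkoidDiagram n m) (k : Fin n ⊕ Fin m) (t : ℝ) (h : ¬ L.under k t) :
    L.fundamentalQuandle :=
  PresentedQuandle.of L.CrossingRel
    (L.arcOf ⟨(k, clampParam k t), inDomain_clampParam k t, L.not_under_clampParam h⟩)

theorem arcClass_eq (L : LinkoidDiagram n m) {k : Fin n ⊕ Fin m} {a b : ℝ} (hab : a ≤ b)
    (h : ∀ t ∈ Icc a b, ¬ L.under k t) (ha : ¬ L.under k a) (hb : ¬ L.under k b) :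
    L.arcClass k a ha = L.arcClass k b hb := by
  refine congrArg (PresentedQuandle.of L.CrossingRel)
    (Quot.sound (Or.inr ⟨rfl, clampParam_mono k hab, fun t ht hu => ?_⟩))
  exact h t (L.mem_Icc_of_clampParam ht hu) hu

/-- The colouring by the fundamental quandle. -/
noncomputable def universalColoring (L : LinkoidDiagram n m) (k : Fin n ⊕ Fin m) (t : ℝ) :
    L.fundamentalQuandle :=
  L.arcClass k (L.exists_not_under_left k t).choose
    ((L.exists_not_under_left k t).choose_spec.2 _
      ⟨le_rfl, (L.exists_not_under_left k t).choose_spec.1⟩)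

/-- Independence of the chosen parameter: two parameters to the left of `t`, each reaching `t`
without an undercrossing, lie on the same arc. -/
theorem universalColoring_eq_of_lt (L : LinkoidDiagram n m) {k : Fin n ⊕ Fin m} {a t : ℝ}
    (hat : a < t) (h : ∀ r ∈ Ico a t, ¬ L.under k r) :
    L.universalColoring k t = L.arcClass k a (h a ⟨le_rfl, hat⟩) := by
  obtain ⟨h1, h2⟩ := (L.exists_not_under_left k t).choose_spec
  rw [universalColoring]
  rcases le_total a (L.exists_not_under_left k t).choose with h3 | h3
  · exact (L.arcClass_eq h3 (fun r hr => h r ⟨hr.1, hr.2.trans_lt h1⟩) _ _).symm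
  · exact L.arcClass_eq h3 (fun r hr => h2 r ⟨hr.1, hr.2.trans_lt hat⟩) _ _

theorem universalColoring_eq (L : LinkoidDiagram n m) {k : Fin n ⊕ Fin m} {t : ℝ}
    (h : ¬ L.under k t) : L.universalColoring k t = L.arcClass k t h := by
  obtain ⟨l, hl, h1⟩ := L.exists_not_under_left k t
  rw [L.universalColoring_eq_of_lt hl h1]
  refine L.arcClass_eq hl.le (fun r hr => ?_) _ _
  rcases hr.2.eq_or_lt with h' | h'
  · rwa [h']
  · exact h1 r ⟨hr.1, h'⟩

theorem universalColoring_arcPoint (L : LinkoidDiagram n m) (p : L.ArcPoint) :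
    L.universalColoring p.1.1 p.1.2 = PresentedQuandle.of L.CrossingRel (L.arcOf p) := by
  rw [L.universalColoring_eq p.2.2, arcClass]
  refine congrArg _ (congrArg _ (Subtype.ext (Prod.ext rfl ?_)))
  exact clampParam_eq p.2.1

/-- Being joined gives local constancy and periodicity; the defining relations of `Q(L)` give
precisely the jumps at undercrossings. -/
theorem isColoring_universalColoring (L : LinkoidDiagram n m) :
    L.IsColoring L.universalColoring where
  periodic j t := by
    obtain ⟨l, hl, h⟩ := L.exists_not_under_left (Sum.inr j) t
    have h' : ∀ r ∈ Ico (l + 1) (t + 1), ¬ L.under (Sum.inr j) r := by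
      intro r hr hu
      refine h (r - 1) ⟨by linarith [hr.1], by linarith [hr.2]⟩ ?_
      rw [← L.under_periodic, sub_add_cancel]
      exact hu
    rw [L.universalColoring_eq_of_lt hl h,
      L.universalColoring_eq_of_lt (a := l + 1) (by linarith) h']
    refine congrArg (PresentedQuandle.of L.CrossingRel)
      (Quot.sound (Or.inl ⟨rfl, Or.inr ⟨rfl, -1, ?_⟩⟩))
    simp [clampParam]
  left k t := by
    obtain ⟨l, hl, h⟩ := L.exists_not_under_left k t
    filter_upwards [Ioo_mem_nhdsLT hl] with s hs
    rw [L.universalColoring_eq_of_lt hl h,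
      L.universalColoring_eq_of_lt hs.1 fun r hr => h r ⟨hr.1, hr.2.trans hs.2⟩]
  right k t ht := by
    obtain ⟨u, hu, h⟩ := L.exists_not_under_right k t
    filter_upwards [Ioc_mem_nhdsGT hu] with s hs
    rw [L.universalColoring_eq (h s hs), L.universalColoring_eq ht]
    refine (L.arcClass_eq hs.1.le (fun r hr => ?_) _ _).symm
    rcases hr.1.eq_or_lt with h' | h'
    · rwa [← h']
    · exact h r ⟨h', hr.2.trans hs.2⟩
  cross k t ht q hq hne he := by
    obtain ⟨l, hl, h1⟩ := L.exists_not_under_left k t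
    obtain ⟨u, hu, h2⟩ := L.exists_not_under_right k t
    have hqu : ¬ L.under q.1 q.2 :=
      (L.under_xor (k, t) q (L.under_double (k, t) ht).1 hq hne he.symm).1 ht
    filter_upwards [Ioc_mem_nhdsGT hu] with s hs
    -- An undercrossing is interior to its component, so clamping `l` and `s` does not move them
    -- past `t`.
    have hlt : clampParam k l < t ∧ t < clampParam k s := by
      rcases k with i | j
      · have := L.mem_Ioo_of_under ht
        exact ⟨max_lt this.1 ((min_le_right _ _).trans_lt hl),
          lt_max_of_lt_right (lt_min this.2 hs.1)⟩
      · exact ⟨hl, hs.1⟩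
    rw [L.universalColoring_arcPoint ⟨q, hq, hqu⟩, L.universalColoring_eq_of_lt hl h1,
      L.universalColoring_eq (h2 s hs)]
    have hX : L.IsCrossingAt ⟨q, hq, hqu⟩
        ⟨(k, clampParam k l), inDomain_clampParam k l,
          L.not_under_clampParam (h1 l ⟨le_rfl, hl⟩)⟩
        ⟨(k, clampParam k s), inDomain_clampParam k s, L.not_under_clampParam (h2 s hs)⟩
        (planeDet (deriv (L.curve q.1) q.2) (deriv (L.curve k) t)) := by
      refine ⟨t, ht, rfl, hlt.1, hlt.2, fun r hr hur => ?_, he, rfl⟩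
      have hr' := L.mem_Icc_of_clampParam hr hur
      rcases lt_trichotomy r t with h | h | h
      · exact (h1 r ⟨hr'.1, h⟩ hur).elim
      · exact h
      · exact (h2 r ⟨h, hr'.2.trans hs.2⟩ hur).elim
    have hne' : ¬ q.Same (k, t) := by
      rintro ⟨h1, h2⟩
      refine hne ⟨h1.symm, ?_⟩
      rcases h2 with h2 | ⟨h2, z, h3⟩
      · exact Or.inl h2.symm
      · refine Or.inr ⟨h1 ▸ h2, -z, ?_⟩
        simp only at h3 ⊢
        rw [h3]
        push_cast
        ring
    rcases (L.transverse q (k, t) hq (L.under_double (k, t) ht).1 hne' he).lt_or_gt with hd | hd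
    -- For a negative crossing the relation expresses the incoming arc by the outgoing one;
    -- cancelling the action of the upper arc inverts it.
    · rw [crossingPerm_of_neg hd,
        ← Rack.left_cancel (PresentedQuandle.of L.CrossingRel (L.arcOf ⟨q, hq, hqu⟩)),
        Rack.act_invAct_eq]
      exact (PresentedQuandle.of_eq_act (CrossingRel.neg _ _ _ _ hX hd)).symm
    · rw [crossingPerm_of_pos hd]
      exact PresentedQuandle.of_eq_act (CrossingRel.pos _ _ _ _ hX hd)

theorem IsColoring.comp {L : LinkoidDiagram n m} {X Y : Type} [Quandle X] [Quandle Y]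
    {c : Fin n ⊕ Fin m → ℝ → X} (hc : L.IsColoring c) (f : X →◃ Y) :
    L.IsColoring fun k t => f (c k t) where
  periodic j t := congrArg f (hc.periodic j t)
  left k t := (hc.left k t).mono fun _ h => congrArg f h
  right k t ht := (hc.right k t ht).mono fun _ h => congrArg f h
  cross k t ht q hq hne he := (hc.cross k t ht q hq hne he).mono fun s h => by
    rw [h, f.map_crossingPerm]

/-- A colouring is determined by the colours of the points that are not undercrossings. -/
theorem IsColoring.ext_arcPoint {L : LinkoidDiagram n m} {X : Type} [Quandle X]
    {c c' : Fin n ⊕ Fin m → ℝ → X} (hc : L.IsColoring c) (hc' : L.IsColoring c')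
    (h : ∀ p : L.ArcPoint, c p.1.1 p.1.2 = c' p.1.1 p.1.2) : c = c' := by
  funext k t
  obtain ⟨l, hl, h1⟩ := L.exists_not_under_left k t
  rw [hc.eq_of_not_under hl.le h1, hc'.eq_of_not_under hl.le h1, ← hc.clampParam_eq,
    ← hc'.clampParam_eq]
  exact h ⟨(k, clampParam k l), inDomain_clampParam k l, L.not_under_clampParam (h1 l ⟨le_rfl, hl⟩)⟩

/-- Colourings correspond to homomorphisms from the fundamental quandle. -/
theorem IsColoring.exists_hom {L : LinkoidDiagram n m} {X : Type} [Quandle X]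
    {c : Fin n ⊕ Fin m → ℝ → X} (hc : L.IsColoring c) :
    ∃ f : L.fundamentalQuandle →◃ X, ∀ k t, f (L.universalColoring k t) = c k t := by
  have hJ : ∀ p q : L.ArcPoint, L.Joined p q → c p.1.1 p.1.2 = c q.1.1 q.1.2 := by
    rintro ⟨⟨k, t⟩, hp⟩ ⟨⟨k', t'⟩, hq⟩ (⟨h1, h2⟩ | ⟨h1, h2, h3⟩) <;> dsimp only at h1 h2 ⊢ <;>
      subst h1
    · rcases h2 with rfl | ⟨hk, z, rfl⟩
      · rfl
      · rcases k with i | j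
        · simp at hk
        · exact (hc.add_int j t z).symm
    · exact (hc.eq_of_not_under h2 fun r hr => h3 r ⟨hr.1, hr.2.le⟩).symm
  -- The jump condition is local at the crossing; constancy up to `t` and after `t` carries it to
  -- the given points `a` and `a'`.
  have hX : ∀ (b a a' : L.ArcPoint) (d : ℝ), L.IsCrossingAt b a a' d →
      c a'.1.1 a'.1.2 = crossingPerm d (c b.1.1 b.1.2) (c a.1.1 a.1.2) := by
    rintro ⟨q, hq⟩ ⟨⟨k, a⟩, ha⟩ ⟨⟨k', a'⟩, ha'⟩ d ⟨t, hu, h1, h2, h3, h4, h5, rfl⟩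
    dsimp only at hu h1 h2 h3 h4 h5 ⊢
    subst h1
    -- The point `q` is an arc point, hence not an undercrossing, whereas `t` is one.
    have hne : ¬ StrandParam.Same (k', t) q := by
      rintro ⟨hk, hs⟩
      refine hq.2 ?_
      rw [← hk]
      rcases hs with hs | ⟨hr, z, hs⟩
      · rwa [← hs]
      · rcases k' with i | j
        · simp at hr
        · rw [hs]
          exact (L.under_add_int j t z).2 hu
    have e1 : c k' t = c k' a := hc.eq_of_not_under h2.le fun r hr hur =>
      hr.2.ne (h4 r ⟨hr.1, (hr.2.trans h3).le⟩ hur)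
    have e2 := eqOn_Ioc_of_eventually (a := t) (b := a') (fun r _ => hc.left k' r)
      (fun r hr => hc.right k' r fun hur =>
        hr.1.ne' (h4 r ⟨(h2.trans hr.1).le, hr.2.le⟩ hur))
      (hc.cross k' t hu q hq.1 hne h5) a' ⟨h3, le_rfl⟩
    rw [e2, e1]
  let f : L.fundamentalQuandle →◃ X := PresentedQuandle.lift L.CrossingRel
    (Quot.lift (fun p : L.ArcPoint => c p.1.1 p.1.2) hJ) (by
      rintro _ _ (⟨b, a, a', d, h, hd⟩ | ⟨b, a, a', d, h, hd⟩)
      · have := hX b a a' d h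
        rw [crossingPerm_of_pos hd] at this
        exact this
      · have := hX b a a' d h
        rw [crossingPerm_of_neg hd] at this
        refine Eq.trans ?_ (congrArg (c b.1.1 b.1.2 ◃ ·) this.symm)
        exact (Rack.act_invAct_eq _ _).symm)
  refine ⟨f, fun k t => ?_⟩
  refine congrFun (congrFun ((L.isColoring_universalColoring.comp f).ext_arcPoint hc fun p => ?_) k) t
  rw [L.universalColoring_arcPoint]
  rfl

/-- Every generator is the value of the universal colouring at some arc point. -/
theorem hom_ext {L : LinkoidDiagram n m} {X : Type} [Quandle X]
    {f g : L.fundamentalQuandle →◃ X}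
    (h : ∀ k t, f (L.universalColoring k t) = g (L.universalColoring k t))
    (x : L.fundamentalQuandle) : f x = g x := by
  refine PresentedQuandle.hom_ext (fun a => ?_) x
  obtain ⟨p, rfl⟩ := Quot.exists_rep a
  have := h p.1.1 p.1.2
  rwa [L.universalColoring_arcPoint] at this

/-- If colourings of `L` and of `L'` by any quandle correspond to each other by extension from a
common set of points that contains the endpoints, then the pointed quandles are isomorphic. -/
theorem isIsomorphic_of_isColoring {L L' : LinkoidDiagram n m} {S : Type}
    (ι ι' : S → StrandParam n m)
    (hι : ∀ (i : Fin n) (t : ℝ), t = 0 ∨ t = 1 → ∃ s, ι s = (Sum.inl i, t) ∧ ι' s = (Sum.inl i, t))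
    (hext : ∀ (X : Type) [Quandle X] (c : Fin n ⊕ Fin m → ℝ → X), L.IsColoring c →
      ∃ c', L'.IsColoring c' ∧ ∀ s, c' (ι' s).1 (ι' s).2 = c (ι s).1 (ι s).2)
    (hext' : ∀ (X : Type) [Quandle X] (c' : Fin n ⊕ Fin m → ℝ → X), L'.IsColoring c' →
      ∃ c, L.IsColoring c ∧ ∀ s, c (ι s).1 (ι s).2 = c' (ι' s).1 (ι' s).2)
    (huniq : ∀ (X : Type) [Quandle X] (c d : Fin n ⊕ Fin m → ℝ → X), L.IsColoring c →
      L.IsColoring d → (∀ s, c (ι s).1 (ι s).2 = d (ι s).1 (ι s).2) → c = d)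
    (huniq' : ∀ (X : Type) [Quandle X] (c d : Fin n ⊕ Fin m → ℝ → X), L'.IsColoring c →
      L'.IsColoring d → (∀ s, c (ι' s).1 (ι' s).2 = d (ι' s).1 (ι' s).2) → c = d) :
    L.fundamentalPointedQuandle.IsIsomorphic L'.fundamentalPointedQuandle := by
  -- Each universal colouring is transferred to the other diagram, and there induces a homomorphism
  -- out of that diagram's quandle.
  obtain ⟨c, hc, hcS⟩ := hext' _ _ L'.isColoring_universalColoring
  obtain ⟨c', hc', hcS'⟩ := hext _ _ L.isColoring_universalColoring
  obtain ⟨f, hf⟩ := hc.exists_hom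
  obtain ⟨g, hg⟩ := hc'.exists_hom
  -- Both are colourings of `L` by `Q(L)` with the same values on `S`, so uniqueness applies; this
  -- will give `g ∘ f = id`.
  have hgf : (fun k t => g (c k t)) = L.universalColoring :=
    huniq _ _ _ (hc.comp g) L.isColoring_universalColoring fun s => by rw [hcS, hg, hcS']
  have hfg : (fun k t => f (c' k t)) = L'.universalColoring :=
    huniq' _ _ _ (hc'.comp f) L'.isColoring_universalColoring fun s => by rw [hcS', hf, hcS]
  have hend : ∀ (i : Fin n) (t : ℝ), t = 0 ∨ t = 1 →
      f (L.universalColoring (Sum.inl i) t) = L'.universalColoring (Sum.inl i) t ∧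
      g (L'.universalColoring (Sum.inl i) t) = L.universalColoring (Sum.inl i) t := by
    intro i t ht
    obtain ⟨s, h1, h2⟩ := hι i t ht
    have h3 := hcS s
    have h4 := hcS' s
    rw [h1, h2] at h3 h4
    rw [hf, hg]
    exact ⟨h3, h4⟩
  refine ⟨⟨f, fun x y => f.map_act, fun j => ?_⟩, ⟨g, fun x y => g.map_act, fun j => ?_⟩,
    fun x => ?_, fun x => ?_⟩
  · simp only [fundamentalPointedQuandle]
    split_ifs
    · rw [← universalColoring_arcPoint, ← universalColoring_arcPoint]
      exact (hend _ 0 (Or.inl rfl)).1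
    · rw [← universalColoring_arcPoint, ← universalColoring_arcPoint]
      exact (hend _ 1 (Or.inr rfl)).1
  · simp only [fundamentalPointedQuandle]
    split_ifs
    · rw [← universalColoring_arcPoint, ← universalColoring_arcPoint]
      exact (hend _ 0 (Or.inl rfl)).2
    · rw [← universalColoring_arcPoint, ← universalColoring_arcPoint]
      exact (hend _ 1 (Or.inr rfl)).2
  · refine hom_ext (f := g.comp f) (g := ShelfHom.id _) (fun k t => ?_) x
    change g (f _) = _
    rw [hf]
    exact congrFun (congrFun hgf k) t
  · refine hom_ext (f := f.comp g) (g := ShelfHom.id _) (fun k t => ?_) x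
    change f (g _) = _
    rw [hg]
    exact congrFun (congrFun hfg k) t

end LinkoidDiagram

/-! ### Parameters that name the same point -/

theorem StrandParam.Same.refl {n m : ℕ} (p : StrandParam n m) : p.Same p := ⟨rfl, Or.inl rfl⟩

theorem StrandParam.same_inl {n m : ℕ} {i : Fin n} {t : ℝ} {q : StrandParam n m} :
    StrandParam.Same (Sum.inl i, t) q ↔ q = (Sum.inl i, t) := by
  constructor
  · rintro ⟨h1, h2 | ⟨h2, -⟩⟩
    · exact Prod.ext h1.symm h2.symm
    · simp at h2
  · rintro rfl
    exact .refl _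

theorem StrandParam.same_inr {n m : ℕ} {j : Fin m} {t : ℝ} {q : StrandParam n m} :
    StrandParam.Same (Sum.inr j, t) q ↔ ∃ z : ℤ, q = (Sum.inr j, t + z) := by
  constructor
  · rintro ⟨h1, h2 | ⟨-, z, h2⟩⟩
    · exact ⟨0, Prod.ext h1.symm (by simpa using h2.symm)⟩
    · exact ⟨z, Prod.ext h1.symm h2⟩
  · rintro ⟨z, rfl⟩
    exact ⟨rfl, Or.inr ⟨rfl, z, rfl⟩⟩

theorem StrandParam.Same.symm {n m : ℕ} {p q : StrandParam n m} (h : p.Same q) : q.Same p := by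
  obtain ⟨k | k, t⟩ := p
  · rw [same_inl.1 h]
    exact .refl _
  · obtain ⟨z, rfl⟩ := same_inr.1 h
    exact same_inr.2 ⟨-z, by simp⟩

theorem StrandParam.Same.trans {n m : ℕ} {p q r : StrandParam n m} (h : p.Same q)
    (h' : q.Same r) : p.Same r := by
  obtain ⟨k | k, t⟩ := p
  · rwa [same_inl.1 h] at h'
  · obtain ⟨z, rfl⟩ := same_inr.1 h
    obtain ⟨z', rfl⟩ := same_inr.1 h'
    exact same_inr.2 ⟨z + z', by simp [add_assoc]⟩

theorem StrandParam.Same.inDomain {n m : ℕ} {p q : StrandParam n m} (h : p.Same q)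
    (hp : p.InDomain) : q.InDomain := by
  obtain ⟨k | k, t⟩ := p
  · rwa [same_inl.1 h]
  · obtain ⟨z, rfl⟩ := same_inr.1 h
    simp [InDomain]

theorem orderIso_mem_Icc_iff {a b : ℝ} {σ : ℝ ≃o ℝ} (ha : σ a = a) (hb : σ b = b) (t : ℝ) :
    σ t ∈ Icc a b ↔ t ∈ Icc a b := by
  have h1 := σ.le_iff_le (x := a) (y := t)
  have h2 := σ.le_iff_le (x := t) (y := b)
  rw [ha] at h1
  rw [hb] at h2
  exact and_congr h1 h2

namespace LinkoidDiagram

variable {n m : ℕ}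

theorem under_same (L : LinkoidDiagram n m) {p q : StrandParam n m} (h : p.Same q) :
    L.under p.1 p.2 ↔ L.under q.1 q.2 := by
  obtain ⟨k | k, t⟩ := p
  · rw [StrandParam.same_inl.1 h]
  · obtain ⟨z, rfl⟩ := StrandParam.same_inr.1 h
    exact (L.under_add_int k t z).symm

theorem curve_same (L : LinkoidDiagram n m) {p q : StrandParam n m} (h : p.Same q) :
    L.curve p.1 p.2 = L.curve q.1 q.2 := by
  obtain ⟨k | k, t⟩ := p
  · rw [StrandParam.same_inl.1 h]
  · obtain ⟨z, rfl⟩ := StrandParam.same_inr.1 h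
    exact (L.curve_add_int k t z).symm

theorem deriv_same (L : LinkoidDiagram n m) {p q : StrandParam n m} (h : p.Same q) :
    deriv (L.curve p.1) p.2 = deriv (L.curve q.1) q.2 := by
  obtain ⟨k | k, t⟩ := p
  · rw [StrandParam.same_inl.1 h]
  · obtain ⟨z, rfl⟩ := StrandParam.same_inr.1 h
    dsimp only
    rw [← deriv_comp_add_const]
    congr 1
    funext s
    exact (L.curve_add_int k s z).symm

theorem IsColoring.same {L : LinkoidDiagram n m} {X : Type} [Quandle X]
    {c : Fin n ⊕ Fin m → ℝ → X} (hc : L.IsColoring c) {p q : StrandParam n m} (h : p.Same q) :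
    c p.1 p.2 = c q.1 q.2 := by
  obtain ⟨k | k, t⟩ := p
  · rw [StrandParam.same_inl.1 h]
  · obtain ⟨z, rfl⟩ := StrandParam.same_inr.1 h
    exact (hc.add_int k t z).symm

theorem differentiableAt (L : LinkoidDiagram n m) (k : Fin n ⊕ Fin m) (t : ℝ) :
    DifferentiableAt ℝ (L.curve k) t :=
  (L.smooth k).differentiable (by simp) t

/-- Legs and heads are simple. Thus derivatives at crossings can be compared by equality of curves
on a two-sided neighbourhood inside the domain. -/
theorem mem_Ioo_of_crossing (L : LinkoidDiagram n m) {i : Fin n} {t : ℝ} {q : StrandParam n m}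
    (ht : t ∈ Icc (0 : ℝ) 1) (hq : q.InDomain) (hne : ¬ StrandParam.Same (Sum.inl i, t) q)
    (he : L.curve q.1 q.2 = L.curve (Sum.inl i) t) : t ∈ Ioo (0 : ℝ) 1 := by
  refine ⟨lt_of_le_of_ne ht.1 fun h => hne ?_, lt_of_le_of_ne ht.2 fun h => hne ?_⟩ <;>
  exact StrandParam.same_inl.2 (L.endpoint_simple i t (by simp [h]) q hq he)

/-! ## Reparametrization and transformation of the plane -/

/-- A correspondence between the points of two diagrams that preserves crossings and their signs. -/
structure Correspondence (L L' : LinkoidDiagram n m) (e : Equiv.Perm (Fin m))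
    (ρ : Fin n ⊕ Fin m → ℝ ≃o ℝ) : Prop where
  zero : ∀ i, ρ (Sum.inl i) 0 = 0
  one : ∀ i, ρ (Sum.inl i) 1 = 1
  periodic : ∀ j t, ρ (Sum.inr j) (t + 1) = ρ (Sum.inr j) t + 1
  under : ∀ k t, L.under k t ↔ L'.under (Sum.map id e k) (ρ k t)
  cross : ∀ p q : StrandParam n m, p.InDomain → q.InDomain → (L.curve p.1 p.2 = L.curve q.1 q.2 ↔
    L'.curve (Sum.map id e p.1) (ρ p.1 p.2) = L'.curve (Sum.map id e q.1) (ρ q.1 q.2))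
  sign : ∀ p q : StrandParam n m, p.InDomain → q.InDomain → ¬ p.Same q →
    L.curve p.1 p.2 = L.curve q.1 q.2 →
    SignType.sign (planeDet (deriv (L.curve p.1) p.2) (deriv (L.curve q.1) q.2)) =
    SignType.sign (planeDet (deriv (L'.curve (Sum.map id e p.1)) (ρ p.1 p.2))
      (deriv (L'.curve (Sum.map id e q.1)) (ρ q.1 q.2)))

namespace Correspondence

variable {L L' : LinkoidDiagram n m} {e : Equiv.Perm (Fin m)} {ρ : Fin n ⊕ Fin m → ℝ ≃o ℝ}

theorem add_int (h : L.Correspondence L' e ρ) (j : Fin m) (t : ℝ) (z : ℤ) :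
    ρ (Sum.inr j) (t + z) = ρ (Sum.inr j) t + z := by
  have h1 : Function.Periodic (fun t => ρ (Sum.inr j) t - t) 1 := fun t => by
    simp only [h.periodic]
    ring
  have h2 := h1.int_mul z t
  simp only [mul_one] at h2
  linarith

theorem inDomain_iff (h : L.Correspondence L' e ρ) (k : Fin n ⊕ Fin m) (t : ℝ) :
    StrandParam.InDomain ((Sum.map id e k, ρ k t) : StrandParam n m) ↔
      StrandParam.InDomain ((k, t) : StrandParam n m) := by
  rcases k with i | j
  · simp only [StrandParam.InDomain, Sum.map_inl, Sum.isLeft_inl, forall_const]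
    exact orderIso_mem_Icc_iff (h.zero i) (h.one i) t
  · simp [StrandParam.InDomain]

theorem same_iff (h : L.Correspondence L' e ρ) (p q : StrandParam n m) :
    StrandParam.Same ((Sum.map id e p.1, ρ p.1 p.2) : StrandParam n m)
      (Sum.map id e q.1, ρ q.1 q.2) ↔ p.Same q := by
  obtain ⟨i | j, t⟩ := p
  · obtain ⟨i' | j', t'⟩ := q
    · simp only [Sum.map_inl, id, StrandParam.same_inl, Prod.mk.injEq, Sum.inl.injEq]
      constructor
      · rintro ⟨rfl, h'⟩
        exact ⟨rfl, (ρ _).injective h'⟩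
      · rintro ⟨rfl, rfl⟩
        exact ⟨rfl, rfl⟩
    · simp [StrandParam.same_inl]
  · obtain ⟨i' | j', t'⟩ := q
    · simp [StrandParam.same_inr]
    · simp only [Sum.map_inr, StrandParam.same_inr, Prod.mk.injEq, Sum.inr.injEq,
        EmbeddingLike.apply_eq_iff_eq]
      refine exists_congr fun z => ?_
      constructor
      · rintro ⟨rfl, h'⟩
        rw [← h.add_int] at h'
        exact ⟨rfl, (ρ _).injective h'⟩
      · rintro ⟨rfl, rfl⟩
        exact ⟨rfl, h.add_int _ _ _⟩

theorem symm (h : L.Correspondence L' e ρ) :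
    L'.Correspondence L e.symm fun k => (ρ (Sum.map id e.symm k)).symm := by
  -- Every parameter of `L'` comes from one of `L`. The equations are recorded in both directions so
  -- that the conditions for `p'` can be rewritten into those for `p`.
  have key : ∀ p : StrandParam n m, ∃ p' : StrandParam n m,
      p.1 = Sum.map id e p'.1 ∧ p.2 = ρ p'.1 p'.2 ∧ p'.1 = Sum.map id e.symm p.1 ∧
      p'.2 = (ρ (Sum.map id e.symm p.1)).symm p.2 := by
    rintro ⟨i | j, t⟩
    · exact ⟨(Sum.inl i, (ρ (Sum.inl i)).symm t), by simp⟩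
    · exact ⟨(Sum.inr (e.symm j), (ρ (Sum.inr (e.symm j))).symm t), by simp⟩
  constructor
  · intro i
    simp [OrderIso.symm_apply_eq, h.zero]
  · intro i
    simp [OrderIso.symm_apply_eq, h.one]
  · intro j t
    simp [OrderIso.symm_apply_eq, h.periodic]
  · intro k t
    obtain ⟨p, h1, h2, h3, h4⟩ := key (k, t)
    have := h.under p.1 p.2
    rw [← h1, ← h2, h3, h4] at this
    exact this.symm
  · intro p q hp hq
    obtain ⟨p', h1, h2, h3, h4⟩ := key p
    obtain ⟨q', h5, h6, h7, h8⟩ := key q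
    have hp' := h.inDomain_iff p'.1 p'.2
    have hq' := h.inDomain_iff q'.1 q'.2
    rw [← h1, ← h2] at hp'
    rw [← h5, ← h6] at hq'
    have := h.cross p' q' (hp'.1 hp) (hq'.1 hq)
    rw [← h1, ← h2, ← h5, ← h6, h3, h4, h7, h8] at this
    exact this.symm
  · intro p q hp hq hne he
    obtain ⟨p', h1, h2, h3, h4⟩ := key p
    obtain ⟨q', h5, h6, h7, h8⟩ := key q
    have hp' := h.inDomain_iff p'.1 p'.2
    have hq' := h.inDomain_iff q'.1 q'.2
    have hs := h.same_iff p' q'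
    have hx := h.cross p' q'
    have := h.sign p' q'
    rw [← h1, ← h2] at hp'
    rw [← h5, ← h6] at hq'
    rw [← h1, ← h2, ← h5, ← h6] at hs hx this
    have := this (hp'.1 hp) (hq'.1 hq) (fun h' => hne (hs.2 h')) ((hx (hp'.1 hp) (hq'.1 hq)).2 he)
    rw [h3, h4, h7, h8] at this
    exact this.symm

/-- Increasing homeomorphisms preserve left and right neighbourhoods, and equal crossing signs give
equal jump permutations. -/
theorem isColoring (h : L.Correspondence L' e ρ) {X : Type} [Quandle X]
    {c : Fin n ⊕ Fin m → ℝ → X} (hc : L'.IsColoring c) :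
    L.IsColoring fun k t => c (Sum.map id e k) (ρ k t) where
  periodic j t := by
    rw [h.periodic]
    exact hc.periodic _ _
  left k t := by
    have : Tendsto (ρ k) (𝓝[<] t) (𝓝[<] (ρ k t)) :=
      (ρ k).continuous.continuousWithinAt.tendsto_nhdsWithin fun s hs => (ρ k).strictMono hs
    exact this.eventually (hc.left _ _)
  right k t ht := by
    have : Tendsto (ρ k) (𝓝[>] t) (𝓝[>] (ρ k t)) :=
      (ρ k).continuous.continuousWithinAt.tendsto_nhdsWithin fun s hs => (ρ k).strictMono hs
    exact this.eventually (hc.right _ _ fun hu => ht ((h.under k t).2 hu))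
  cross k t ht q hq hne he := by
    have h1 : Tendsto (ρ k) (𝓝[>] t) (𝓝[>] (ρ k t)) :=
      (ρ k).continuous.continuousWithinAt.tendsto_nhdsWithin fun s hs => (ρ k).strictMono hs
    have hp := (L.under_double (k, t) ht).1
    have h2 := h.sign q (k, t) hq hp (fun h => hne h.symm) he
    rw [crossingPerm_congr h2]
    exact h1.eventually (hc.cross _ _ ((h.under k t).1 ht) (Sum.map id e q.1, ρ q.1 q.2)
      ((h.inDomain_iff _ _).2 hq) (fun h3 => hne ((h.same_iff (k, t) q).1 h3))
      ((h.cross q (k, t) hq hp).1 he))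

/-- Here the common set is the set of all parameters, so uniqueness is immediate and existence is
pulling back in both directions. -/
theorem isIsomorphic (h : L.Correspondence L' e ρ) :
    L.fundamentalPointedQuandle.IsIsomorphic L'.fundamentalPointedQuandle := by
  have hs : ∀ k t, ∃ k' t', k = Sum.map id e k' ∧ t = ρ k' t' := by
    rintro (i | j) t
    · exact ⟨Sum.inl i, (ρ (Sum.inl i)).symm t, by simp⟩
    · exact ⟨Sum.inr (e.symm j), (ρ (Sum.inr (e.symm j))).symm t, by simp⟩
  refine isIsomorphic_of_isColoring (S := StrandParam n m) id
    (fun p => (Sum.map id e p.1, ρ p.1 p.2)) ?_ ?_ ?_ ?_ ?_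
  · rintro i t (rfl | rfl)
    · exact ⟨_, rfl, by simp [h.zero]⟩
    · exact ⟨_, rfl, by simp [h.one]⟩
  · intro X _ c hc
    refine ⟨_, h.symm.isColoring hc, ?_⟩
    rintro ⟨i | j, t⟩ <;> simp
  · intro X _ c hc
    exact ⟨_, h.isColoring hc, fun s => rfl⟩
  · intro X _ c d _ _ hcd
    funext k t
    exact hcd (k, t)
  · intro X _ c d _ _ hcd
    funext k t
    obtain ⟨k', t', rfl, rfl⟩ := hs k t
    exact hcd (k', t')

end Correspondence

theorem planeDet_map (A : ℂ →L[ℝ] ℂ) (v w : ℂ) :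
    planeDet (A v) (A w) = A.det * planeDet v w := by
  have hA : ∀ v : ℂ, A v = v.re • A 1 + v.im • A Complex.I := by
    intro v
    rw [← map_smul, ← map_smul, ← map_add]
    congr 1
    simp [Complex.re_add_im]
  have hdet : A.det = (A 1).re * (A Complex.I).im - (A Complex.I).re * (A 1).im := by
    rw [ContinuousLinearMap.det, ← LinearMap.det_toMatrix Complex.basisOneI, Matrix.det_fin_two]
    simp [LinearMap.toMatrix_apply, Complex.coe_basisOneI_repr]
  rw [hA v, hA w, hdet]
  simp only [planeDet, Complex.add_re, Complex.add_im, Complex.real_smul, Complex.re_ofReal_mul,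
    Complex.im_ofReal_mul]
  ring

theorem sign_planeDet_map {A : ℂ →L[ℝ] ℂ} (hA : 0 < A.det) (v w : ℂ) :
    SignType.sign (planeDet (A v) (A w)) = SignType.sign (planeDet v w) := by
  rw [planeDet_map, sign_mul, sign_pos hA, one_mul]

theorem sign_planeDet_smul {a b : ℝ} (ha : 0 < a) (hb : 0 < b) (v w : ℂ) :
    SignType.sign (planeDet (a • v) (b • w)) = SignType.sign (planeDet v w) := by
  have : planeDet (a • v) (b • w) = a * b * planeDet v w := by
    simp [planeDet]
    ring
  rw [this, sign_mul, sign_pos (mul_pos ha hb), one_mul]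

theorem planeDet_mul (a v w : ℂ) : planeDet (a * v) (a * w) = Complex.normSq a * planeDet v w := by
  simp [planeDet, Complex.normSq_apply]
  ring

/-- If `L'` is the reparametrized image of `L` under a transformation that preserves the orientation
of the plane, then the fundamental pointed quandles are isomorphic. -/
theorem isIsomorphic_of_transform {L L' : LinkoidDiagram n m} (G : ℂ → ℂ) (e : Equiv.Perm (Fin m))
    (ρ : Fin n ⊕ Fin m → ℝ ≃o ℝ) (hρ : ∀ k t, DifferentiableAt ℝ (ρ k) t)
    (hρ' : ∀ k t, 0 < deriv (ρ k) t)
    (hρ0 : ∀ i, ρ (Sum.inl i) 0 = 0 ∧ ρ (Sum.inl i) 1 = 1)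
    (hρ1 : ∀ j t, ρ (Sum.inr j) (t + 1) = ρ (Sum.inr j) t + 1)
    (hG : ∀ p : StrandParam n m, p.InDomain → ∃ A : ℂ →L[ℝ] ℂ, HasFDerivAt G A (L.curve p.1 p.2) ∧
      ∀ v w, SignType.sign (planeDet (A v) (A w)) = SignType.sign (planeDet v w))
    (hinj : ∀ p q : StrandParam n m, p.InDomain → q.InDomain →
      G (L.curve p.1 p.2) = G (L.curve q.1 q.2) → L.curve p.1 p.2 = L.curve q.1 q.2)
    (h : ∀ p : StrandParam n m, p.InDomain →
      L'.curve (Sum.map id e p.1) p.2 = G (L.curve p.1 (ρ p.1 p.2)) ∧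
      (L'.under (Sum.map id e p.1) p.2 ↔ L.under p.1 (ρ p.1 p.2))) :
    L.fundamentalPointedQuandle.IsIsomorphic L'.fundamentalPointedQuandle := by
  have hsymm : ∀ i t, (ρ (Sum.inl i)).symm t ∈ Icc (0 : ℝ) 1 ↔ t ∈ Icc (0 : ℝ) 1 := by
    intro i t
    have h1 : (ρ (Sum.inl i)).symm 0 = 0 := by rw [OrderIso.symm_apply_eq, (hρ0 i).1]
    have h2 : (ρ (Sum.inl i)).symm 1 = 1 := by rw [OrderIso.symm_apply_eq, (hρ0 i).2]
    exact orderIso_mem_Icc_iff h1 h2 t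
  have hdom : ∀ k t, StrandParam.InDomain ((k, t) : StrandParam n m) →
      StrandParam.InDomain ((k, (ρ k).symm t) : StrandParam n m) := by
    rintro (i | j) t ht
    · exact fun _ => (hsymm i t).2 (ht rfl)
    · simp [StrandParam.InDomain]
  have hcurve : ∀ p : StrandParam n m, p.InDomain →
      L'.curve (Sum.map id e p.1) ((ρ p.1).symm p.2) = G (L.curve p.1 p.2) := by
    intro p hp
    have := (h (p.1, (ρ p.1).symm p.2) (hdom _ _ hp)).1
    rwa [OrderIso.apply_symm_apply] at this
  -- The chain rule. As `L'` is given by `G` on the parameter domain only, the point has to be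
  -- interior on an open component; crossings are.
  have hderiv : ∀ p : StrandParam n m, p.InDomain → (p.1.isLeft → p.2 ∈ Ioo (0 : ℝ) 1) →
      ∀ A : ℂ →L[ℝ] ℂ, HasFDerivAt G A (L.curve p.1 p.2) →
      deriv (L'.curve (Sum.map id e p.1)) ((ρ p.1).symm p.2) =
        deriv (ρ p.1) ((ρ p.1).symm p.2) • A (deriv (L.curve p.1) p.2) := by
    intro p hp hp' A hA
    have h1 : HasDerivAt (ρ p.1) (deriv (ρ p.1) ((ρ p.1).symm p.2)) ((ρ p.1).symm p.2) :=
      (hρ _ _).hasDerivAt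
    have h2 : HasDerivAt (L.curve p.1) (deriv (L.curve p.1) p.2) (ρ p.1 ((ρ p.1).symm p.2)) := by
      rw [OrderIso.apply_symm_apply]
      exact (L.differentiableAt _ _).hasDerivAt
    have h3 : HasFDerivAt G A ((L.curve p.1 ∘ ρ p.1) ((ρ p.1).symm p.2)) := by
      rw [Function.comp, OrderIso.apply_symm_apply]
      exact hA
    have h4 := h3.comp_hasDerivAt _ (h2.scomp _ h1)
    rw [map_smul] at h4
    rw [← h4.deriv]
    apply Filter.EventuallyEq.deriv_eq
    have h5 : ∀ᶠ s in 𝓝 ((ρ p.1).symm p.2),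
        StrandParam.InDomain ((p.1, s) : StrandParam n m) := by
      obtain ⟨i | j, t⟩ := p
      · have h6 : (ρ (Sum.inl i)).symm t ∈ Ioo (0 : ℝ) 1 := by
          have h7 := hp' rfl
          have h8 := (hsymm i t).2 (Ioo_subset_Icc_self h7)
          refine ⟨lt_of_le_of_ne h8.1 fun h9 => ?_, lt_of_le_of_ne h8.2 fun h9 => ?_⟩
          · rw [eq_comm, OrderIso.symm_apply_eq, (hρ0 i).1] at h9
            exact h7.1.ne' h9
          · rw [OrderIso.symm_apply_eq, (hρ0 i).2] at h9
            exact h7.2.ne h9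
        filter_upwards [Ioo_mem_nhds h6.1 h6.2] with s hs
        exact fun _ => Ioo_subset_Icc_self hs
      · exact Eventually.of_forall fun s => by simp [StrandParam.InDomain]
    filter_upwards [h5] with s hs
    exact (h _ hs).1
  -- The point of `L'` with parameter `t` comes from the parameter `ρ t` of `L`, so the
  -- correspondence from `L` to `L'` uses the inverse.
  refine Correspondence.isIsomorphic (e := e) (ρ := fun k => (ρ k).symm)
    ⟨fun i => ?_, fun i => ?_, fun j t => ?_, fun k t => ?_, fun p q hp hq => ?_,
      fun p q hp hq hne he => ?_⟩
  · rw [OrderIso.symm_apply_eq, (hρ0 i).1]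
  · rw [OrderIso.symm_apply_eq, (hρ0 i).2]
  · rw [OrderIso.symm_apply_eq, hρ1, OrderIso.apply_symm_apply]
  · by_cases hd : StrandParam.InDomain ((k, t) : StrandParam n m)
    · have := (h _ (hdom k t hd)).2
      rw [OrderIso.apply_symm_apply] at this
      exact this.symm
    · refine iff_of_false (fun hu => hd (L.under_double (k, t) hu).1) fun hu => hd ?_
      have := (L'.under_double (_, _) hu).1
      rcases k with i | j
      · exact fun _ => (hsymm i t).1 (this rfl)
      · simp [StrandParam.InDomain]
  · rw [hcurve p hp, hcurve q hq]
    exact ⟨fun he => by rw [he], hinj p q hp hq⟩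
  · obtain ⟨A, hA, hs⟩ := hG p hp
    have hA' := hA
    rw [he] at hA'
    have hp' : p.1.isLeft → p.2 ∈ Ioo (0 : ℝ) 1 := by
      obtain ⟨i | j, t⟩ := p
      · exact fun _ => L.mem_Ioo_of_crossing (hp rfl) hq hne he.symm
      · simp
    have hq' : q.1.isLeft → q.2 ∈ Ioo (0 : ℝ) 1 := by
      obtain ⟨i | j, t⟩ := q
      · exact fun _ => L.mem_Ioo_of_crossing (hq rfl) hp (fun h => hne h.symm) he
      · simp
    rw [hderiv p hp hp' A hA, hderiv q hq hq' A hA', sign_planeDet_smul (hρ' _ _) (hρ' _ _), hs]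

theorem PlanarIsotopy.isIsomorphic {L L' : LinkoidDiagram n m} (h : L.PlanarIsotopy L') :
    L.fundamentalPointedQuandle.IsIsomorphic L'.fundamentalPointedQuandle := by
  obtain ⟨F, e, ρ, h1, h2, h3, h4, h5⟩ := h
  exact isIsomorphic_of_transform F.toEquiv e ρ (fun k => (h1 k).differentiable (by simp)) h2 h3 h4
    (fun p _ => ⟨_, (F.smooth.differentiable (by simp) _).hasFDerivAt,
      sign_planeDet_map (F.orientation _)⟩) (fun p q _ _ h => F.toEquiv.injective h) h5

/-- The map `w ↦ (w - z)⁻¹` is injective and holomorphic off `z`. Its derivative is multiplication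
by a nonzero complex number `a`, which scales `planeDet` by `normSq a > 0`. -/
theorem SphericalMove.isIsomorphic {L L' : LinkoidDiagram n m} (h : L.SphericalMove L') :
    L.fundamentalPointedQuandle.IsIsomorphic L'.fundamentalPointedQuandle := by
  obtain ⟨z, h⟩ := h
  refine isIsomorphic_of_transform (fun w => (w - z)⁻¹) (Equiv.refl _) (fun _ => OrderIso.refl ℝ)
    (fun k => differentiable_id) (fun k t => ?_) (fun i => ⟨rfl, rfl⟩) (fun j t => rfl)
    (fun p hp => ?_) (fun p q hp hq he => ?_) (fun p hp => ?_)
  · exact (deriv_id t).symm ▸ one_pos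
  · have h0 : L.curve p.1 p.2 - z ≠ 0 := sub_ne_zero.2 (h p hp).1
    have h1 := (((hasDerivAt_id (L.curve p.1 p.2)).sub_const z).inv h0).hasFDerivAt.restrictScalars ℝ
    refine ⟨_, h1, fun v w => ?_⟩
    have h2 : -1 / (id (L.curve p.1 p.2) - z) ^ 2 ≠ 0 :=
      div_ne_zero (by norm_num) (pow_ne_zero 2 h0)
    simp only [ContinuousLinearMap.coe_restrictScalars', ContinuousLinearMap.toSpanSingleton_apply,
      smul_eq_mul]
    rw [mul_comm v, mul_comm w, planeDet_mul, sign_mul, sign_pos (Complex.normSq_pos.2 h2), one_mul]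
  · exact sub_left_injective (inv_injective he)
  · have : Sum.map id (Equiv.refl (Fin m)) p.1 = p.1 := by
      rcases p.1 with i | j <;> rfl
    rw [this]
    exact (h p hp).2

end LinkoidDiagram

/-! ## Replacing a diagram inside a disc -/

namespace StrandInterval

variable {n m : ℕ}

theorem Mem.same {J : StrandInterval n m} {p q : StrandParam n m} (h : J.Mem p) (h' : p.Same q) :
    J.Mem q := by
  obtain ⟨t, ht, hs⟩ := h
  exact ⟨t, ht, hs.trans h'⟩

theorem mem_of_mem_Icc (J : StrandInterval n m) {t : ℝ} (ht : t ∈ Icc J.lo J.hi) :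
    J.Mem (J.comp, t) := ⟨t, ht, .refl _⟩

theorem inDomain_of_mem_Icc (J : StrandInterval n m) {t : ℝ} (ht : t ∈ Icc J.lo J.hi) :
    StrandParam.InDomain ((J.comp, t) : StrandParam n m) :=
  fun h => ⟨(J.open_proper h).1.le.trans ht.1, ht.2.trans (J.open_proper h).2.le⟩

theorem Mem.inDomain {J : StrandInterval n m} {p : StrandParam n m} (h : J.Mem p) :
    p.InDomain := by
  obtain ⟨t, ht, hs⟩ := h
  exact hs.inDomain (J.inDomain_of_mem_Icc ht)

/-- On a closed component the interval is shorter than the period `1`, so no two of its parameters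
differ by a nonzero integer. -/
theorem eq_of_same {J : StrandInterval n m} {t t' : ℝ} (ht : t ∈ Icc J.lo J.hi)
    (ht' : t' ∈ Icc J.lo J.hi)
    (h : StrandParam.Same ((J.comp, t) : StrandParam n m) (J.comp, t')) : t = t' := by
  obtain ⟨-, h | ⟨hr, z, h⟩⟩ := h
  · exact h
  · have h1 := J.closed_proper hr
    simp only at h
    have h2 : (z : ℝ) < 1 := by linarith [ht.1, ht'.2]
    have h3 : (-1 : ℝ) < z := by linarith [ht.2, ht'.1]
    have h4 : z = 0 := by
      have h5 : z < 1 := by exact_mod_cast h2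
      have h6 : -1 < z := by exact_mod_cast h3
      omega
    simp [h, h4]

theorem not_mem_endpoint (J : StrandInterval n m) {i : Fin n} {t : ℝ} (ht : t = 0 ∨ t = 1) :
    ¬ J.Mem (Sum.inl i, t) := by
  rintro ⟨s, hs, h⟩
  have h1 := StrandParam.same_inl.1 h.symm
  obtain ⟨h2, rfl⟩ := Prod.mk.inj h1
  replace h2 := J.open_proper (by rw [h2]; rfl)
  rcases ht with rfl | rfl
  · exact absurd hs.1 (not_le.2 h2.1)
  · exact absurd hs.2 (not_le.2 h2.2)

/-- On a closed component this set is the sum of a compact interval and the closed set `ℤ`. -/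
theorem isClosed_mem (J : StrandInterval n m) (k : Fin n ⊕ Fin m) :
    IsClosed {t | J.Mem (k, t)} := by
  by_cases hk : J.comp = k
  · subst hk
    rcases hc : J.comp with i | j
    · have : {t | J.Mem (Sum.inl i, t)} = Icc J.lo J.hi := by
        ext t
        constructor
        · rintro ⟨s, hs, h⟩
          rw [hc] at h
          have := congrArg Prod.snd (StrandParam.same_inl.1 h)
          simp only at this
          rwa [this]
        · intro ht
          exact ⟨t, ht, by rw [hc]; exact .refl _⟩
      rw [this]
      exact isClosed_Icc
    · have : {t | J.Mem (Sum.inr j, t)} = Icc J.lo J.hi + range ((↑) : ℤ → ℝ) := by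
        ext t
        constructor
        · rintro ⟨s, hs, h⟩
          rw [hc] at h
          obtain ⟨z, hz⟩ := StrandParam.same_inr.1 h
          exact ⟨s, hs, z, ⟨z, rfl⟩, (congrArg Prod.snd hz).symm⟩
        · rintro ⟨s, hs, _, ⟨z, rfl⟩, rfl⟩
          refine ⟨s, hs, ?_⟩
          rw [hc]
          exact StrandParam.same_inr.2 ⟨z, rfl⟩
      rw [this]
      exact Int.isClosedEmbedding_coe_real.isClosed_range.add_left_of_isCompact isCompact_Icc
  · convert isClosed_empty
    ext t
    simp only [mem_ofPred_eq, mem_empty_iff_false, iff_false]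
    rintro ⟨s, -, h, -⟩
    exact hk h

variable {r : ℕ} {J : Fin r → StrandInterval n m}

theorem eq_and_eq_of_same (hJ : ∀ i j p, (J i).Mem p → (J j).Mem p → i = j) {i j : Fin r} {t u : ℝ}
    (ht : t ∈ Icc (J i).lo (J i).hi) (hu : u ∈ Icc (J j).lo (J j).hi)
    (h : StrandParam.Same (((J i).comp, t) : StrandParam n m) ((J j).comp, u)) : i = j ∧ t = u := by
  have := hJ i j _ (((J i).mem_of_mem_Icc ht).same h) ((J j).mem_of_mem_Icc hu)
  subst this
  exact ⟨rfl, eq_of_same ht hu h⟩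

theorem eventually_not_mem (k : Fin n ⊕ Fin m) {t : ℝ} (h : ¬ ∃ i, (J i).Mem (k, t)) :
    ∀ᶠ s in 𝓝 t, ¬ ∃ i, (J i).Mem (k, s) := by
  have : IsClosed (⋃ i, {t | (J i).Mem (k, t)}) := isClosed_iUnion_of_finite fun i =>
    (J i).isClosed_mem k
  filter_upwards [this.isOpen_compl.mem_nhds (by simpa using h)] with s hs
  simpa using hs

/-- The other strands are closed and miss the end `lo`. The strand itself cannot return at once from
an integer translate, being shorter than the period. -/
theorem eventually_not_mem_left (hJ : ∀ i j p, (J i).Mem p → (J j).Mem p → i = j) (i : Fin r) :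
    ∀ᶠ s in 𝓝[<] (J i).lo, ¬ ∃ j, (J j).Mem ((J i).comp, s) := by
  have hmem := (J i).mem_of_mem_Icc ⟨le_rfl, (J i).lo_lt_hi.le⟩
  have h1 : ∀ᶠ s in 𝓝[<] (J i).lo, ∀ j, ¬ (J j).Mem ((J i).comp, s) := by
    rw [eventually_all]
    intro j
    by_cases hij : i = j
    · subst hij
      have h2 : ∀ᶠ s in 𝓝[<] (J i).lo, (J i).comp.isRight → (J i).hi - 1 < s := by
        by_cases hr : (J i).comp.isRight
        · filter_upwards [Ioo_mem_nhdsLT (a := (J i).hi - 1) (b := (J i).lo)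
            (by linarith [(J i).closed_proper hr])] with s hs _ using hs.1
        · exact Eventually.of_forall fun s h => absurd h hr
      filter_upwards [h2, self_mem_nhdsWithin] with s h2 hs
      rintro ⟨t, ht, -, h | ⟨hr, z, h⟩⟩
      · simp only at h
        exact absurd ht.1 (not_le.2 (h ▸ hs))
      · have h3 := h2 hr
        simp only [mem_Iio] at h hs
        have h4 : (z : ℝ) < 0 := by linarith [ht.1]
        have h5 : (-1 : ℝ) < z := by linarith [ht.2]
        have h6 : z < 0 := by exact_mod_cast h4
        have h7 : -1 < z := by exact_mod_cast h5
        omega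
    · exact nhdsWithin_le_nhds (((J j).isClosed_mem (J i).comp).isOpen_compl.mem_nhds
        fun h => hij (hJ i j _ hmem h))
  filter_upwards [h1] with s hs
  simpa using hs

theorem eventually_not_mem_right (hJ : ∀ i j p, (J i).Mem p → (J j).Mem p → i = j) (i : Fin r) :
    ∀ᶠ s in 𝓝[>] (J i).hi, ¬ ∃ j, (J j).Mem ((J i).comp, s) := by
  have hmem := (J i).mem_of_mem_Icc ⟨(J i).lo_lt_hi.le, le_rfl⟩
  have h1 : ∀ᶠ s in 𝓝[>] (J i).hi, ∀ j, ¬ (J j).Mem ((J i).comp, s) := by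
    rw [eventually_all]
    intro j
    by_cases hij : i = j
    · subst hij
      have h2 : ∀ᶠ s in 𝓝[>] (J i).hi, (J i).comp.isRight → s < (J i).lo + 1 := by
        by_cases hr : (J i).comp.isRight
        · filter_upwards [Ioo_mem_nhdsGT ((J i).closed_proper hr)] with s hs _ using hs.2
        · exact Eventually.of_forall fun s h => absurd h hr
      filter_upwards [h2, self_mem_nhdsWithin] with s h2 hs
      rintro ⟨t, ht, -, h | ⟨hr, z, h⟩⟩
      · simp only at h
        exact absurd ht.2 (not_le.2 (h ▸ hs))
      · have h3 := h2 hr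
        simp only [mem_Ioi] at h hs
        have h4 : (0 : ℝ) < z := by linarith [ht.2]
        have h5 : (z : ℝ) < 1 := by linarith [ht.1]
        have h6 : 0 < z := by exact_mod_cast h4
        have h7 : z < 1 := by exact_mod_cast h5
        omega
    · exact nhdsWithin_le_nhds (((J j).isClosed_mem (J i).comp).isOpen_compl.mem_nhds
        fun h => hij (hJ i j _ hmem h))
  filter_upwards [h1] with s hs
  simpa using hs

open Classical in
/-- The function given by `g` on the intervals `J` and by `c` elsewhere. -/
noncomputable def fill {X : Type} (J : Fin r → StrandInterval n m) (g : Fin r → ℝ → X)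
    (c : Fin n ⊕ Fin m → ℝ → X) (k : Fin n ⊕ Fin m) (t : ℝ) : X :=
  if h : ∃ x : Fin r × ℝ, x.2 ∈ Icc (J x.1).lo (J x.1).hi ∧
    StrandParam.Same (((J x.1).comp, x.2) : StrandParam n m) (k, t)
  then g h.choose.1 h.choose.2 else c k t

theorem fill_of_same (hJ : ∀ i j p, (J i).Mem p → (J j).Mem p → i = j) {X : Type}
    (g : Fin r → ℝ → X) (c : Fin n ⊕ Fin m → ℝ → X) {i : Fin r} {t : ℝ}
    (ht : t ∈ Icc (J i).lo (J i).hi) {p : StrandParam n m}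
    (hp : StrandParam.Same (((J i).comp, t) : StrandParam n m) p) : fill J g c p.1 p.2 = g i t := by
  have h : ∃ x : Fin r × ℝ, x.2 ∈ Icc (J x.1).lo (J x.1).hi ∧
    StrandParam.Same (((J x.1).comp, x.2) : StrandParam n m) (p.1, p.2) := ⟨(i, t), ht, hp⟩
  rw [fill, dif_pos h]
  obtain ⟨h1, h2⟩ := eq_and_eq_of_same hJ h.choose_spec.1 ht (h.choose_spec.2.trans hp.symm)
  rw [h2, h1]

theorem fill_of_not_mem {X : Type} (g : Fin r → ℝ → X) (c : Fin n ⊕ Fin m → ℝ → X)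
    {k : Fin n ⊕ Fin m} {t : ℝ} (h : ¬ ∃ i, (J i).Mem (k, t)) : fill J g c k t = c k t := by
  rw [fill, dif_neg]
  rintro ⟨x, hx, hs⟩
  exact h ⟨x.1, x.2, hx, hs⟩

theorem fill_same (hJ : ∀ i j p, (J i).Mem p → (J j).Mem p → i = j) {X : Type}
    (g : Fin r → ℝ → X) (c : Fin n ⊕ Fin m → ℝ → X)
    (hc : ∀ p q : StrandParam n m, p.Same q → c p.1 p.2 = c q.1 q.2)
    {p q : StrandParam n m} (h : p.Same q) : fill J g c p.1 p.2 = fill J g c q.1 q.2 := by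
  by_cases hp : ∃ i, (J i).Mem p
  · obtain ⟨i, t, ht, hs⟩ := hp
    rw [fill_of_same hJ g c ht hs, fill_of_same hJ g c ht (hs.trans h)]
  · rw [fill_of_not_mem g c hp, fill_of_not_mem g c fun ⟨i, hi⟩ => hp ⟨i, hi.same h.symm⟩]
    exact hc p q h

end StrandInterval

/-! ### Local colourings and gluing along the boundary of the disc -/

namespace LinkoidDiagram

open StrandInterval

variable {n m r : ℕ}

/-- A colouring of the strands of `L` in a disc. -/
structure IsLocalColoring (L : LinkoidDiagram n m) (J : Fin r → StrandInterval n m) {X : Type}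
    [Quandle X] (g : Fin r → ℝ → X) : Prop where
  left : ∀ i, ∀ t ∈ Ioc (J i).lo (J i).hi, ∀ᶠ s in 𝓝[<] t, g i s = g i t
  right : ∀ i, ∀ t ∈ Ico (J i).lo (J i).hi, ¬ L.under (J i).comp t → ∀ᶠ s in 𝓝[>] t, g i s = g i t
  cross : ∀ i, ∀ t ∈ Ico (J i).lo (J i).hi, L.under (J i).comp t →
    ∀ j, ∀ u ∈ Icc (J j).lo (J j).hi, ¬ (j = i ∧ u = t) →
    L.curve (J j).comp u = L.curve (J i).comp t →
    ∀ᶠ s in 𝓝[>] t, g i s =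
      crossingPerm (planeDet (deriv (L.curve (J j).comp) u) (deriv (L.curve (J i).comp) t)) (g j u)
        (g i t)

theorem IsColoring.isLocalColoring {L : LinkoidDiagram n m} {X : Type} [Quandle X]
    {c : Fin n ⊕ Fin m → ℝ → X} (hc : L.IsColoring c) {J : Fin r → StrandInterval n m}
    (hJ : ∀ i j p, (J i).Mem p → (J j).Mem p → i = j) :
    L.IsLocalColoring J fun i => c (J i).comp where
  left i t _ := hc.left _ t
  right i t _ := hc.right _ t
  cross i t ht hu j u huJ hne he := by
    refine hc.cross _ t hu ((J j).comp, u) ((J j).inDomain_of_mem_Icc huJ) (fun h => hne ?_) he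
    exact eq_and_eq_of_same hJ huJ (Ico_subset_Icc_self ht) h.symm

/-- The conditions on a colouring need to be checked at one parameter of each point only. -/
theorem IsColoring.of_representatives {L : LinkoidDiagram n m} {X : Type} [Quandle X]
    {c : Fin n ⊕ Fin m → ℝ → X}
    (hc : ∀ p q : StrandParam n m, p.Same q → c p.1 p.2 = c q.1 q.2)
    (h : ∀ p : StrandParam n m, ∃ k t, StrandParam.Same (k, t) p ∧
      (∀ᶠ s in 𝓝[<] t, c k s = c k t) ∧
      (¬ L.under k t → ∀ᶠ s in 𝓝[>] t, c k s = c k t) ∧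
      (L.under k t → ∀ q : StrandParam n m, q.InDomain → ¬ StrandParam.Same (k, t) q →
        L.curve q.1 q.2 = L.curve k t → ∀ᶠ s in 𝓝[>] t,
        c k s = crossingPerm (planeDet (deriv (L.curve q.1) q.2) (deriv (L.curve k) t)) (c q.1 q.2)
          (c k t))) : L.IsColoring c := by
  have hshift : ∀ (j : Fin m) (t : ℝ) (z : ℤ), c (Sum.inr j) (t + z) = c (Sum.inr j) t :=
    fun j t z => hc (Sum.inr j, t + z) (Sum.inr j, t) (StrandParam.same_inr.2 ⟨-z, by simp⟩)
  -- One-sided limits of a periodic function are carried along by integer translations.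
  have hlim : ∀ k t t', StrandParam.Same ((k, t) : StrandParam n m) (k, t') → ∀ x,
      ((∀ᶠ s in 𝓝[<] t, c k s = x) → ∀ᶠ s in 𝓝[<] t', c k s = x) ∧
      ((∀ᶠ s in 𝓝[>] t, c k s = x) → ∀ᶠ s in 𝓝[>] t', c k s = x) := by
    rintro (i | j) t t' hs x
    · have := congrArg Prod.snd (StrandParam.same_inl.1 hs)
      simp only at this
      rw [this]
      exact ⟨id, id⟩
    · obtain ⟨z, hz⟩ := StrandParam.same_inr.1 hs
      have := congrArg Prod.snd hz
      simp only at this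
      subst this
      have ht : Tendsto (fun s => s + ((-z : ℤ) : ℝ)) (𝓝 (t + z)) (𝓝 t) := by
        have := ((continuous_id (X := ℝ)).add_const ((-z : ℤ) : ℝ)).tendsto (t + z)
        simpa using this
      constructor <;> intro hx
      · have ht' : Tendsto (fun s => s + ((-z : ℤ) : ℝ)) (𝓝[<] (t + z)) (𝓝[<] t) := by
          refine tendsto_nhdsWithin_iff.2 ⟨ht.mono_left nhdsWithin_le_nhds, ?_⟩
          filter_upwards [self_mem_nhdsWithin] with s hs
          simp only [mem_Iio] at hs ⊢
          push_cast
          linarith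
        filter_upwards [ht'.eventually hx] with s hs
        rwa [hshift] at hs
      · have ht' : Tendsto (fun s => s + ((-z : ℤ) : ℝ)) (𝓝[>] (t + z)) (𝓝[>] t) := by
          refine tendsto_nhdsWithin_iff.2 ⟨ht.mono_left nhdsWithin_le_nhds, ?_⟩
          filter_upwards [self_mem_nhdsWithin] with s hs
          simp only [mem_Ioi] at hs ⊢
          push_cast
          linarith
        filter_upwards [ht'.eventually hx] with s hs
        rwa [hshift] at hs
  refine ⟨fun j t => ?_, fun k t' => ?_, fun k t' hu => ?_, fun k t' hu q hq hne he => ?_⟩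
  · simpa using hshift j t 1
  all_goals
    obtain ⟨k', t, hs, h1, h2, h3⟩ := h (k, t')
    have hk : k' = k := hs.1
    subst hk
    have e1 := hc _ _ hs
    have e2 := L.under_same hs
    have e3 := L.curve_same hs
    have e4 := L.deriv_same hs
    simp only at e1 e2 e3 e4
    rw [← e1]
  · exact (hlim _ _ _ hs _).1 h1
  · exact (hlim _ _ _ hs _).2 (h2 fun h => hu (e2.1 h))
  · rw [← e4]
    exact (hlim _ _ _ hs _).2 (h3 (e2.2 hu) q hq (fun h => hne (hs.symm.trans h)) (he.trans e3.symm))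

theorem DifferInDisc.symm {L L' : LinkoidDiagram n m} {φ : PlaneDiffeo}
    {J : Fin r → StrandInterval n m} (h : L.DifferInDisc L' φ J) : L'.DifferInDisc L φ J :=
  ⟨h.disjoint, h.mem_disc', h.mem_disc, fun p hp hJ =>
    ⟨(h.agree p hp hJ).1.symm, (h.agree p hp hJ).2.symm⟩⟩

/-- A point of the disc on the diagram is on one of the strands. -/
theorem DifferInDisc.exists_of_curve_eq {L L' : LinkoidDiagram n m} {φ : PlaneDiffeo}
    {J : Fin r → StrandInterval n m} (h : L.DifferInDisc L' φ J) {i : Fin r} {t : ℝ}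
    (ht : t ∈ Icc (J i).lo (J i).hi) {q : StrandParam n m} (hq : q.InDomain)
    (he : L.curve q.1 q.2 = L.curve (J i).comp t) : ∃ j, (J j).Mem q := by
  rw [← h.mem_disc q hq, he]
  exact (h.mem_disc ((J i).comp, t) ((J i).inDomain_of_mem_Icc ht)).2 ⟨i, (J i).mem_of_mem_Icc ht⟩

/-- Off the closed strands the two curves agree near `p`. The crossing with `q` guarantees that `p`
is not an endpoint, so that a whole neighbourhood lies in the domain. -/
theorem DifferInDisc.deriv_eq {L L' : LinkoidDiagram n m} {φ : PlaneDiffeo}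
    {J : Fin r → StrandInterval n m} (h : L.DifferInDisc L' φ J) {p q : StrandParam n m}
    (hp : p.InDomain) (hpJ : ¬ ∃ i, (J i).Mem p) (hq : q.InDomain) (hne : ¬ p.Same q)
    (he : L.curve q.1 q.2 = L.curve p.1 p.2) :
    deriv (L.curve p.1) p.2 = deriv (L'.curve p.1) p.2 := by
  apply Filter.EventuallyEq.deriv_eq
  have h1 : ∀ᶠ s in 𝓝 p.2, StrandParam.InDomain ((p.1, s) : StrandParam n m) := by
    obtain ⟨i | j, t⟩ := p
    · have := L.mem_Ioo_of_crossing (hp rfl) hq hne he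
      filter_upwards [Ioo_mem_nhds this.1 this.2] with s hs
      exact fun _ => Ioo_subset_Icc_self hs
    · exact Eventually.of_forall fun s => by simp [StrandParam.InDomain]
  filter_upwards [h1, eventually_not_mem p.1 hpJ] with s h1 h2
  exact (h.agree _ h1 h2).1

/-- The conditions on a colouring are local. Inside the strands they come from `g`, outside from
`c`; at the ends the two functions match, and the assumptions at `hi` exclude a jump exactly where a
strand leaves the disc. -/
theorem DifferInDisc.isColoring_fill {L L' : LinkoidDiagram n m} {φ : PlaneDiffeo}
    {J : Fin r → StrandInterval n m} (h : L.DifferInDisc L' φ J)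
    (hhi : ∀ i, ¬ L.under (J i).comp (J i).hi) (hhi' : ∀ i, ¬ L'.under (J i).comp (J i).hi)
    {X : Type} [Quandle X] {c : Fin n ⊕ Fin m → ℝ → X} (hc : L.IsColoring c) {g : Fin r → ℝ → X}
    (hg : L'.IsLocalColoring J g) (hglo : ∀ i, g i (J i).lo = c (J i).comp (J i).lo)
    (hghi : ∀ i, g i (J i).hi = c (J i).comp (J i).hi) : L'.IsColoring (fill J g c) := by
  have hJ := h.disjoint
  refine IsColoring.of_representatives (fun p q hpq => fill_same hJ g c (fun _ _ => hc.same) hpq)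
    fun p => ?_
  have fillJ : ∀ i, ∀ t ∈ Icc (J i).lo (J i).hi, fill J g c (J i).comp t = g i t :=
    fun i t ht => fill_of_same hJ g c ht (.refl ((J i).comp, t))
  by_cases hp : ∃ i, (J i).Mem p
  · obtain ⟨i, t, ht, hs⟩ := hp
    refine ⟨_, t, hs, ?_, ?_, ?_⟩
    · rw [fillJ i t ht]
      -- At the incoming end the left neighbourhood is outside the strands and is coloured by `c`.
      rcases ht.1.eq_or_lt with h1 | h1
      · subst h1
        rw [hglo]
        filter_upwards [eventually_not_mem_left hJ i, hc.left (J i).comp (J i).lo] with s h2 h3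
        rw [fill_of_not_mem g c h2, h3]
      · filter_upwards [Ioo_mem_nhdsLT h1, hg.left i t ⟨h1, ht.2⟩] with s h2 h3
        rw [fillJ i s ⟨h2.1.le, h2.2.le.trans ht.2⟩, h3]
    · intro hu
      rw [fillJ i t ht]
      rcases ht.2.eq_or_lt with h1 | h1
      · subst h1
        rw [hghi]
        filter_upwards [eventually_not_mem_right hJ i, hc.right (J i).comp (J i).hi (hhi i)]
          with s h2 h3
        rw [fill_of_not_mem g c h2, h3]
      · filter_upwards [Ioo_mem_nhdsGT h1, hg.right i t ⟨ht.1, h1⟩ hu] with s h2 h3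
        rw [fillJ i s ⟨ht.1.trans h2.1.le, h2.2.le⟩, h3]
    · intro hu q hq hne he
      have h1 : t < (J i).hi := lt_of_le_of_ne ht.2 fun h2 => hhi' i (h2 ▸ hu)
      obtain ⟨j, u, huJ, hs'⟩ := h.symm.exists_of_curve_eq ht hq he
      rw [← L'.deriv_same hs', fill_of_same hJ g c huJ hs', fillJ i t ht]
      have h4 := hg.cross i t ⟨ht.1, h1⟩ hu j u huJ ?_ ((L'.curve_same hs').trans he)
      · filter_upwards [Ioo_mem_nhdsGT h1, h4] with s h2 h3
        rw [fillJ i s ⟨ht.1.trans h2.1.le, h2.2.le⟩, h3]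
      · rintro ⟨rfl, rfl⟩
        exact hne hs'
  · have hev := eventually_not_mem p.1 hp
    have hund : L'.under p.1 p.2 ↔ L.under p.1 p.2 :=
      ⟨fun h1 => (h.agree p (L'.under_double p h1).1 hp).2.2 h1,
        fun h1 => (h.agree p (L.under_double p h1).1 hp).2.1 h1⟩
    refine ⟨p.1, p.2, .refl _, ?_, ?_, ?_⟩
    · filter_upwards [nhdsWithin_le_nhds hev, hc.left p.1 p.2] with s h1 h2
      rw [fill_of_not_mem g c h1, h2, fill_of_not_mem g c hp]
    · intro hu
      filter_upwards [nhdsWithin_le_nhds hev, hc.right p.1 p.2 fun h => hu (hund.2 h)] with s h1 h2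
      rw [fill_of_not_mem g c h1, h2, fill_of_not_mem g c hp]
    · intro hu q hq hne he
      have hpd := (L'.under_double p hu).1
      -- A point off the strands maps outside the disc; the other branch of its crossing has the
      -- same image, so it is off the strands too.
      have hqJ : ¬ ∃ i, (J i).Mem q := by
        rw [← h.mem_disc' q hq, he, h.mem_disc' p hpd]
        exact hp
      have he' : L.curve q.1 q.2 = L.curve p.1 p.2 := by
        rw [(h.agree q hq hqJ).1, he, (h.agree p hpd hp).1]
      rw [← h.deriv_eq hpd hp hq hne he', ← h.deriv_eq hq hqJ hpd (fun h => hne h.symm) he'.symm]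
      filter_upwards [nhdsWithin_le_nhds hev, hc.cross p.1 p.2 (hund.1 hu) q hq hne he'] with s h1 h2
      rw [fill_of_not_mem g c h1, h2, fill_of_not_mem g c hp, fill_of_not_mem g c hqJ]

/-- Colourings that agree outside a disc agree if local colourings are determined by the colours of
the incoming ends of the strands. -/
theorem IsColoring.eq_of_eq_outside {L : LinkoidDiagram n m} {J : Fin r → StrandInterval n m}
    (hJ : ∀ i j p, (J i).Mem p → (J j).Mem p → i = j) {X : Type} [Quandle X]
    (huniq : ∀ g g' : Fin r → ℝ → X, L.IsLocalColoring J g → L.IsLocalColoring J g' →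
      (∀ i, g i (J i).lo = g' i (J i).lo) → ∀ i, ∀ t ∈ Icc (J i).lo (J i).hi, g i t = g' i t)
    {c d : Fin n ⊕ Fin m → ℝ → X} (hc : L.IsColoring c) (hd : L.IsColoring d)
    (hcd : ∀ p : StrandParam n m, (¬ ∃ i, (J i).Mem p) → c p.1 p.2 = d p.1 p.2) : c = d := by
  -- By left-continuity the colour at an incoming end is already taken just before it, outside the
  -- strands.
  have h := huniq _ _ (hc.isLocalColoring hJ) (hd.isLocalColoring hJ) fun i => by
    obtain ⟨s, h1, h2, h3⟩ := ((eventually_not_mem_left hJ i).and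
      ((hc.left (J i).comp (J i).lo).and (hd.left (J i).comp (J i).lo))).exists
    rw [← h2, ← h3]
    exact hcd (_, s) h1
  funext k t
  by_cases hp : ∃ i, (J i).Mem (k, t)
  · obtain ⟨i, u, hu, hs⟩ := hp
    have h1 := hc.same hs
    have h2 := hd.same hs
    simp only at h1 h2
    rw [← h1, ← h2]
    exact h i u hu
  · exact hcd (k, t) hp

/-- If two diagrams differ in a disc only and local colourings of both in the disc correspond to each
other, then the fundamental pointed quandles are isomorphic. -/
theorem DifferInDisc.isIsomorphic {L L' : LinkoidDiagram n m} {φ : PlaneDiffeo}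
    {J : Fin r → StrandInterval n m} (h : L.DifferInDisc L' φ J)
    (hhi : ∀ i, ¬ L.under (J i).comp (J i).hi) (hhi' : ∀ i, ¬ L'.under (J i).comp (J i).hi)
    (hext : ∀ (X : Type) [Quandle X] (g : Fin r → ℝ → X), L.IsLocalColoring J g →
      ∃ g' : Fin r → ℝ → X, L'.IsLocalColoring J g' ∧ ∀ i, g' i (J i).lo = g i (J i).lo ∧
        g' i (J i).hi = g i (J i).hi)
    (hext' : ∀ (X : Type) [Quandle X] (g : Fin r → ℝ → X), L'.IsLocalColoring J g →
      ∃ g' : Fin r → ℝ → X, L.IsLocalColoring J g' ∧ ∀ i, g' i (J i).lo = g i (J i).lo ∧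
        g' i (J i).hi = g i (J i).hi)
    (huniq : ∀ (X : Type) [Quandle X] (g g' : Fin r → ℝ → X), L.IsLocalColoring J g →
      L.IsLocalColoring J g' → (∀ i, g i (J i).lo = g' i (J i).lo) →
      ∀ i, ∀ t ∈ Icc (J i).lo (J i).hi, g i t = g' i t)
    (huniq' : ∀ (X : Type) [Quandle X] (g g' : Fin r → ℝ → X), L'.IsLocalColoring J g →
      L'.IsLocalColoring J g' → (∀ i, g i (J i).lo = g' i (J i).lo) →
      ∀ i, ∀ t ∈ Icc (J i).lo (J i).hi, g i t = g' i t) :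
    L.fundamentalPointedQuandle.IsIsomorphic L'.fundamentalPointedQuandle := by
  refine isIsomorphic_of_isColoring (S := {p : StrandParam n m // ¬ ∃ i, (J i).Mem p})
    Subtype.val Subtype.val ?_ ?_ ?_ ?_ ?_
  · intro i t ht
    exact ⟨⟨(Sum.inl i, t), fun ⟨j, hj⟩ => (J j).not_mem_endpoint ht hj⟩, rfl, rfl⟩
  · intro X _ c hc
    obtain ⟨g, hg, h1⟩ := hext X _ (hc.isLocalColoring h.disjoint)
    exact ⟨_, h.isColoring_fill hhi hhi' hc hg (fun i => (h1 i).1) (fun i => (h1 i).2),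
      fun s => fill_of_not_mem g c s.2⟩
  · intro X _ c hc
    obtain ⟨g, hg, h1⟩ := hext' X _ (hc.isLocalColoring h.disjoint)
    exact ⟨_, h.symm.isColoring_fill hhi' hhi hc hg (fun i => (h1 i).1) (fun i => (h1 i).2),
      fun s => fill_of_not_mem g c s.2⟩
  · intro X _ c d hc hd hcd
    exact hc.eq_of_eq_outside h.disjoint (huniq X) hd fun p hp => hcd ⟨p, hp⟩
  · intro X _ c d hc hd hcd
    exact hc.eq_of_eq_outside h.disjoint (huniq' X) hd fun p hp => hcd ⟨p, hp⟩

end LinkoidDiagram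

/-! ## Signs of functions and derivatives -/

theorem sign_eq_of_ne_zero {f : ℝ → ℝ} {S : Set ℝ} (hS : IsPreconnected S) (hf : Continuous f)
    (h0 : ∀ x ∈ S, f x ≠ 0) {x y : ℝ} (hx : x ∈ S) (hy : y ∈ S) :
    SignType.sign (f x) = SignType.sign (f y) :=
  hS.constant (f := fun x => SignType.sign (f x)) (fun z hz =>
    ((continuousAt_sign_of_ne_zero (h0 z hz)).comp hf.continuousAt).continuousWithinAt) hx hy

theorem eventually_sign_slope {f : ℝ → ℝ} {a d : ℝ} (hd : d ≠ 0) (h : HasDerivAt f d a) :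
    ∀ᶠ x in 𝓝[≠] a, SignType.sign (slope f a x) = SignType.sign d := by
  have := (continuousAt_sign_of_ne_zero hd).tendsto.comp (hasDerivAt_iff_tendsto_slope.1 h)
  rw [nhds_discrete, tendsto_pure] at this
  exact this

/-- After a simple zero, a function without further zeros has the sign of the derivative. -/
theorem sign_deriv_eq_right {f : ℝ → ℝ} {a b d : ℝ} (hab : a < b) (hf : Continuous f)
    (h0 : ∀ x ∈ Ioc a b, f x ≠ 0) (hd : d ≠ 0) (h : HasDerivAt f d a) (ha : f a = 0) :
    SignType.sign d = SignType.sign (f b) := by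
  obtain ⟨x, hx, hxb⟩ := (((eventually_sign_slope hd h).filter_mono
    (nhdsWithin_mono a (s := Ioi a) fun x hx => (mem_Ioi.1 hx).ne')).and (Ioc_mem_nhdsGT hab)).exists
  rw [← hx, slope_def_field, ha, sub_zero, div_eq_mul_inv, sign_mul,
    sign_pos (inv_pos.2 (sub_pos.2 hxb.1)), mul_one]
  exact sign_eq_of_ne_zero isPreconnected_Ioc hf h0 hxb ⟨hab, le_rfl⟩

/-- Before a simple zero, a function without further zeros has the sign opposite to that of the
derivative. -/
theorem sign_deriv_eq_left {f : ℝ → ℝ} {a b d : ℝ} (hab : a < b) (hf : Continuous f)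
    (h0 : ∀ x ∈ Ico a b, f x ≠ 0) (hd : d ≠ 0) (h : HasDerivAt f d b) (hb : f b = 0) :
    SignType.sign d = -SignType.sign (f a) := by
  obtain ⟨x, hx, hxb⟩ := (((eventually_sign_slope hd h).filter_mono
    (nhdsWithin_mono b (s := Iio b) fun x hx => (mem_Iio.1 hx).ne)).and (Ico_mem_nhdsLT hab)).exists
  rw [← hx, slope_def_field, hb, sub_zero, div_eq_mul_inv, sign_mul,
    sign_neg (inv_lt_zero.2 (sub_neg.2 hxb.2)),
    sign_eq_of_ne_zero isPreconnected_Ico hf h0 hxb ⟨le_rfl, hab⟩]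
  simp

/-- A nondegenerate interval determines the derivative even at its endpoints, where only one-sided
agreement is available. -/
theorem deriv_eq_of_eqOn_Icc {E : Type*} [NormedAddCommGroup E] [NormedSpace ℝ E] {f g : ℝ → E}
    {a b x : ℝ} (hab : a < b) (hx : x ∈ Icc a b) (hf : DifferentiableAt ℝ f x)
    (hg : DifferentiableAt ℝ g x) (h : EqOn f g (Icc a b)) : deriv f x = deriv g x :=
  (uniqueDiffOn_Icc hab x hx).eq_deriv _ hf.hasDerivAt.hasDerivWithinAt
    ((hg.hasDerivAt.hasDerivWithinAt).congr h (h hx))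

theorem HasDerivAt.complex_re {f : ℝ → ℂ} {f' : ℂ} {x : ℝ} (h : HasDerivAt f f' x) :
    HasDerivAt (fun y => (f y).re) f'.re x :=
  Complex.reCLM.hasFDerivAt.comp_hasDerivAt x h

theorem HasDerivAt.complex_im {f : ℝ → ℂ} {f' : ℂ} {x : ℝ} (h : HasDerivAt f f' x) :
    HasDerivAt (fun y => (f y).im) f'.im x :=
  Complex.imCLM.hasFDerivAt.comp_hasDerivAt x h

/-! ## Step functions -/

/-- The left-continuous step function with values `x`, `y`, `z` and jumps at `s` and `t`. -/
noncomputable def stepFun {X : Type} (s t : ℝ) (x y z : X) (τ : ℝ) : X :=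
  if τ ≤ s then x else if τ ≤ t then y else z

theorem stepFun_left {X : Type} (s t : ℝ) (x y z : X) (τ : ℝ) :
    ∀ᶠ a in 𝓝[<] τ, stepFun s t x y z a = stepFun s t x y z τ := by
  have h : ∀ w : ℝ, ∀ᶠ a in 𝓝[<] τ, a ≤ w ↔ τ ≤ w := by
    intro w
    rcases le_or_gt τ w with hw | hw
    · filter_upwards [self_mem_nhdsWithin] with a ha
      exact iff_of_true ((mem_Iio.1 ha).le.trans hw) hw
    · filter_upwards [Ioo_mem_nhdsLT hw] with a ha
      exact iff_of_false (not_le.2 ha.1) (not_le.2 hw)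
  filter_upwards [h s, h t] with a h1 h2
  simp only [stepFun, h1, h2]

theorem stepFun_right {X : Type} {s t : ℝ} (x y z : X) {τ : ℝ} (hs : τ ≠ s) (ht : τ ≠ t) :
    ∀ᶠ a in 𝓝[>] τ, stepFun s t x y z a = stepFun s t x y z τ := by
  have h : ∀ w : ℝ, τ ≠ w → ∀ᶠ a in 𝓝[>] τ, a ≤ w ↔ τ ≤ w := by
    intro w hne
    rcases hne.lt_or_gt with hw | hw
    · filter_upwards [Ioo_mem_nhdsGT hw] with a ha
      exact iff_of_true ha.2.le hw.le
    · filter_upwards [self_mem_nhdsWithin] with a ha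
      exact iff_of_false (not_le.2 (hw.trans ha)) (not_le.2 hw)
  filter_upwards [h s hs, h t ht] with a h1 h2
  simp only [stepFun, h1, h2]

theorem stepFun_right_first {X : Type} {s t : ℝ} (hst : s < t) (x y z : X) :
    ∀ᶠ a in 𝓝[>] s, stepFun s t x y z a = y := by
  filter_upwards [Ioo_mem_nhdsGT hst] with a ha
  rw [stepFun, if_neg (not_le.2 ha.1), if_pos ha.2.le]

theorem stepFun_right_second {X : Type} {s t : ℝ} (hst : s < t) (x y z : X) :
    ∀ᶠ a in 𝓝[>] t, stepFun s t x y z a = z := by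
  filter_upwards [self_mem_nhdsWithin] with a ha
  have ha : t < a := ha
  rw [stepFun, if_neg (not_le.2 (hst.trans ha)), if_neg (not_le.2 ha)]

theorem stepFun_of_le {X : Type} {s t : ℝ} (x y z : X) {τ : ℝ} (h : τ ≤ s) :
    stepFun s t x y z τ = x := if_pos h

theorem stepFun_mid {X : Type} {s t : ℝ} (x y z : X) {τ : ℝ} (h : s < τ) (h' : τ ≤ t) :
    stepFun s t x y z τ = y := by
  rw [stepFun, if_neg (not_le.2 h), if_pos h']

theorem stepFun_of_lt {X : Type} {s t : ℝ} (hst : s < t) (x y z : X) {τ : ℝ} (h : t < τ) :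
    stepFun s t x y z τ = z := by
  rw [stepFun, if_neg (not_le.2 (hst.trans h)), if_neg (not_le.2 h)]

theorem stepFun_jump_first {X : Type} {s t : ℝ} (hst : s < t) {x y : X} (z : X) {P : X → X}
    (h : P x = y) : ∀ᶠ a in 𝓝[>] s, stepFun s t x y z a = P (stepFun s t x y z s) := by
  rw [stepFun_of_le _ _ _ le_rfl, h]
  exact stepFun_right_first hst x y z

theorem stepFun_jump_second {X : Type} {s t : ℝ} (hst : s < t) (x : X) {y z : X} {P : X → X}
    (h : P y = z) : ∀ᶠ a in 𝓝[>] t, stepFun s t x y z a = P (stepFun s t x y z t) := by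
  rw [stepFun_mid _ _ _ hst le_rfl, h]
  exact stepFun_right_second hst x y z

/-- A function that is locally constant up to two jumps. -/
theorem eq_of_two_jumps {X : Type} {g : ℝ → X} {a b s t : ℝ} {P Q : X → X} (hs : a ≤ s)
    (hst : s < t) (ht : t < b) (hl : ∀ τ ∈ Ioc a b, ∀ᶠ x in 𝓝[<] τ, g x = g τ)
    (hr : ∀ τ ∈ Ico a b, τ ≠ s → τ ≠ t → ∀ᶠ x in 𝓝[>] τ, g x = g τ)
    (hP : ∀ᶠ x in 𝓝[>] s, g x = P (g s)) (hQ : ∀ᶠ x in 𝓝[>] t, g x = Q (g t)) :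
    g b = Q (P (g a)) := by
  have h1 : g s = g a := eqOn_Icc_of_eventually
    (fun τ hτ => hl τ ⟨hτ.1, by linarith [hτ.2]⟩)
    (fun τ hτ => hr τ ⟨hτ.1, by linarith [hτ.2]⟩ hτ.2.ne (hτ.2.trans hst).ne) s ⟨hs, le_rfl⟩
  have h2 : g t = P (g s) := eqOn_Ioc_of_eventually
    (fun τ hτ => hl τ ⟨by linarith [hτ.1], by linarith [hτ.2]⟩)
    (fun τ hτ => hr τ ⟨by linarith [hτ.1], by linarith [hτ.2]⟩ hτ.1.ne' hτ.2.ne) hP t ⟨hst, le_rfl⟩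
  have h3 : g b = Q (g t) := eqOn_Ioc_of_eventually
    (fun τ hτ => hl τ ⟨by linarith [hτ.1], by linarith [hτ.2]⟩)
    (fun τ hτ => hr τ ⟨by linarith [hτ.1], by linarith [hτ.2]⟩ (hst.trans hτ.1).ne' hτ.1.ne') hQ b
    ⟨ht, le_rfl⟩
  rw [h3, h2, h1]

/-- A function that is locally constant up to one jump. -/
theorem eq_of_one_jump {X : Type} {g : ℝ → X} {a b s : ℝ} {P : X → X}
    (hs : s ∈ Ico a b) (hl : ∀ τ ∈ Ioc a b, ∀ᶠ x in 𝓝[<] τ, g x = g τ)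
    (hr : ∀ τ ∈ Ico a b, τ ≠ s → ∀ᶠ x in 𝓝[>] τ, g x = g τ)
    (hP : ∀ᶠ x in 𝓝[>] s, g x = P (g s)) :
    (∀ τ ∈ Icc a s, g τ = g a) ∧ ∀ τ ∈ Ioc s b, g τ = P (g a) := by
  have h1 : ∀ τ ∈ Icc a s, g τ = g a := eqOn_Icc_of_eventually
    (fun τ hτ => hl τ ⟨hτ.1, by linarith [hτ.2, hs.2]⟩)
    (fun τ hτ => hr τ ⟨hτ.1, by linarith [hτ.2, hs.2]⟩ hτ.2.ne)
  have h2 : ∀ τ ∈ Ioc s b, g τ = P (g s) := eqOn_Ioc_of_eventually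
    (fun τ hτ => hl τ ⟨by linarith [hτ.1, hs.1], hτ.2⟩)
    (fun τ hτ => hr τ ⟨by linarith [hτ.1, hs.1], hτ.2⟩ hτ.1.ne') hP
  refine ⟨h1, fun τ hτ => ?_⟩
  rw [h2 τ hτ, h1 s ⟨hs.1, le_rfl⟩]

/-- Idempotence, the axiom behind the first move. -/
theorem crossingPerm_self {X : Type} [Quandle X] (d : ℝ) (x : X) : crossingPerm d x x = x := by
  rcases lt_trichotomy d 0 with h | h | h
  · rw [crossingPerm_of_neg h, Quandle.fix_inv]
  · simp [crossingPerm, h]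
  · rw [crossingPerm_of_pos h, Quandle.fix]

/-! ### Strands and crossings in the coordinates of the disc -/

namespace LinkoidDiagram

open StrandInterval

variable {n m r : ℕ} {L L' : LinkoidDiagram n m} {φ : PlaneDiffeo} {J : Fin r → StrandInterval n m}

theorem inChart_eq {i j : Fin r} {t u : ℝ}
    (h : L.curve (J j).comp u = L.curve (J i).comp t) :
    L.inChart φ (J j) u = L.inChart φ (J i) t := congrArg φ.toEquiv h

theorem hasDerivAt_inChart (L : LinkoidDiagram n m) (φ : PlaneDiffeo) (I : StrandInterval n m)
    (t : ℝ) : HasDerivAt (L.inChart φ I)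
      (fderiv ℝ φ.toEquiv (L.curve I.comp t) (deriv (L.curve I.comp) t)) t :=
  ((φ.smooth.differentiable (by simp) _).hasFDerivAt).comp_hasDerivAt t
    (L.differentiableAt _ t).hasDerivAt

theorem contDiff_inChart (L : LinkoidDiagram n m) (φ : PlaneDiffeo) (I : StrandInterval n m) :
    ContDiff ℝ ∞ (L.inChart φ I) := φ.smooth.comp (L.smooth I.comp)

theorem hasDerivAt_inChart' (L : LinkoidDiagram n m) (φ : PlaneDiffeo) (I : StrandInterval n m)
    (t : ℝ) : HasDerivAt (L.inChart φ I) (deriv (L.inChart φ I) t) t :=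
  (L.hasDerivAt_inChart φ I t).differentiableAt.hasDerivAt

theorem continuous_inChart (L : LinkoidDiagram n m) (φ : PlaneDiffeo) (I : StrandInterval n m) :
    Continuous (L.inChart φ I) := (L.contDiff_inChart φ I).continuous

theorem continuous_deriv_inChart (L : LinkoidDiagram n m) (φ : PlaneDiffeo)
    (I : StrandInterval n m) : Continuous (deriv (L.inChart φ I)) :=
  (L.contDiff_inChart φ I).continuous_deriv (by simp)

/-- If the derivative `A` of the chart killed the velocity `v ≠ 0`, then `planeDet (A v) (A (i v)) =
det A * |v|²` would vanish, against `0 < det A`. -/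
theorem deriv_inChart_ne_zero (L : LinkoidDiagram n m) (φ : PlaneDiffeo) (I : StrandInterval n m)
    {t : ℝ} (ht : t ∈ Icc I.lo I.hi) : deriv (L.inChart φ I) t ≠ 0 := by
  rw [(L.hasDerivAt_inChart φ I t).deriv]
  intro h
  have h1 := planeDet_map (fderiv ℝ φ.toEquiv (L.curve I.comp t)) (deriv (L.curve I.comp) t)
    (Complex.I * deriv (L.curve I.comp) t)
  have h2 : planeDet (deriv (L.curve I.comp) t) (Complex.I * deriv (L.curve I.comp) t) =
      Complex.normSq (deriv (L.curve I.comp) t) := by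
    simp [planeDet, Complex.normSq_apply]
  rw [h, h2] at h1
  have h3 := mul_pos (φ.orientation (L.curve I.comp t))
    (Complex.normSq_pos.2 (L.immersed (I.comp, t) (I.inDomain_of_mem_Icc ht)))
  rw [← h1] at h3
  simp [planeDet] at h3

theorem sign_planeDet_inChart {I I' : StrandInterval n m} {t u : ℝ}
    (h : L.curve I'.comp u = L.curve I.comp t) :
    SignType.sign (planeDet (deriv (L.curve I'.comp) u) (deriv (L.curve I.comp) t)) =
    SignType.sign (planeDet (deriv (L.inChart φ I') u) (deriv (L.inChart φ I) t)) := by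
  rw [(L.hasDerivAt_inChart φ I' u).deriv, (L.hasDerivAt_inChart φ I t).deriv, h,
    sign_planeDet_map (φ.orientation _)]

namespace DifferInDisc

theorem not_same (h : L.DifferInDisc L' φ J) {i j : Fin r} {t u : ℝ}
    (ht : t ∈ Icc (J i).lo (J i).hi) (hu : u ∈ Icc (J j).lo (J j).hi) (hne : ¬ (j = i ∧ u = t)) :
    ¬ StrandParam.Same (((J i).comp, t) : StrandParam n m) ((J j).comp, u) :=
  fun hs => hne (eq_and_eq_of_same h.disjoint hu ht hs.symm)

theorem under_iff (h : L.DifferInDisc L' φ J) {i j : Fin r} {t u : ℝ}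
    (ht : t ∈ Icc (J i).lo (J i).hi) (hu : u ∈ Icc (J j).lo (J j).hi) (hne : ¬ (j = i ∧ u = t))
    (he : L.curve (J j).comp u = L.curve (J i).comp t) :
    L.under (J i).comp t ↔ ¬ L.under (J j).comp u :=
  L.under_xor _ _ ((J i).inDomain_of_mem_Icc ht) ((J j).inDomain_of_mem_Icc hu)
    (h.not_same ht hu hne) he.symm

theorem planeDet_ne_zero (h : L.DifferInDisc L' φ J) {i j : Fin r} {t u : ℝ}
    (ht : t ∈ Icc (J i).lo (J i).hi) (hu : u ∈ Icc (J j).lo (J j).hi) (hne : ¬ (j = i ∧ u = t))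
    (he : L.curve (J j).comp u = L.curve (J i).comp t) :
    planeDet (deriv (L.inChart φ (J j)) u) (deriv (L.inChart φ (J i)) t) ≠ 0 := by
  rw [← sign_ne_zero, ← sign_planeDet_inChart he, sign_ne_zero]
  exact L.transverse _ _ ((J j).inDomain_of_mem_Icc hu) ((J i).inDomain_of_mem_Icc ht)
    (fun hs => h.not_same ht hu hne hs.symm) he

theorem exists_upper (h : L.DifferInDisc L' φ J) {i : Fin r} {t : ℝ}
    (ht : t ∈ Icc (J i).lo (J i).hi) (hu : L.under (J i).comp t) :
    ∃ j, ∃ u ∈ Icc (J j).lo (J j).hi, ¬ (j = i ∧ u = t) ∧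
      L.curve (J j).comp u = L.curve (J i).comp t ∧ ¬ L.under (J j).comp u := by
  obtain ⟨-, q, hq, hne, he⟩ := L.under_double ((J i).comp, t) hu
  obtain ⟨j, u, huJ, hs⟩ := h.exists_of_curve_eq ht hq he.symm
  have he' : L.curve (J j).comp u = L.curve (J i).comp t := (L.curve_same hs).trans he.symm
  have hne' : ¬ (j = i ∧ u = t) := by
    rintro ⟨rfl, rfl⟩
    exact hne hs
  exact ⟨j, u, huJ, hne', he', (h.under_iff ht huJ hne' he').1 hu⟩

/-- There are no triple points. Hence the jump condition at an undercrossing has to be checked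
against one upper point only. -/
theorem upper_unique (h : L.DifferInDisc L' φ J) {i j k : Fin r} {t u v : ℝ}
    (ht : t ∈ Icc (J i).lo (J i).hi) (hu : u ∈ Icc (J j).lo (J j).hi)
    (hv : v ∈ Icc (J k).lo (J k).hi) (hne : ¬ (j = i ∧ u = t)) (hne' : ¬ (k = i ∧ v = t))
    (he : L.curve (J j).comp u = L.curve (J i).comp t)
    (he' : L.curve (J k).comp v = L.curve (J i).comp t) : j = k ∧ u = v := by
  rcases L.no_triple ((J i).comp, t) ((J j).comp, u) ((J k).comp, v)
    ((J i).inDomain_of_mem_Icc ht) ((J j).inDomain_of_mem_Icc hu) ((J k).inDomain_of_mem_Icc hv)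
    he.symm he'.symm with hs | hs | hs
  · exact (h.not_same ht hu hne hs).elim
  · exact (h.not_same ht hv hne' hs).elim
  · exact eq_and_eq_of_same h.disjoint hu hv hs

/-- The curves agree just before the strand enters the disc, hence by continuity at its end. -/
theorem curve_lo (h : L.DifferInDisc L' φ J) (i : Fin r) :
    L.curve (J i).comp (J i).lo = L'.curve (J i).comp (J i).lo := by
  have hd : ∀ᶠ s in 𝓝[<] (J i).lo, StrandParam.InDomain (((J i).comp, s) : StrandParam n m) := by
    by_cases hl : (J i).comp.isLeft
    · have h1 := (J i).open_proper hl
      filter_upwards [Ioo_mem_nhdsLT h1.1] with s hs _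
      exact ⟨hs.1.le, by linarith [hs.2, (J i).lo_lt_hi]⟩
    · exact Eventually.of_forall fun s h => absurd h hl
  refine tendsto_nhds_unique_of_eventuallyEq
    (((L.smooth (J i).comp).continuous.tendsto _).mono_left (nhdsWithin_le_nhds (s := Iio (J i).lo)))
    (((L'.smooth (J i).comp).continuous.tendsto _).mono_left nhdsWithin_le_nhds) ?_
  filter_upwards [hd, eventually_not_mem_left h.disjoint i] with s h1 h2
  exact (h.agree _ h1 h2).1

theorem curve_hi (h : L.DifferInDisc L' φ J) (i : Fin r) :
    L.curve (J i).comp (J i).hi = L'.curve (J i).comp (J i).hi := by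
  have hd : ∀ᶠ s in 𝓝[>] (J i).hi, StrandParam.InDomain (((J i).comp, s) : StrandParam n m) := by
    by_cases hl : (J i).comp.isLeft
    · have h1 := (J i).open_proper hl
      filter_upwards [Ioo_mem_nhdsGT h1.2] with s hs _
      exact ⟨by linarith [hs.1, (J i).lo_lt_hi], hs.2.le⟩
    · exact Eventually.of_forall fun s h => absurd h hl
  refine tendsto_nhds_unique_of_eventuallyEq
    (((L.smooth (J i).comp).continuous.tendsto _).mono_left (nhdsWithin_le_nhds (s := Ioi (J i).hi)))
    (((L'.smooth (J i).comp).continuous.tendsto _).mono_left nhdsWithin_le_nhds) ?_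
  filter_upwards [hd, eventually_not_mem_right h.disjoint i] with s h1 h2
  exact (h.agree _ h1 h2).1

end DifferInDisc

namespace IsLocalColoring

variable {X : Type} [Quandle X] {g g' : Fin r → ℝ → X}

theorem eq_lo (hg : L.IsLocalColoring J g) {i : Fin r}
    (h : ∀ t ∈ Icc (J i).lo (J i).hi, ¬ L.under (J i).comp t) :
    ∀ t ∈ Icc (J i).lo (J i).hi, g i t = g i (J i).lo :=
  eqOn_Icc_of_eventually (hg.left i) fun t ht => hg.right i t ht (h t (Ico_subset_Icc_self ht))

/-- Local colourings are determined by the colours of the incoming ends if the strands can be ordered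
by height. -/
theorem eq_of_rank (rank : Fin r → ℕ)
    (h : ∀ i, ∀ t ∈ Icc (J i).lo (J i).hi, L.under (J i).comp t → ∃ j, ∃ u ∈ Icc (J j).lo (J j).hi,
      L.curve (J j).comp u = L.curve (J i).comp t ∧ rank j < rank i)
    (hg : L.IsLocalColoring J g) (hg' : L.IsLocalColoring J g')
    (hlo : ∀ i, g i (J i).lo = g' i (J i).lo) :
    ∀ i, ∀ t ∈ Icc (J i).lo (J i).hi, g i t = g' i t := by
  suffices H : ∀ N, ∀ i, rank i < N → ∀ t ∈ Icc (J i).lo (J i).hi, g i t = g' i t from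
    fun i => H _ i (Nat.lt_succ_self _)
  intro N
  induction N with
  | zero => exact fun i hi => absurd hi (Nat.not_lt_zero _)
  | succ N ih =>
    intro i hi t ht
    -- The locally constant function is the truth value of the equality. At an undercrossing the
    -- upper colours agree by induction, so both colours change by the same bijection.
    have key := eqOn_Icc_of_eventually (g := fun t => g i t = g' i t) (a := (J i).lo) (b := (J i).hi)
      (fun τ hτ => by
        filter_upwards [hg.left i τ hτ, hg'.left i τ hτ] with s h1 h2
        rw [h1, h2])
      (fun τ hτ => by
        by_cases hu : L.under (J i).comp τ
        · obtain ⟨j, u, huJ, he, hlt⟩ := h i τ (Ico_subset_Icc_self hτ) hu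
          have hne : ¬ (j = i ∧ u = τ) := fun h => by
            rw [h.1] at hlt
            exact lt_irrefl _ hlt
          filter_upwards [hg.cross i τ hτ hu j u huJ hne he, hg'.cross i τ hτ hu j u huJ hne he]
            with s h1 h2
          rw [h1, h2, ih j (by omega) u huJ, EmbeddingLike.apply_eq_iff_eq]
        · filter_upwards [hg.right i τ hτ hu, hg'.right i τ hτ hu] with s h1 h2
          rw [h1, h2])
      t ht
    simp only [hlo, eq_iff_iff, iff_true] at key
    exact key

end IsLocalColoring

/-! ## The first move -/

/-- On either side of the move a local colouring is constant: without a crossing trivially, with the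
kink because a strand crossing under itself jumps by the action of one of its own two colours. So
the same function serves for both diagrams. -/
theorem ReidemeisterOne.isIsomorphic (h : L.ReidemeisterOne L') :
    L.fundamentalPointedQuandle.IsIsomorphic L'.fundamentalPointedQuandle := by
  obtain ⟨φ, J, h, hemb, s, hs, t, ht, hst, hx⟩ := h
  have hconst : ∀ (D : LinkoidDiagram n m) (X : Type) [Quandle X] (g : Fin 1 → ℝ → X),
      (∀ x ∈ Icc (J 0).lo (J 0).hi, g 0 x = g 0 (J 0).lo) → D.IsLocalColoring J g := by
    intro D X _ g hg
    refine ⟨fun i x hx => ?_, fun i x hx _ => ?_, fun i x hx _ j u hu _ _ => ?_⟩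
    · fin_cases i
      filter_upwards [Ioo_mem_nhdsLT hx.1] with y hy
      exact (hg y ⟨hy.1.le, hy.2.le.trans hx.2⟩).trans (hg x (Ioc_subset_Icc_self hx)).symm
    · fin_cases i
      filter_upwards [Ioo_mem_nhdsGT hx.2] with y hy
      exact (hg y ⟨hx.1.trans hy.1.le, hy.2.le⟩).trans (hg x (Ico_subset_Icc_self hx)).symm
    · fin_cases i
      fin_cases j
      filter_upwards [Ioo_mem_nhdsGT hx.2] with y hy
      have e1 := hg y ⟨hx.1.trans hy.1.le, hy.2.le⟩
      have e2 := hg x (Ico_subset_Icc_self hx)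
      have e3 := hg u hu
      simp only [Fin.zero_eta, Fin.isValue] at e1 e2 e3 ⊢
      rw [e1, e2, e3, crossingPerm_self]
  have hL : ∀ i, ∀ x ∈ Icc (J i).lo (J i).hi, ¬ L.under (J i).comp x := by
    intro i x hx hu
    obtain ⟨j, u, huJ, hne, he, -⟩ := h.exists_upper hx hu
    fin_cases i
    fin_cases j
    exact hne ⟨rfl, hemb huJ hx he⟩
  have hst' : L'.curve (J 0).comp s = L'.curve (J 0).comp t :=
    (hx s (Ioo_subset_Icc_self hs) t (Ioo_subset_Icc_self ht) hst).2 ⟨rfl, rfl⟩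
  -- Here `w` is the lower and `v` the upper parameter of the kink, in whichever order they occur.
  obtain ⟨w, v, hw, hv, hwv, he, hu, hu'⟩ : ∃ w v, w ∈ Ioo (J 0).lo (J 0).hi ∧
      v ∈ Ioo (J 0).lo (J 0).hi ∧ v ≠ w ∧ L'.curve (J 0).comp v = L'.curve (J 0).comp w ∧
      L'.under (J 0).comp w ∧ ∀ x ∈ Icc (J 0).lo (J 0).hi, L'.under (J 0).comp x → x = w := by
    have hx' : ∀ x ∈ Icc (J 0).lo (J 0).hi, L'.under (J 0).comp x → x = s ∨ x = t := by
      intro x hxJ hu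
      obtain ⟨j, u, huJ, hne, he, -⟩ := h.symm.exists_upper hxJ hu
      fin_cases j
      rcases lt_trichotomy x u with h1 | h1 | h1
      · exact Or.inl ((hx x hxJ u huJ h1).1 he.symm).1
      · exact (hne ⟨rfl, h1.symm⟩).elim
      · exact Or.inr ((hx u huJ x hxJ h1).1 he).2
    have hxor := h.symm.under_iff (Ioo_subset_Icc_self hs) (Ioo_subset_Icc_self ht)
      (fun h => hst.ne' h.2) hst'.symm
    by_cases hus : L'.under (J 0).comp s
    · refine ⟨s, t, hs, ht, hst.ne', hst'.symm, hus, fun x hxJ hux => ?_⟩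
      rcases hx' x hxJ hux with rfl | rfl
      · rfl
      · exact (hxor.1 hus hux).elim
    · have hut : L'.under (J 0).comp t := by
        by_contra hut
        exact hus (hxor.2 hut)
      refine ⟨t, s, ht, hs, hst.ne, hst', hut, fun x hxJ hux => ?_⟩
      rcases hx' x hxJ hux with rfl | rfl
      · exact (hus hux).elim
      · rfl
  have hc : ∀ (X : Type) [Quandle X] (g : Fin 1 → ℝ → X), L.IsLocalColoring J g →
      ∀ x ∈ Icc (J 0).lo (J 0).hi, g 0 x = g 0 (J 0).lo :=
    fun X _ g hg => hg.eq_lo (hL 0)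
  have hc' : ∀ (X : Type) [Quandle X] (g : Fin 1 → ℝ → X), L'.IsLocalColoring J g →
      ∀ x ∈ Icc (J 0).lo (J 0).hi, g 0 x = g 0 (J 0).lo := by
    intro X _ g hg
    obtain ⟨h1, h2⟩ := eq_of_one_jump (Ioo_subset_Ico_self hw) (hg.left 0)
      (fun τ hτ hne => hg.right 0 τ hτ fun h => hne (hu' τ (Ico_subset_Icc_self hτ) h))
      (hg.cross 0 w (Ioo_subset_Ico_self hw) hu 0 v (Ioo_subset_Icc_self hv)
        (fun h => hwv h.2) he)
    have h3 : g 0 v = g 0 (J 0).lo := by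
      rcases hwv.lt_or_gt with h4 | h4
      · exact h1 v ⟨hv.1.le, h4.le⟩
      · have h5 := h2 v ⟨h4, hv.2.le⟩
        -- If the upper point comes later, its colour `y` is the result of `y` acting on the initial
        -- colour; it is also the result of `y` acting on `y`, and the action is injective.
        nth_rewrite 1 [← crossingPerm_self (planeDet (deriv (L'.curve (J 0).comp) v)
          (deriv (L'.curve (J 0).comp) w)) (g 0 v)] at h5
        exact (crossingPerm _ _).injective h5
    intro x hx
    rcases le_or_gt x w with h4 | h4
    · exact h1 x ⟨hx.1, h4⟩
    · rw [h2 x ⟨h4, hx.2⟩, h3, crossingPerm_self]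
  refine h.isIsomorphic (fun i => hL i _ ⟨(J i).lo_lt_hi.le, le_rfl⟩) (fun i hi => ?_)
    (fun X _ g hg => ⟨g, hconst L' X g (hc X g hg), fun i => ⟨rfl, rfl⟩⟩)
    (fun X _ g hg => ⟨g, hconst L X g (hc' X g hg), fun i => ⟨rfl, rfl⟩⟩)
    (fun X _ g g' hg hg' hlo i x hx => ?_) (fun X _ g g' hg hg' hlo i x hx => ?_)
  · fin_cases i
    exact hw.2.ne' (hu' _ ⟨(J 0).lo_lt_hi.le, le_rfl⟩ hi)
  · fin_cases i
    exact (hc X g hg x hx).trans ((hlo 0).trans (hc X g' hg' x hx).symm)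
  · fin_cases i
    exact (hc' X g hg x hx).trans ((hlo 0).trans (hc' X g' hg' x hx).symm)

end LinkoidDiagram

namespace LinkoidDiagram

open StrandInterval

variable {n m r : ℕ} {L L' : LinkoidDiagram n m} {φ : PlaneDiffeo} {J : Fin r → StrandInterval n m}

theorem inChart_congr {I : StrandInterval n m} {t : ℝ}
    (h : L.curve I.comp t = L'.curve I.comp t) : L.inChart φ I t = L'.inChart φ I t :=
  congrArg φ.toEquiv h

/-! ## Strands on the axes -/

theorem deriv_im_eq_zero {f : ℝ → ℂ} (hf : Differentiable ℝ f) {a b x : ℝ} (hab : a < b)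
    (hx : x ∈ Icc a b) (h : ∀ t ∈ Icc a b, (f t).im = 0) : (deriv f x).im = 0 := by
  have h1 := (hf x).hasDerivAt.complex_im
  rw [← h1.deriv, deriv_eq_of_eqOn_Icc hab hx h1.differentiableAt (differentiableAt_const (0 : ℝ)) h,
    deriv_const]

theorem deriv_re_eq_zero {f : ℝ → ℂ} (hf : Differentiable ℝ f) {a b x : ℝ} (hab : a < b)
    (hx : x ∈ Icc a b) (h : ∀ t ∈ Icc a b, (f t).re = 0) : (deriv f x).re = 0 := by
  have h1 := (hf x).hasDerivAt.complex_re
  rw [← h1.deriv, deriv_eq_of_eqOn_Icc hab hx h1.differentiableAt (differentiableAt_const (0 : ℝ)) h,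
    deriv_const]

theorem differentiable_inChart (L : LinkoidDiagram n m) (φ : PlaneDiffeo)
    (I : StrandInterval n m) : Differentiable ℝ (L.inChart φ I) :=
  (L.contDiff_inChart φ I).differentiable (by simp)

/-- The direction of a strand on the real axis. -/
theorem exists_sign_of_im_eq_zero {I : StrandInterval n m}
    (h : ∀ t ∈ Icc I.lo I.hi, (L.inChart φ I t).im = 0) :
    ∃ ε : SignType, ε ≠ 0 ∧ ∀ t ∈ Icc I.lo I.hi, (deriv (L.inChart φ I) t).im = 0 ∧
      SignType.sign (deriv (L.inChart φ I) t).re = ε := by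
  have h1 : ∀ t ∈ Icc I.lo I.hi, (deriv (L.inChart φ I) t).im = 0 := fun t ht =>
    deriv_im_eq_zero (L.differentiable_inChart φ I) I.lo_lt_hi ht h
  have h2 : ∀ t ∈ Icc I.lo I.hi, (deriv (L.inChart φ I) t).re ≠ 0 := fun t ht h3 =>
    L.deriv_inChart_ne_zero φ I ht (Complex.ext h3 (h1 t ht))
  have hlo : I.lo ∈ Icc I.lo I.hi := ⟨le_rfl, I.lo_lt_hi.le⟩
  exact ⟨_, sign_ne_zero.2 (h2 _ hlo), fun t ht => ⟨h1 t ht, sign_eq_of_ne_zero isPreconnected_Icc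
    (Complex.continuous_re.comp (L.continuous_deriv_inChart φ I)) h2 ht hlo⟩⟩

/-- The direction of a strand on the imaginary axis. -/
theorem exists_sign_of_re_eq_zero {I : StrandInterval n m}
    (h : ∀ t ∈ Icc I.lo I.hi, (L.inChart φ I t).re = 0) :
    ∃ ε : SignType, ε ≠ 0 ∧ ∀ t ∈ Icc I.lo I.hi, (deriv (L.inChart φ I) t).re = 0 ∧
      SignType.sign (deriv (L.inChart φ I) t).im = ε := by
  have h1 : ∀ t ∈ Icc I.lo I.hi, (deriv (L.inChart φ I) t).re = 0 := fun t ht =>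
    deriv_re_eq_zero (L.differentiable_inChart φ I) I.lo_lt_hi ht h
  have h2 : ∀ t ∈ Icc I.lo I.hi, (deriv (L.inChart φ I) t).im ≠ 0 := fun t ht h3 =>
    L.deriv_inChart_ne_zero φ I ht (Complex.ext (h1 t ht) h3)
  have hlo : I.lo ∈ Icc I.lo I.hi := ⟨le_rfl, I.lo_lt_hi.le⟩
  exact ⟨_, sign_ne_zero.2 (h2 _ hlo), fun t ht => ⟨h1 t ht, sign_eq_of_ne_zero isPreconnected_Icc
    (Complex.continuous_im.comp (L.continuous_deriv_inChart φ I)) h2 ht hlo⟩⟩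

theorem planeDet_of_im_eq_zero {v : ℂ} (h : v.im = 0) (w : ℂ) : planeDet v w = v.re * w.im := by
  simp [planeDet, h]

theorem planeDet_of_re_eq_zero {v : ℂ} (h : v.re = 0) (w : ℂ) : planeDet v w = -(v.im * w.re) := by
  simp [planeDet, h]

/-- The cancellation behind the second move: crossings of opposite sign under the same colour undo
each other. -/
theorem crossingPerm_eq_inv {X : Type} [Quandle X] {d d' : ℝ}
    (h : SignType.sign d = -SignType.sign d') (y : X) :
    crossingPerm d y = (crossingPerm d' y)⁻¹ := by
  rw [crossingPerm, crossingPerm, h, ← zpow_neg]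
  congr 1
  generalize SignType.sign d' = a
  cases a <;> rfl

/-! ## The second move -/

/-- The strand `J 1` starts and ends above the real axis and meets it only at `s` and `t`, so it
crosses downwards at `s` and upwards at `t`. The strand `J 0` runs along the axis in one direction;
hence the two crossings have opposite signs and the jumps cancel. -/
theorem ReidemeisterTwo.isIsomorphic (h : L.ReidemeisterTwo L') :
    L.fundamentalPointedQuandle.IsIsomorphic L'.fundamentalPointedQuandle := by
  obtain ⟨φ, J, h, hemb, h0, h1, s, hs, t, ht, hst, hx, hus, hut⟩ := h
  have h0' : ∀ x ∈ Icc (J 0).lo (J 0).hi, (L'.inChart φ (J 0) x).im = 0 := fun x hx => by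
    rw [← inChart_congr (h0 x hx).1]
    exact (h0 x hx).2
  have hlo : ∀ i, (J i).lo ∈ Icc (J i).lo (J i).hi := fun i => ⟨le_rfl, (J i).lo_lt_hi.le⟩
  have hhi : ∀ i, (J i).hi ∈ Icc (J i).lo (J i).hi := fun i => ⟨(J i).lo_lt_hi.le, le_rfl⟩
  -- The ends of a strand are common to both diagrams, so positivity passes from `L` to `L'`.
  have hplo : 0 < (L'.inChart φ (J 1) (J 1).lo).im := by
    rw [← inChart_congr (h.curve_lo 1)]
    exact h1 _ (hlo 1)
  have hphi : 0 < (L'.inChart φ (J 1) (J 1).hi).im := by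
    rw [← inChart_congr (h.curve_hi 1)]
    exact h1 _ (hhi 1)
  have hs0 : (L'.inChart φ (J 1) s).im = 0 := (hx s hs).2 (Or.inl rfl)
  have ht0 : (L'.inChart φ (J 1) t).im = 0 := (hx t ht).2 (Or.inr rfl)
  have hlos : (J 1).lo < s := lt_of_le_of_ne hs.1 fun h2 => by
    rw [h2, hs0] at hplo
    exact lt_irrefl _ hplo
  have hthi : t < (J 1).hi := lt_of_le_of_ne ht.2 fun h2 => by
    rw [← h2, ht0] at hphi
    exact lt_irrefl _ hphi
  have hL : ∀ i, ∀ x ∈ Icc (J i).lo (J i).hi, ¬ L.under (J i).comp x := by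
    intro i x hxJ hu
    obtain ⟨j, u, huJ, hne, he, -⟩ := h.exists_upper hxJ hu
    have hc := inChart_eq (φ := φ) he
    fin_cases i <;> fin_cases j
    · exact hne ⟨rfl, (hemb 0).1 huJ hxJ he⟩
    · have := h1 u huJ
      simp only [Fin.mk_one, Fin.zero_eta] at hc
      rw [hc, (h0 x hxJ).2] at this
      exact lt_irrefl _ this
    · have := h1 x hxJ
      simp only [Fin.mk_one, Fin.zero_eta] at hc
      rw [← hc, (h0 u huJ).2] at this
      exact lt_irrefl _ this
    · exact hne ⟨rfl, (hemb 1).1 huJ hxJ he⟩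
  have hL0 : ∀ x ∈ Icc (J 0).lo (J 0).hi, ¬ L'.under (J 0).comp x := by
    intro x hxJ hu
    obtain ⟨j, u, huJ, hne, he, hnu⟩ := h.symm.exists_upper hxJ hu
    fin_cases j
    · exact hne ⟨rfl, (hemb 0).2 huJ hxJ he⟩
    · have hc := inChart_eq (φ := φ) he
      simp only [Fin.mk_one] at hc
      rcases (hx u huJ).1 (by rw [hc, h0' x hxJ]) with rfl | rfl
      · exact hnu hus
      · exact hnu hut
  have hup : ∀ x ∈ Icc (J 1).lo (J 1).hi, L'.under (J 1).comp x →
      ∃ u ∈ Icc (J 0).lo (J 0).hi, L'.curve (J 0).comp u = L'.curve (J 1).comp x := by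
    intro x hxJ hu
    obtain ⟨j, u, huJ, hne, he, hnu⟩ := h.symm.exists_upper hxJ hu
    fin_cases j
    · exact ⟨u, huJ, he⟩
    · exact (hne ⟨rfl, (hemb 1).2 huJ hxJ he⟩).elim
  have hL1 : ∀ x ∈ Icc (J 1).lo (J 1).hi, L'.under (J 1).comp x → x = s ∨ x = t := by
    intro x hxJ hu
    obtain ⟨u, huJ, he⟩ := hup x hxJ hu
    rw [← hx x hxJ, ← inChart_eq he]
    exact h0' u huJ
  obtain ⟨u, hu, heu⟩ := hup s hs hus
  obtain ⟨v, hv, hev⟩ := hup t ht hut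
  -- The constant direction `ε` of `J 0` makes the signs of its velocity at `u` and at `v` equal.
  obtain ⟨ε, hε, hε'⟩ := exists_sign_of_im_eq_zero h0'
  have hne01 : ∀ a b : ℝ, ¬ ((0 : Fin 2) = 1 ∧ a = b) := fun a b h => by simp at h
  have hds : SignType.sign (deriv (L'.inChart φ (J 1)) s).im = -1 := by
    have hd : (deriv (L'.inChart φ (J 1)) s).im ≠ 0 := fun h2 =>
      h.symm.planeDet_ne_zero hs hu (hne01 _ _) heu
        (by rw [planeDet_of_im_eq_zero (hε' u hu).1, h2, mul_zero])
    rw [sign_deriv_eq_left hlos (Complex.continuous_im.comp (L'.continuous_inChart φ (J 1)))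
      (fun x hxI h2 => ?_) hd (L'.hasDerivAt_inChart' φ (J 1) s).complex_im hs0]
    · exact congrArg Neg.neg (sign_pos hplo)
    · rcases (hx x ⟨hxI.1, hxI.2.le.trans hs.2⟩).1 h2 with rfl | rfl
      · exact lt_irrefl _ hxI.2
      · exact lt_asymm hst hxI.2
  have hdt : SignType.sign (deriv (L'.inChart φ (J 1)) t).im = 1 := by
    have hd : (deriv (L'.inChart φ (J 1)) t).im ≠ 0 := fun h2 =>
      h.symm.planeDet_ne_zero ht hv (hne01 _ _) hev
        (by rw [planeDet_of_im_eq_zero (hε' v hv).1, h2, mul_zero])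
    rw [sign_deriv_eq_right hthi (Complex.continuous_im.comp (L'.continuous_inChart φ (J 1)))
      (fun x hxI h2 => ?_) hd (L'.hasDerivAt_inChart' φ (J 1) t).complex_im ht0]
    · exact sign_pos hphi
    · rcases (hx x ⟨ht.1.trans hxI.1.le, hxI.2⟩).1 h2 with rfl | rfl
      · exact lt_asymm hst hxI.1
      · exact lt_irrefl _ hxI.1
  have hsign : SignType.sign (planeDet (deriv (L'.curve (J 0).comp) v)
      (deriv (L'.curve (J 1).comp) t)) = -SignType.sign (planeDet (deriv (L'.curve (J 0).comp) u)
      (deriv (L'.curve (J 1).comp) s)) := by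
    rw [sign_planeDet_inChart (φ := φ) heu, sign_planeDet_inChart (φ := φ) hev,
      planeDet_of_im_eq_zero (hε' u hu).1, planeDet_of_im_eq_zero (hε' v hv).1, sign_mul, sign_mul,
      hds, hdt, (hε' u hu).2, (hε' v hv).2]
    simp
  refine h.isIsomorphic (fun i => hL i _ (hhi i)) (fun i hi => ?_) (fun X _ g hg => ?_)
    (fun X _ g hg => ?_) (fun X _ g g' hg hg' hlo => hg.eq_of_rank (fun _ => 0)
      (fun i x hxJ hu => (hL i x hxJ hu).elim) hg' hlo)
    (fun X _ g g' hg hg' hlo => hg.eq_of_rank (fun i => i.1) (fun i x hxJ hu => ?_) hg' hlo)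
  · fin_cases i
    · exact hL0 _ (hhi 0) hi
    · rcases hL1 _ (hhi 1) hi with h2 | h2
      · exact ((hst.trans hthi).ne h2.symm).elim
      · exact (hthi.ne h2.symm).elim
  · have hc := fun i => hg.eq_lo (hL i)
    -- The colour of `J 1` between the crossings is forced by the first jump; the second jump
    -- restores the initial colour.
    refine ⟨![fun _ => g 0 (J 0).lo, stepFun s t (g 1 (J 1).lo) (crossingPerm
      (planeDet (deriv (L'.curve (J 0).comp) u) (deriv (L'.curve (J 1).comp) s)) (g 0 (J 0).lo)
      (g 1 (J 1).lo)) (g 1 (J 1).lo)], ⟨fun i x hx => ?_, fun i x hxJ hnu => ?_,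
        fun i x hxJ hxu j w hw hne he => ?_⟩, fun i => ?_⟩
    · fin_cases i
      · exact Eventually.of_forall fun _ => rfl
      · exact stepFun_left _ _ _ _ _ _
    · fin_cases i
      · exact Eventually.of_forall fun _ => rfl
      · refine stepFun_right _ _ _ ?_ ?_
        · rintro rfl
          exact hnu hus
        · rintro rfl
          exact hnu hut
    · have hxJ' := Ico_subset_Icc_self hxJ
      fin_cases i
      · exact (hL0 x hxJ' hxu).elim
      · rcases hL1 x hxJ' hxu with rfl | rfl
        · obtain ⟨rfl, rfl⟩ := h.symm.upper_unique hs hw hu hne (hne01 _ _) he heu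
          exact stepFun_jump_first hst _ rfl
        · obtain ⟨rfl, rfl⟩ := h.symm.upper_unique ht hw hv hne (hne01 _ _) he hev
          refine stepFun_jump_second hst _ ?_
          exact (DFunLike.congr_fun (crossingPerm_eq_inv hsign (g 0 (J 0).lo)) _).trans
            (Equiv.symm_apply_apply _ _)
    · fin_cases i
      · exact ⟨rfl, (hc 0 _ (hhi 0)).symm⟩
      · exact ⟨stepFun_of_le _ _ _ hlos.le,
          (stepFun_of_lt hst _ _ _ hthi).trans (hc 1 _ (hhi 1)).symm⟩
  · have hc := hg.eq_lo hL0
    refine ⟨fun i _ => g i (J i).lo, ⟨fun i x hx => Eventually.of_forall fun _ => rfl,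
      fun i x hxJ hnu => Eventually.of_forall fun _ => rfl,
      fun i x hxJ hxu => (hL i x (Ico_subset_Icc_self hxJ) hxu).elim⟩, fun i => ⟨rfl, ?_⟩⟩
    fin_cases i
    · exact (hc _ (hhi 0)).symm
    · refine ((eq_of_two_jumps hlos.le hst hthi (hg.left 1) (fun τ hτ h2 h3 => hg.right 1 τ hτ ?_)
        (hg.cross 1 s ⟨hs.1, hst.trans hthi⟩ hus 0 u hu (hne01 _ _) heu)
        (hg.cross 1 t ⟨ht.1, hthi⟩ hut 0 v hv (hne01 _ _) hev)).trans ?_).symm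
      · exact fun h4 => (hL1 τ (Ico_subset_Icc_self hτ) h4).elim h2 h3
      · rw [hc u hu, hc v hv, crossingPerm_eq_inv hsign]
        exact Equiv.symm_apply_apply _ _
  · fin_cases i
    · exact (hL0 x hxJ hu).elim
    · obtain ⟨w, hw, he⟩ := hup x hxJ hu
      exact ⟨0, w, hw, he, Nat.zero_lt_one⟩

end LinkoidDiagram

/-! ## The third move -/

theorem sign_eq_of_mul_pos {a b : ℝ} (h : 0 < a * b) : SignType.sign b = SignType.sign a := by
  rcases mul_pos_iff.1 h with ⟨h1, h2⟩ | ⟨h1, h2⟩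
  · rw [sign_pos h1, sign_pos h2]
  · rw [sign_neg h1, sign_neg h2]

/-- The intermediate value theorem; a zero differs from `x` and `y`, where `f` is nonzero, and is
therefore interior. -/
theorem exists_zero_mem_Ioo {f : ℝ → ℝ} (hf : Continuous f) {a b x y : ℝ} (hx : x ∈ Icc a b)
    (hy : y ∈ Icc a b) {σ : SignType} (hσ : σ ≠ 0) (h : SignType.sign (f x) = σ)
    (h' : SignType.sign (f y) = -σ) : ∃ z ∈ Ioo a b, f z = 0 := by
  by_contra! hne
  have h0 : ∀ z ∈ uIcc x y, f z ≠ 0 := by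
    intro z hz hz0
    have hzx : z ≠ x := by
      rintro rfl
      rw [hz0, sign_zero] at h
      exact hσ h.symm
    have hzy : z ≠ y := by
      rintro rfl
      rw [hz0, sign_zero] at h'
      revert hσ h'
      cases σ <;> decide
    rcases mem_uIcc.1 hz with h1 | h1
    · exact hne z ⟨hx.1.trans_lt (lt_of_le_of_ne h1.1 hzx.symm),
        (lt_of_le_of_ne h1.2 hzy).trans_le hy.2⟩ hz0
    · exact hne z ⟨hy.1.trans_lt (lt_of_le_of_ne h1.1 hzy.symm),
        (lt_of_le_of_ne h1.2 hzx).trans_le hx.2⟩ hz0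
  have := sign_eq_of_ne_zero isPreconnected_uIcc hf h0 left_mem_uIcc right_mem_uIcc
  rw [h, h'] at this
  revert hσ this
  cases σ <;> decide

/-- The permutation `y ▷ ·`, its inverse, or the identity. -/
def signPerm {X : Type} [Quandle X] (a : SignType) (y : X) : Equiv.Perm X := Rack.act' y ^ (a : ℤ)

theorem crossingPerm_eq_signPerm {X : Type} [Quandle X] (d : ℝ) (y : X) :
    crossingPerm d y = signPerm (SignType.sign d) y := rfl

theorem signPerm_neg {X : Type} [Quandle X] (a : SignType) (y : X) :
    signPerm (-a) y = (signPerm a y)⁻¹ := by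
  rw [signPerm, signPerm, ← zpow_neg]
  congr 1
  cases a <;> rfl

/-- Self-distributivity says that the action of `y ◃ x` is the conjugate of the action of `x` by
that of `y`. The inverse case follows by applying this to `signPerm (-1) y x`. -/
theorem act'_signPerm {X : Type} [Quandle X] (a : SignType) (y x : X) :
    Rack.act' (signPerm a y x) = signPerm a y * Rack.act' x * (signPerm a y)⁻¹ := by
  have h1 : signPerm 1 y = Rack.act' y := zpow_one _
  have h : ∀ x, Rack.act' (signPerm 1 y x) = signPerm 1 y * Rack.act' x * (signPerm 1 y)⁻¹ := by
    intro x
    rw [h1]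
    exact Rack.ad_conj y x
  cases a with
  | zero => simp [signPerm]
  | pos => exact h x
  | neg =>
    have h2 := h (signPerm (-1) y x)
    rw [signPerm_neg] at h2
    rw [show signPerm 1 y ((signPerm 1 y)⁻¹ x) = x from Equiv.apply_symm_apply _ _] at h2
    change Rack.act' (signPerm (-1) y x) = signPerm (-1) y * Rack.act' x * (signPerm (-1) y)⁻¹
    rw [h2, signPerm_neg]
    group

/-- The algebra of the third move: passing under two strands on either side of their crossing has
the same total effect. -/
theorem signPerm_signPerm_mul {X : Type} [Quandle X] (a e : SignType) (y x : X) :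
    signPerm e (signPerm a y x) * signPerm a y = signPerm a y * signPerm e x := by
  rw [signPerm, act'_signPerm, conj_zpow, inv_mul_cancel_right]
  rfl

theorem mul_signPerm_signPerm {X : Type} [Quandle X] (a e : SignType) (y x : X) :
    signPerm (-a) y * signPerm e (signPerm a y x) = signPerm e x * signPerm (-a) y := by
  rw [signPerm_neg, inv_mul_eq_iff_eq_mul, ← mul_assoc, ← signPerm_signPerm_mul,
    mul_inv_cancel_right]

/-- The values on the two sides of a jump. -/
theorem eq_or_eq_of_jump {X : Type} {g : ℝ → X} {f : ℝ → ℝ} {a b w x y : ℝ} {Q : X → X} {c : X}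
    {ε σ : SignType} (hε : ε ≠ 0) (hσ : σ ≠ 0) (hw : f w = 0)
    (hl : ∀ τ ∈ Icc a b, τ < w → SignType.sign (f τ) = -ε)
    (hr : ∀ τ ∈ Icc a b, w < τ → SignType.sign (f τ) = ε)
    (hgl : ∀ τ ∈ Icc a w, g τ = c) (hgr : ∀ τ ∈ Ioc w b, g τ = Q c) (hx : x ∈ Icc a b)
    (hy : y ∈ Icc a b) (hfx : SignType.sign (f x) = σ) (hfy : SignType.sign (f y) = -σ) :
    (σ = ε ∧ g x = Q (g y)) ∨ (σ = -ε ∧ g y = Q (g x)) := by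
  have hne : ∀ z, SignType.sign (f z) ≠ 0 → z ≠ w := by
    rintro z hz rfl
    rw [hw, sign_zero] at hz
    exact hz rfl
  have hnσ : -σ ≠ 0 := by
    revert hσ
    cases σ <;> decide
  have hself : ε ≠ -ε := by
    revert hε
    cases ε <;> decide
  rcases (hne x (hfx ▸ hσ)).lt_or_gt with h1 | h1 <;> rcases (hne y (hfy ▸ hnσ)).lt_or_gt with h2 | h2
  · have e1 := hl x hx h1
    have e2 := hl y hy h2
    rw [hfx] at e1
    rw [hfy, e1, neg_neg] at e2
    exact (hself e2).elim
  · refine Or.inr ⟨hfx ▸ hl x hx h1, ?_⟩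
    rw [hgl x ⟨hx.1, h1.le⟩, hgr y ⟨h2, hy.2⟩]
  · refine Or.inl ⟨hfx ▸ hr x hx h1, ?_⟩
    rw [hgr x ⟨h1, hx.2⟩, hgl y ⟨hy.1, h2.le⟩]
  · have e1 := hr x hx h1
    have e2 := hr y hy h2
    rw [hfx] at e1
    rw [hfy, e1] at e2
    exact (hself e2.symm).elim

/-! ### Geometry of the third move -/

namespace LinkoidDiagram

open StrandInterval

variable {n m : ℕ} {L L' : LinkoidDiagram n m} {φ : PlaneDiffeo} {J : Fin 3 → StrandInterval n m}

/-- The third move, from the side `σ` to the side `-σ`. -/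
structure IsThirdMove (L L' : LinkoidDiagram n m) (φ : PlaneDiffeo)
    (J : Fin 3 → StrandInterval n m) (σ : ℝ) : Prop where
  differ : L.DifferInDisc L' φ J
  embedded : ∀ i, L.EmbeddedOn (J i) ∧ L'.EmbeddedOn (J i)
  horizontal : ∀ t ∈ Icc (J 0).lo (J 0).hi,
    L.curve (J 0).comp t = L'.curve (J 0).comp t ∧ (L.inChart φ (J 0) t).im = 0 ∧
    (L.inChart φ (J 0) t = 0 → (L.under (J 0).comp t ↔ L'.under (J 0).comp t))
  vertical : ∀ t ∈ Icc (J 1).lo (J 1).hi,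
    L.curve (J 1).comp t = L'.curve (J 1).comp t ∧ (L.inChart φ (J 1) t).re = 0
  side : σ ≠ 0
  passes : L.PassesUnderAxes φ (J 2) σ
  passes' : L'.PassesUnderAxes φ (J 2) (-σ)

theorem IsThirdMove.symm {σ : ℝ} (H : L.IsThirdMove L' φ J σ) : L'.IsThirdMove L φ J (-σ) where
  differ := H.differ.symm
  embedded i := (H.embedded i).symm
  horizontal t ht := by
    obtain ⟨h1, h2, h3⟩ := H.horizontal t ht
    rw [← inChart_congr h1]
    exact ⟨h1.symm, h2, fun h => (h3 h).symm⟩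
  vertical t ht := by
    obtain ⟨h1, h2⟩ := H.vertical t ht
    rw [← inChart_congr h1]
    exact ⟨h1.symm, h2⟩
  side := neg_ne_zero.2 H.side
  passes := H.passes'
  passes' := by
    rw [neg_neg]
    exact H.passes

/-- The strand `J 2` passes under `J 0` at `s` and under `J 1` at `t`. -/
structure Passage (L : LinkoidDiagram n m) (φ : PlaneDiffeo) (J : Fin 3 → StrandInterval n m)
    (σ ε₀ ε₁ μ : SignType) (s t u v : ℝ) : Prop where
  mem_s : s ∈ Ioo (J 2).lo (J 2).hi
  mem_t : t ∈ Ioo (J 2).lo (J 2).hi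
  mem_u : u ∈ Icc (J 0).lo (J 0).hi
  mem_v : v ∈ Icc (J 1).lo (J 1).hi
  under_s : L.under (J 2).comp s
  under_t : L.under (J 2).comp t
  under : ∀ x ∈ Icc (J 2).lo (J 2).hi, L.under (J 2).comp x → x = s ∨ x = t
  curve_s : L.curve (J 0).comp u = L.curve (J 2).comp s
  curve_t : L.curve (J 1).comp v = L.curve (J 2).comp t
  sign_u : SignType.sign (L.inChart φ (J 0) u).re = σ
  sign_v : SignType.sign (L.inChart φ (J 1) v).im = σ
  det_s : SignType.sign (planeDet (deriv (L.curve (J 0).comp) u) (deriv (L.curve (J 2).comp) s)) =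
    ε₀ * μ
  det_t : SignType.sign (planeDet (deriv (L.curve (J 1).comp) v) (deriv (L.curve (J 2).comp) t)) =
    ε₁ * μ
  order : (s < t ∧ μ = σ) ∨ (t < s ∧ μ = -σ)

/-- The crossing of the strands `J 0` and `J 1`. -/
structure AxesCrossing (L : LinkoidDiagram n m) (φ : PlaneDiffeo) (J : Fin 3 → StrandInterval n m)
    (ε₀ ε₁ : SignType) (t₀ v₀ : ℝ) : Prop where
  mem_zero : t₀ ∈ Ioo (J 0).lo (J 0).hi
  mem_one : v₀ ∈ Ioo (J 1).lo (J 1).hi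
  zero_zero : L.inChart φ (J 0) t₀ = 0
  one_zero : L.inChart φ (J 1) v₀ = 0
  under_zero : ∀ x ∈ Icc (J 0).lo (J 0).hi, L.under (J 0).comp x → x = t₀
  under_one : ∀ x ∈ Icc (J 1).lo (J 1).hi, L.under (J 1).comp x → x = v₀
  under_iff : L.under (J 0).comp t₀ ↔ ¬ L.under (J 1).comp v₀
  curve : L.curve (J 1).comp v₀ = L.curve (J 0).comp t₀
  det : SignType.sign (planeDet (deriv (L.curve (J 0).comp) t₀) (deriv (L.curve (J 1).comp) v₀)) =
    ε₀ * ε₁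
  sign_zero_left : ∀ x ∈ Icc (J 0).lo (J 0).hi, x < t₀ →
    SignType.sign (L.inChart φ (J 0) x).re = -ε₀
  sign_zero_right : ∀ x ∈ Icc (J 0).lo (J 0).hi, t₀ < x →
    SignType.sign (L.inChart φ (J 0) x).re = ε₀
  sign_one_left : ∀ x ∈ Icc (J 1).lo (J 1).hi, x < v₀ →
    SignType.sign (L.inChart φ (J 1) x).im = -ε₁
  sign_one_right : ∀ x ∈ Icc (J 1).lo (J 1).hi, v₀ < x →
    SignType.sign (L.inChart φ (J 1) x).im = ε₁

theorem fin_three_cases (j : Fin 3) : j = 0 ∨ j = 1 ∨ j = 2 := by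
  fin_cases j <;> simp

theorem not_and_of_ne {a b : Fin 3} (h : a ≠ b) (x y : ℝ) : ¬ (a = b ∧ x = y) := fun h' => h h'.1

/-- Let `μ` be the sign of the imaginary part at the outgoing end of `J 2`. After `s` the strand
stays on the side `μ` of the real axis, before `s` on the other one, and it meets the imaginary axis
on the side `σ`; so the order of `s` and `t` is decided by comparing `μ` with `σ`. The end is common
to both diagrams, hence so is `μ`, and replacing `σ` by `-σ` reverses the order. -/
theorem IsThirdMove.exists_passage {σ : ℝ} (H : L.IsThirdMove L' φ J σ) {ε₀ ε₁ : SignType}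
    (h0 : ∀ t ∈ Icc (J 0).lo (J 0).hi, (deriv (L.inChart φ (J 0)) t).im = 0 ∧
      SignType.sign (deriv (L.inChart φ (J 0)) t).re = ε₀)
    (h1 : ∀ t ∈ Icc (J 1).lo (J 1).hi, (deriv (L.inChart φ (J 1)) t).re = 0 ∧
      SignType.sign (deriv (L.inChart φ (J 1)) t).im = ε₁) :
    ∃ s t u v, L.Passage φ J (SignType.sign σ) ε₀ ε₁
      (SignType.sign (L.inChart φ (J 2) (J 2).hi).im) s t u v := by
  obtain ⟨s, hs, t, ht, him, hsre, hre, htim, hus, hut⟩ := H.passes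
  obtain ⟨s', hs', t', ht', him', hsre', hre', htim', -, -⟩ := H.passes'
  -- A parameter where the diagrams agree cannot be a passage: `L'` would cross the same axis at the
  -- same point, but its passage lies on the opposite half-axis.
  have hend : ∀ e ∈ Icc (J 2).lo (J 2).hi, L.curve (J 2).comp e = L'.curve (J 2).comp e →
      s ≠ e ∧ t ≠ e := by
    intro e he hc
    have hc' := inChart_congr (φ := φ) hc
    constructor
    · rintro rfl
      have h2 := (him s hs).2 rfl
      rw [hc', him' s hs] at h2
      rw [← h2, ← hc'] at hsre'
      linarith
    · rintro rfl
      have h2 := (hre t ht).2 rfl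
      rw [hc', hre' t ht] at h2
      rw [← h2, ← hc'] at htim'
      linarith
  have hlo := hend _ ⟨le_rfl, (J 2).lo_lt_hi.le⟩ (H.differ.curve_lo 2)
  have hhi := hend _ ⟨(J 2).lo_lt_hi.le, le_rfl⟩ (H.differ.curve_hi 2)
  have hs2 : s ∈ Ioo (J 2).lo (J 2).hi :=
    ⟨lt_of_le_of_ne hs.1 hlo.1.symm, lt_of_le_of_ne hs.2 hhi.1⟩
  have ht2 : t ∈ Ioo (J 2).lo (J 2).hi :=
    ⟨lt_of_le_of_ne ht.1 hlo.2.symm, lt_of_le_of_ne ht.2 hhi.2⟩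
  have hup : ∀ x ∈ Icc (J 2).lo (J 2).hi, L.under (J 2).comp x →
      (∃ u ∈ Icc (J 0).lo (J 0).hi, L.curve (J 0).comp u = L.curve (J 2).comp x ∧
        (L.inChart φ (J 2) x).im = 0) ∨
      (∃ v ∈ Icc (J 1).lo (J 1).hi, L.curve (J 1).comp v = L.curve (J 2).comp x ∧
        (L.inChart φ (J 2) x).re = 0) := by
    intro x hx hu
    obtain ⟨j, w, hw, hne, he, -⟩ := H.differ.exists_upper hx hu
    obtain rfl | rfl | rfl := fin_three_cases j
    · exact Or.inl ⟨w, hw, he, by rw [← inChart_eq he]; exact (H.horizontal w hw).2.1⟩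
    · exact Or.inr ⟨w, hw, he, by rw [← inChart_eq he]; exact (H.vertical w hw).2⟩
    · exact (hne ⟨rfl, (H.embedded 2).1 hw hx he⟩).elim
  have hs0 := (him s hs).2 rfl
  have ht0 := (hre t ht).2 rfl
  have hsre0 : (L.inChart φ (J 2) s).re ≠ 0 := fun h => by
    rw [h, mul_zero] at hsre
    exact lt_irrefl _ hsre
  have htim0 : (L.inChart φ (J 2) t).im ≠ 0 := fun h => by
    rw [h, mul_zero] at htim
    exact lt_irrefl _ htim
  obtain ⟨u, hu, heu⟩ : ∃ u ∈ Icc (J 0).lo (J 0).hi,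
      L.curve (J 0).comp u = L.curve (J 2).comp s := by
    rcases hup s hs hus with ⟨u, hu, he, -⟩ | ⟨-, -, -, h⟩
    · exact ⟨u, hu, he⟩
    · exact (hsre0 h).elim
  obtain ⟨v, hv, hev⟩ : ∃ v ∈ Icc (J 1).lo (J 1).hi,
      L.curve (J 1).comp v = L.curve (J 2).comp t := by
    rcases hup t ht hut with ⟨-, -, -, h⟩ | ⟨v, hv, he, -⟩
    · exact (htim0 h).elim
    · exact ⟨v, hv, he⟩
  have hds : (deriv (L.inChart φ (J 2)) s).im ≠ 0 := fun h2 =>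
    H.differ.planeDet_ne_zero hs hu (not_and_of_ne (by decide) _ _) heu
      (by rw [planeDet_of_im_eq_zero (h0 u hu).1, h2, mul_zero])
  have hdt : (deriv (L.inChart φ (J 2)) t).re ≠ 0 := fun h2 =>
    H.differ.planeDet_ne_zero ht hv (not_and_of_ne (by decide) _ _) hev
      (by rw [planeDet_of_re_eq_zero (h1 v hv).1, h2, mul_zero, neg_zero])
  have cre := Complex.continuous_re.comp (L.continuous_inChart φ (J 2))
  have cim := Complex.continuous_im.comp (L.continuous_inChart φ (J 2))
  have dre := (L.hasDerivAt_inChart' φ (J 2) t).complex_re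
  have dim := (L.hasDerivAt_inChart' φ (J 2) s).complex_im
  have him0 : ∀ x ∈ Icc (J 2).lo (J 2).hi, x ≠ s → (L.inChart φ (J 2) x).im ≠ 0 :=
    fun x hx hne h => hne ((him x hx).1 h)
  have hre0 : ∀ x ∈ Icc (J 2).lo (J 2).hi, x ≠ t → (L.inChart φ (J 2) x).re ≠ 0 :=
    fun x hx hne h => hne ((hre x hx).1 h)
  have hμ : SignType.sign (deriv (L.inChart φ (J 2)) s).im =
      SignType.sign (L.inChart φ (J 2) (J 2).hi).im :=
    sign_deriv_eq_right hs2.2 cim (fun x hx => him0 x ⟨hs.1.trans hx.1.le, hx.2⟩ hx.1.ne') hds dim hs0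
  have hst : s ≠ t := by
    rintro rfl
    exact hsre0 ht0
  have hsσ := sign_eq_of_mul_pos hsre
  have htσ := sign_eq_of_mul_pos htim
  have horder : (s < t ∧ SignType.sign (deriv (L.inChart φ (J 2)) s).im = SignType.sign σ ∧
      SignType.sign (deriv (L.inChart φ (J 2)) t).re = -SignType.sign σ) ∨
      (t < s ∧ SignType.sign (deriv (L.inChart φ (J 2)) s).im = -SignType.sign σ ∧
      SignType.sign (deriv (L.inChart φ (J 2)) t).re = SignType.sign σ) := by
    rcases hst.lt_or_gt with hlt | hlt
    · refine Or.inl ⟨hlt, ?_, ?_⟩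
      · rw [← htσ]
        exact sign_deriv_eq_right hlt cim
          (fun x hx => him0 x ⟨hs.1.trans hx.1.le, hx.2.trans ht.2⟩ hx.1.ne') hds dim hs0
      · rw [← hsσ]
        exact sign_deriv_eq_left hlt cre
          (fun x hx => hre0 x ⟨hs.1.trans hx.1, hx.2.le.trans ht.2⟩ hx.2.ne) hdt dre ht0
    · refine Or.inr ⟨hlt, ?_, ?_⟩
      · rw [← htσ]
        exact sign_deriv_eq_left hlt cim
          (fun x hx => him0 x ⟨ht.1.trans hx.1, hx.2.le.trans hs.2⟩ hx.2.ne) hds dim hs0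
      · rw [← hsσ]
        exact sign_deriv_eq_right hlt cre
          (fun x hx => hre0 x ⟨ht.1.trans hx.1.le, hx.2.trans hs.2⟩ hx.1.ne') hdt dre ht0
  refine ⟨s, t, u, v, hs2, ht2, hu, hv, hus, hut, fun x hx hux => ?_, heu, hev, ?_, ?_, ?_, ?_, ?_⟩
  · rcases hup x hx hux with ⟨-, -, -, h⟩ | ⟨-, -, -, h⟩
    · exact Or.inl ((him x hx).1 h)
    · exact Or.inr ((hre x hx).1 h)
  · rw [inChart_eq heu, hsσ]
  · rw [inChart_eq hev, htσ]
  · rw [sign_planeDet_inChart (φ := φ) heu, planeDet_of_im_eq_zero (h0 u hu).1, sign_mul,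
      (h0 u hu).2, hμ]
  -- The minus sign in the determinant is absorbed: in either order the real part at `t` and the
  -- imaginary part at `s` change in opposite directions.
  · rw [sign_planeDet_inChart (φ := φ) hev, planeDet_of_re_eq_zero (h1 v hv).1, Left.sign_neg,
      sign_mul, (h1 v hv).2, ← hμ, ← mul_neg]
    rcases horder with ⟨-, h2, h3⟩ | ⟨-, h2, h3⟩
    · rw [h2, h3, neg_neg]
    · rw [h2, h3]
  · rw [← hμ]
    exact horder.imp (fun h => ⟨h.1, h.2.1⟩) fun h => ⟨h.1, h.2.1⟩

/-- The strands on the axes are embedded, so they meet only at the origin. `J 2` is the lower strand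
wherever it meets them, so neither has an undercrossing elsewhere. -/
theorem IsThirdMove.axesCrossing {σ : ℝ} (H : L.IsThirdMove L' φ J σ) {ε₀ ε₁ : SignType}
    (hε₀ : ε₀ ≠ 0) (hε₁ : ε₁ ≠ 0)
    (h0 : ∀ t ∈ Icc (J 0).lo (J 0).hi, (deriv (L.inChart φ (J 0)) t).im = 0 ∧
      SignType.sign (deriv (L.inChart φ (J 0)) t).re = ε₀)
    (h1 : ∀ t ∈ Icc (J 1).lo (J 1).hi, (deriv (L.inChart φ (J 1)) t).re = 0 ∧
      SignType.sign (deriv (L.inChart φ (J 1)) t).im = ε₁) {t₀ v₀ : ℝ}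
    (ht₀ : t₀ ∈ Ioo (J 0).lo (J 0).hi) (hv₀ : v₀ ∈ Ioo (J 1).lo (J 1).hi)
    (hzero : L.inChart φ (J 0) t₀ = 0) (hone : L.inChart φ (J 1) v₀ = 0) :
    L.AxesCrossing φ J ε₀ ε₁ t₀ v₀ := by
  obtain ⟨s, hs, t, ht, him, hsre, hre, htim, hus, hut⟩ := H.passes
  have ht₀' := Ioo_subset_Icc_self ht₀
  have hv₀' := Ioo_subset_Icc_self hv₀
  have hinj0 : ∀ x ∈ Icc (J 0).lo (J 0).hi, (L.inChart φ (J 0) x).re = 0 → x = t₀ := by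
    intro x hx h
    refine (H.embedded 0).1 hx ht₀' (φ.toEquiv.injective ?_)
    exact (Complex.ext h (H.horizontal x hx).2.1 : L.inChart φ (J 0) x = 0).trans hzero.symm
  have hinj1 : ∀ x ∈ Icc (J 1).lo (J 1).hi, (L.inChart φ (J 1) x).im = 0 → x = v₀ := by
    intro x hx h
    refine (H.embedded 1).1 hx hv₀' (φ.toEquiv.injective ?_)
    exact (Complex.ext (H.vertical x hx).2 h : L.inChart φ (J 1) x = 0).trans hone.symm
  have hcurve : L.curve (J 1).comp v₀ = L.curve (J 0).comp t₀ :=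
    φ.toEquiv.injective (hone.trans hzero.symm)
  have cre := Complex.continuous_re.comp (L.continuous_inChart φ (J 0))
  have cim := Complex.continuous_im.comp (L.continuous_inChart φ (J 1))
  have dre := (L.hasDerivAt_inChart' φ (J 0) t₀).complex_re
  have dim := (L.hasDerivAt_inChart' φ (J 1) v₀).complex_im
  have hre0 : (L.inChart φ (J 0) t₀).re = 0 := by rw [hzero, Complex.zero_re]
  have him0 : (L.inChart φ (J 1) v₀).im = 0 := by rw [hone, Complex.zero_im]
  have hdre : (deriv (L.inChart φ (J 0)) t₀).re ≠ 0 := by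
    rw [← sign_ne_zero, (h0 t₀ ht₀').2]
    exact hε₀
  have hdim : (deriv (L.inChart φ (J 1)) v₀).im ≠ 0 := by
    rw [← sign_ne_zero, (h1 v₀ hv₀').2]
    exact hε₁
  refine ⟨ht₀, hv₀, hzero, hone, fun x hx hu => ?_, fun x hx hu => ?_,
    H.differ.under_iff ht₀' hv₀' (not_and_of_ne (by decide) _ _) hcurve, hcurve, ?_,
    fun x hx hlt => ?_, fun x hx hlt => ?_, fun x hx hlt => ?_, fun x hx hlt => ?_⟩
  · obtain ⟨j, w, hw, hne, he, hnu⟩ := H.differ.exists_upper hx hu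
    obtain rfl | rfl | rfl := fin_three_cases j
    · exact (hne ⟨rfl, (H.embedded 0).1 hw hx he⟩).elim
    · exact hinj0 x hx (by rw [← inChart_eq he]; exact (H.vertical w hw).2)
    · have := (him w hw).1 (by rw [inChart_eq he]; exact (H.horizontal x hx).2.1)
      exact (hnu (this ▸ hus)).elim
  · obtain ⟨j, w, hw, hne, he, hnu⟩ := H.differ.exists_upper hx hu
    obtain rfl | rfl | rfl := fin_three_cases j
    · exact hinj1 x hx (by rw [← inChart_eq he]; exact (H.horizontal w hw).2.1)
    · exact (hne ⟨rfl, (H.embedded 1).1 hw hx he⟩).elim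
    · have := (hre w hw).1 (by rw [inChart_eq he]; exact (H.vertical x hx).2)
      exact (hnu (this ▸ hut)).elim
  · rw [sign_planeDet_inChart (φ := φ) hcurve.symm, planeDet_of_im_eq_zero (h0 t₀ ht₀').1, sign_mul,
      (h0 t₀ ht₀').2, (h1 v₀ hv₀').2]
  · have := sign_deriv_eq_left hlt cre (fun y hy h => hy.2.ne
      (hinj0 y ⟨hx.1.trans hy.1, hy.2.le.trans ht₀.2.le⟩ h)) hdre dre hre0
    rw [(h0 t₀ ht₀').2] at this
    rw [this, neg_neg]
    rfl
  · have := sign_deriv_eq_right hlt cre (fun y hy h => hy.1.ne'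
      (hinj0 y ⟨ht₀.1.le.trans hy.1.le, hy.2.trans hx.2⟩ h)) hdre dre hre0
    rw [(h0 t₀ ht₀').2] at this
    exact this.symm
  · have := sign_deriv_eq_left hlt cim (fun y hy h => hy.2.ne
      (hinj1 y ⟨hx.1.trans hy.1, hy.2.le.trans hv₀.2.le⟩ h)) hdim dim him0
    rw [(h1 v₀ hv₀').2] at this
    rw [this, neg_neg]
    rfl
  · have := sign_deriv_eq_right hlt cim (fun y hy h => hy.1.ne'
      (hinj1 y ⟨hv₀.1.le.trans hy.1.le, hy.2.trans hx.2⟩ h)) hdim dim him0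
    rw [(h1 v₀ hv₀').2] at this
    exact this.symm

theorem IsThirdMove.deriv_eq {σ : ℝ} (H : L.IsThirdMove L' φ J σ) {i : Fin 3} (hi : i ≠ 2) {x : ℝ}
    (hx : x ∈ Icc (J i).lo (J i).hi) :
    deriv (L.curve (J i).comp) x = deriv (L'.curve (J i).comp) x ∧
    deriv (L.inChart φ (J i)) x = deriv (L'.inChart φ (J i)) x := by
  have h : EqOn (L.curve (J i).comp) (L'.curve (J i).comp) (Icc (J i).lo (J i).hi) := by
    obtain rfl | rfl | rfl := fin_three_cases i
    · exact fun t ht => (H.horizontal t ht).1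
    · exact fun t ht => (H.vertical t ht).1
    · exact (hi rfl).elim
  exact ⟨deriv_eq_of_eqOn_Icc (J i).lo_lt_hi hx (L.differentiableAt _ _) (L'.differentiableAt _ _) h,
    deriv_eq_of_eqOn_Icc (J i).lo_lt_hi hx (L.differentiable_inChart φ _ _)
      (L'.differentiable_inChart φ _ _) fun t ht => inChart_congr (h ht)⟩

theorem IsThirdMove.exists_data {σ : ℝ} (H : L.IsThirdMove L' φ J σ) :
    ∃ ε₀ ε₁ μ t₀ v₀ s t u v s' t' u' v', ε₀ ≠ 0 ∧ ε₁ ≠ 0 ∧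
      L.AxesCrossing φ J ε₀ ε₁ t₀ v₀ ∧ L'.AxesCrossing φ J ε₀ ε₁ t₀ v₀ ∧
      L.Passage φ J (SignType.sign σ) ε₀ ε₁ μ s t u v ∧
      L'.Passage φ J (-SignType.sign σ) ε₀ ε₁ μ s' t' u' v' := by
  obtain ⟨ε₀, hε₀, h0⟩ := exists_sign_of_im_eq_zero fun t ht => (H.horizontal t ht).2.1
  obtain ⟨ε₁, hε₁, h1⟩ := exists_sign_of_re_eq_zero fun t ht => (H.vertical t ht).2
  have h0' : ∀ t ∈ Icc (J 0).lo (J 0).hi, (deriv (L'.inChart φ (J 0)) t).im = 0 ∧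
      SignType.sign (deriv (L'.inChart φ (J 0)) t).re = ε₀ := fun t ht => by
    rw [← (H.deriv_eq (by decide) ht).2]
    exact h0 t ht
  have h1' : ∀ t ∈ Icc (J 1).lo (J 1).hi, (deriv (L'.inChart φ (J 1)) t).re = 0 ∧
      SignType.sign (deriv (L'.inChart φ (J 1)) t).im = ε₁ := fun t ht => by
    rw [← (H.deriv_eq (by decide) ht).2]
    exact h1 t ht
  obtain ⟨s, t, u, v, hP⟩ := H.exists_passage h0 h1
  obtain ⟨s', t', u', v', hP'⟩ := H.symm.exists_passage h0' h1'
  -- The common end makes `μ` the same in both passages.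
  rw [Left.sign_neg, ← inChart_congr (H.differ.curve_hi 2)] at hP'
  -- Before and after the move `J 2` passes under `J 0` on opposite half-axes, so `J 0` runs through
  -- the origin in between; likewise for `J 1` below.
  obtain ⟨t₀, ht₀, hzero⟩ := exists_zero_mem_Ioo
    (Complex.continuous_re.comp (L.continuous_inChart φ (J 0))) hP.mem_u hP'.mem_u
    (sign_ne_zero.2 H.side) hP.sign_u (by
      rw [← hP'.sign_u, ← inChart_congr (H.horizontal u' hP'.mem_u).1]
      rfl)
  obtain ⟨v₀, hv₀, hone⟩ := exists_zero_mem_Ioo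
    (Complex.continuous_im.comp (L.continuous_inChart φ (J 1))) hP.mem_v hP'.mem_v
    (sign_ne_zero.2 H.side) hP.sign_v (by
      rw [← hP'.sign_v, ← inChart_congr (H.vertical v' hP'.mem_v).1]
      rfl)
  have hz : L.inChart φ (J 0) t₀ = 0 :=
    Complex.ext hzero (H.horizontal t₀ (Ioo_subset_Icc_self ht₀)).2.1
  have ho : L.inChart φ (J 1) v₀ = 0 :=
    Complex.ext (H.vertical v₀ (Ioo_subset_Icc_self hv₀)).2 hone
  refine ⟨ε₀, ε₁, _, t₀, v₀, s, t, u, v, s', t', u', v', hε₀, hε₁,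
    H.axesCrossing hε₀ hε₁ h0 h1 ht₀ hv₀ hz ho, H.symm.axesCrossing hε₀ hε₁ h0' h1' ht₀ hv₀ ?_ ?_,
    hP, hP'⟩
  · rw [← inChart_congr (H.horizontal t₀ (Ioo_subset_Icc_self ht₀)).1, hz]
  · rw [← inChart_congr (H.vertical v₀ (Ioo_subset_Icc_self hv₀)).1, ho]

/-! ### Colours in the third move -/

section Colorings

variable {X : Type} [Quandle X] {g : Fin 3 → ℝ → X} {σ ε₀ ε₁ μ : SignType} {t₀ v₀ s t u v : ℝ}

/-- The colour of the outgoing end of the lowest strand. -/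
theorem Passage.hi_eq (hP : L.Passage φ J σ ε₀ ε₁ μ s t u v) (hg : L.IsLocalColoring J g) :
    (s < t → g 2 (J 2).hi =
      (signPerm (ε₁ * μ) (g 1 v) * signPerm (ε₀ * μ) (g 0 u)) (g 2 (J 2).lo)) ∧
    (t < s → g 2 (J 2).hi =
      (signPerm (ε₀ * μ) (g 0 u) * signPerm (ε₁ * μ) (g 1 v)) (g 2 (J 2).lo)) := by
  have hs := hg.cross 2 s (Ioo_subset_Ico_self hP.mem_s) hP.under_s 0 u hP.mem_u
    (not_and_of_ne (by decide) _ _) hP.curve_s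
  have ht := hg.cross 2 t (Ioo_subset_Ico_self hP.mem_t) hP.under_t 1 v hP.mem_v
    (not_and_of_ne (by decide) _ _) hP.curve_t
  rw [crossingPerm_eq_signPerm, hP.det_s] at hs
  rw [crossingPerm_eq_signPerm, hP.det_t] at ht
  have hr : ∀ τ ∈ Ico (J 2).lo (J 2).hi, τ ≠ s → τ ≠ t → ∀ᶠ x in 𝓝[>] τ, g 2 x = g 2 τ :=
    fun τ hτ h1 h2 => hg.right 2 τ hτ fun h =>
      (hP.under τ (Ico_subset_Icc_self hτ) h).elim h1 h2
  exact ⟨fun hst => eq_of_two_jumps hP.mem_s.1.le hst hP.mem_t.2 (hg.left 2) hr hs ht,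
    fun hst => eq_of_two_jumps hP.mem_t.1.le hst hP.mem_s.2 (hg.left 2)
      (fun τ hτ h1 h2 => hr τ hτ h2 h1) ht hs⟩

/-- Of the strands `J 0` and `J 1` the upper one has a single colour; the colours of the two parts of
the lower one are related by the crossing. -/
theorem AxesCrossing.colors (hA : L.AxesCrossing φ J ε₀ ε₁ t₀ v₀) (hε₀ : ε₀ ≠ 0) (hε₁ : ε₁ ≠ 0)
    (hσ : σ ≠ 0) (hg : L.IsLocalColoring J g) {u' v' : ℝ} (hu : u ∈ Icc (J 0).lo (J 0).hi)
    (hu' : u' ∈ Icc (J 0).lo (J 0).hi) (hv : v ∈ Icc (J 1).lo (J 1).hi)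
    (hv' : v' ∈ Icc (J 1).lo (J 1).hi) (hsu : SignType.sign (L.inChart φ (J 0) u).re = σ)
    (hsu' : SignType.sign (L.inChart φ (J 0) u').re = -σ)
    (hsv : SignType.sign (L.inChart φ (J 1) v).im = σ)
    (hsv' : SignType.sign (L.inChart φ (J 1) v').im = -σ) :
    (g 0 u = g 0 u' ∧ g 1 v = signPerm (ε₀ * σ) (g 0 u) (g 1 v')) ∨
    (g 1 v = g 1 v' ∧ g 0 u = signPerm (-(ε₁ * σ)) (g 1 v) (g 0 u')) := by
  have hdet : SignType.sign (planeDet (deriv (L.curve (J 1).comp) v₀)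
      (deriv (L.curve (J 0).comp) t₀)) = -(ε₀ * ε₁) := by
    rw [← hA.det, ← Left.sign_neg]
    congr 1
    simp only [planeDet]
    ring
  by_cases hun : L.under (J 0).comp t₀
  · have h1 : ∀ x ∈ Icc (J 1).lo (J 1).hi, g 1 x = g 1 (J 1).lo := hg.eq_lo fun x hx h => by
      have := hA.under_one x hx h
      subst this
      exact hA.under_iff.1 hun h
    have hc := hg.cross 0 t₀ (Ioo_subset_Ico_self hA.mem_zero) hun 1 v₀
      (Ioo_subset_Icc_self hA.mem_one) (not_and_of_ne (by decide) _ _) hA.curve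
    rw [crossingPerm_eq_signPerm, hdet, h1 v₀ (Ioo_subset_Icc_self hA.mem_one)] at hc
    obtain ⟨h2, h3⟩ := eq_of_one_jump (Ioo_subset_Ico_self hA.mem_zero) (hg.left 0)
      (fun τ hτ hne => hg.right 0 τ hτ fun h => hne (hA.under_zero τ (Ico_subset_Icc_self hτ) h)) hc
    refine Or.inr ⟨(h1 v hv).trans (h1 v' hv').symm, ?_⟩
    rw [h1 v hv]
    -- Whether the side `σ` comes after or before the crossing along `J 0` depends on whether `σ` is
    -- `ε₀` or `-ε₀`; in the latter case the jump is read backwards.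
    rcases eq_or_eq_of_jump (f := fun x => (L.inChart φ (J 0) x).re) hε₀ hσ
      (by rw [hA.zero_zero, Complex.zero_re]) hA.sign_zero_left hA.sign_zero_right h2 h3 hu hu' hsu
      hsu' with ⟨rfl, h4⟩ | ⟨rfl, h4⟩
    · rw [h4, mul_comm σ]
    · rw [h4, mul_neg, neg_neg, mul_comm ε₁, signPerm_neg]
      exact (Equiv.apply_symm_apply _ _).symm
  · have hun1 : L.under (J 1).comp v₀ := by
      by_contra h
      exact hun (hA.under_iff.2 h)
    have h1 : ∀ x ∈ Icc (J 0).lo (J 0).hi, g 0 x = g 0 (J 0).lo := hg.eq_lo fun x hx h => by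
      have := hA.under_zero x hx h
      subst this
      exact hun h
    have hc := hg.cross 1 v₀ (Ioo_subset_Ico_self hA.mem_one) hun1 0 t₀
      (Ioo_subset_Icc_self hA.mem_zero) (not_and_of_ne (by decide) _ _) hA.curve.symm
    rw [crossingPerm_eq_signPerm, hA.det, h1 t₀ (Ioo_subset_Icc_self hA.mem_zero)] at hc
    obtain ⟨h2, h3⟩ := eq_of_one_jump (Ioo_subset_Ico_self hA.mem_one) (hg.left 1)
      (fun τ hτ hne => hg.right 1 τ hτ fun h => hne (hA.under_one τ (Ico_subset_Icc_self hτ) h)) hc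
    refine Or.inl ⟨(h1 u hu).trans (h1 u' hu').symm, ?_⟩
    rw [h1 u hu]
    rcases eq_or_eq_of_jump (f := fun x => (L.inChart φ (J 1) x).im) hε₁ hσ
      (by rw [hA.one_zero, Complex.zero_im]) hA.sign_one_left hA.sign_one_right h2 h3 hv hv' hsv
      hsv' with ⟨rfl, h4⟩ | ⟨rfl, h4⟩
    · exact h4
    · rw [h4, mul_neg, signPerm_neg]
      exact (Equiv.symm_apply_apply _ _).symm

/-- Colours of the upper two strands extend to the lowest one. -/
theorem Passage.exists_isLocalColoring (hP : L.Passage φ J σ ε₀ ε₁ μ s t u v)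
    (hD : L.DifferInDisc L' φ J) (g : Fin 3 → ℝ → X)
    (hl : ∀ i ≠ 2, ∀ τ ∈ Ioc (J i).lo (J i).hi, ∀ᶠ x in 𝓝[<] τ, g i x = g i τ)
    (hr : ∀ i ≠ 2, ∀ τ ∈ Ico (J i).lo (J i).hi, ¬ L.under (J i).comp τ →
      ∀ᶠ x in 𝓝[>] τ, g i x = g i τ)
    (hc : ∀ i ≠ 2, ∀ τ ∈ Ico (J i).lo (J i).hi, L.under (J i).comp τ →
      ∃ j ≠ 2, ∃ w ∈ Icc (J j).lo (J j).hi, ¬ (j = i ∧ w = τ) ∧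
      L.curve (J j).comp w = L.curve (J i).comp τ ∧ ∀ᶠ x in 𝓝[>] τ, g i x =
        crossingPerm (planeDet (deriv (L.curve (J j).comp) w) (deriv (L.curve (J i).comp) τ)) (g j w)
        (g i τ)) :
    ∃ g', L.IsLocalColoring J g' ∧ (∀ i ≠ 2, g' i = g i) ∧ g' 2 (J 2).lo = g 2 (J 2).lo := by
  obtain ⟨f, hf1, hf2, hf3, hf4, hf5⟩ : ∃ f : ℝ → X, (∀ τ, ∀ᶠ x in 𝓝[<] τ, f x = f τ) ∧
      (∀ τ, τ ≠ s → τ ≠ t → ∀ᶠ x in 𝓝[>] τ, f x = f τ) ∧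
      (∀ᶠ x in 𝓝[>] s, f x = signPerm (ε₀ * μ) (g 0 u) (f s)) ∧
      (∀ᶠ x in 𝓝[>] t, f x = signPerm (ε₁ * μ) (g 1 v) (f t)) ∧
      f (J 2).lo = g 2 (J 2).lo := by
    rcases hP.order with ⟨h, -⟩ | ⟨h, -⟩
    · exact ⟨_, stepFun_left s t (g 2 (J 2).lo) _ _, fun τ h1 h2 => stepFun_right _ _ _ h1 h2,
        stepFun_jump_first h _ rfl, stepFun_jump_second h _ rfl, stepFun_of_le _ _ _ hP.mem_s.1.le⟩
    · exact ⟨_, stepFun_left t s (g 2 (J 2).lo) _ _, fun τ h1 h2 => stepFun_right _ _ _ h2 h1,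
        stepFun_jump_second h _ rfl, stepFun_jump_first h _ rfl, stepFun_of_le _ _ _ hP.mem_t.1.le⟩
  have hup : ∀ i ≠ 2, Function.update g 2 f i = g i := fun i hi => Function.update_of_ne hi _ _
  have hup2 : Function.update g 2 f 2 = f := Function.update_self _ _ _
  refine ⟨Function.update g 2 f, ⟨fun i τ hτ => ?_, fun i τ hτ hu => ?_,
    fun i τ hτ hu j w hw hne he => ?_⟩, hup, by rw [hup2, hf5]⟩
  · by_cases hi : i = 2
    · subst hi
      rw [hup2]
      exact hf1 τ
    · rw [hup i hi]
      exact hl i hi τ hτ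
  · by_cases hi : i = 2
    · subst hi
      rw [hup2]
      refine hf2 τ ?_ ?_
      · rintro rfl
        exact hu hP.under_s
      · rintro rfl
        exact hu hP.under_t
    · rw [hup i hi]
      exact hr i hi τ hτ hu
  · have hτ' := Ico_subset_Icc_self hτ
    by_cases hi : i = 2
    · subst hi
      rcases hP.under τ hτ' hu with rfl | rfl
      · obtain ⟨rfl, rfl⟩ := hD.upper_unique hτ' hw hP.mem_u hne (not_and_of_ne (by decide) _ _) he
          hP.curve_s
        rw [hup2, hup 0 (by decide), crossingPerm_eq_signPerm, hP.det_s]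
        exact hf3
      · obtain ⟨rfl, rfl⟩ := hD.upper_unique hτ' hw hP.mem_v hne (not_and_of_ne (by decide) _ _) he
          hP.curve_t
        rw [hup2, hup 1 (by decide), crossingPerm_eq_signPerm, hP.det_t]
        exact hf4
    · obtain ⟨j', hj', w', hw', hne', he', h⟩ := hc i hi τ hτ hu
      obtain ⟨rfl, rfl⟩ := hD.upper_unique hτ' hw hw' hne hne' he he'
      rw [hup i hi, hup j hj']
      exact h

end Colorings

/-- The colours of `J 0` and `J 1` are kept, and `J 2` is recoloured from its incoming end. Its
outgoing colour is unchanged because the two passages are in opposite orders and one of the upper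
strands changes colour between them by the action of the other. -/
theorem IsThirdMove.exists_isLocalColoring {σ : ℝ} (H : L.IsThirdMove L' φ J σ) {X : Type}
    [Quandle X] {g : Fin 3 → ℝ → X} (hg : L.IsLocalColoring J g) :
    ∃ g' : Fin 3 → ℝ → X, L'.IsLocalColoring J g' ∧ ∀ i, g' i (J i).lo = g i (J i).lo ∧
      g' i (J i).hi = g i (J i).hi := by
  obtain ⟨ε₀, ε₁, μ, t₀, v₀, s, t, u, v, s', t', u', v', hε₀, hε₁, hA, hA', hP, hP'⟩ := H.exists_data
  have ht₀ := Ioo_subset_Icc_self hA.mem_zero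
  have hv₀ := Ioo_subset_Icc_self hA.mem_one
  have hu0 : L'.under (J 0).comp t₀ ↔ L.under (J 0).comp t₀ :=
    ((H.horizontal t₀ ht₀).2.2 hA.zero_zero).symm
  -- The move fixes the over/under information of `J 0` at the origin; that of `J 1` is
  -- complementary.
  have hu1 : L'.under (J 1).comp v₀ ↔ L.under (J 1).comp v₀ := by
    have h1 := hA.under_iff
    have h2 := hA'.under_iff
    tauto
  have hund : ∀ i ≠ 2, ∀ τ ∈ Icc (J i).lo (J i).hi,
      (L'.under (J i).comp τ ↔ L.under (J i).comp τ) := by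
    intro i hi τ hτ
    obtain rfl | rfl | rfl := fin_three_cases i
    · constructor <;> intro h
      · have := hA'.under_zero τ hτ h
        subst this
        exact hu0.1 h
      · have := hA.under_zero τ hτ h
        subst this
        exact hu0.2 h
    · constructor <;> intro h
      · have := hA'.under_one τ hτ h
        subst this
        exact hu1.1 h
      · have := hA.under_one τ hτ h
        subst this
        exact hu1.2 h
    · exact (hi rfl).elim
  obtain ⟨g', hg', h1, h2⟩ := hP'.exists_isLocalColoring H.differ.symm g
    (fun i _ => hg.left i)
    (fun i hi τ hτ hu => hg.right i τ hτ fun h => hu ((hund i hi τ (Ico_subset_Icc_self hτ)).2 h))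
    (fun i hi τ hτ hu => by
      have hu' := (hund i hi τ (Ico_subset_Icc_self hτ)).1 hu
      rw [← (H.deriv_eq hi (Ico_subset_Icc_self hτ)).1]
      obtain rfl | rfl | rfl := fin_three_cases i
      · have := hA.under_zero τ (Ico_subset_Icc_self hτ) hu'
        subst this
        have hne := not_and_of_ne (show (1 : Fin 3) ≠ 0 by decide) v₀ τ
        refine ⟨1, by decide, v₀, hv₀, hne, hA'.curve, ?_⟩
        rw [← (H.deriv_eq (by decide) hv₀).1]
        exact hg.cross 0 τ hτ hu' 1 v₀ hv₀ hne hA.curve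
      · have := hA.under_one τ (Ico_subset_Icc_self hτ) hu'
        subst this
        have hne := not_and_of_ne (show (0 : Fin 3) ≠ 1 by decide) t₀ τ
        refine ⟨0, by decide, t₀, ht₀, hne, hA'.curve.symm, ?_⟩
        rw [← (H.deriv_eq (by decide) ht₀).1]
        exact hg.cross 1 τ hτ hu' 0 t₀ ht₀ hne hA.curve.symm
      · exact (hi rfl).elim)
  refine ⟨g', hg', fun i => ?_⟩
  by_cases hi : i = 2
  · subst hi
    refine ⟨h2, ?_⟩
    have e := hP.hi_eq hg
    have e' := hP'.hi_eq hg'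
    rw [h1 0 (by decide), h1 1 (by decide), h2] at e'
    have hcol := hA.colors hε₀ hε₁ (sign_ne_zero.2 H.side) hg hP.mem_u hP'.mem_u hP.mem_v hP'.mem_v
      hP.sign_u (by rw [inChart_congr (H.horizontal u' hP'.mem_u).1, hP'.sign_u]) hP.sign_v
      (by rw [inChart_congr (H.vertical v' hP'.mem_v).1, hP'.sign_v])
    have hσ : SignType.sign σ ≠ -SignType.sign σ := by
      have := sign_ne_zero.2 H.side
      revert this
      generalize SignType.sign σ = a
      cases a <;> decide
    -- Equal orders would force `σ` and `-σ` to have the same sign. In the other two cases `J 0` or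
    -- `J 1` may be the upper strand, which decides the form of the conjugation identity.
    rcases hP.order with ⟨h3, h4⟩ | ⟨h3, h4⟩ <;> rcases hP'.order with ⟨h5, h6⟩ | ⟨h5, h6⟩
    · exact (hσ (h4.symm.trans h6)).elim
    · rw [e.1 h3, e'.2 h5, h4]
      refine DFunLike.congr_fun ?_ _
      rcases hcol with ⟨h7, h8⟩ | ⟨h7, h8⟩
      · rw [← h7, h8, signPerm_signPerm_mul]
      · rw [← h7, h8]
        have := mul_signPerm_signPerm (-(ε₁ * SignType.sign σ)) (ε₀ * SignType.sign σ) (g 1 v)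
          (g 0 u')
        rw [neg_neg] at this
        exact this.symm
    · rw [e.2 h3, e'.1 h5, h4]
      refine DFunLike.congr_fun ?_ _
      rw [mul_neg, mul_neg]
      rcases hcol with ⟨h7, h8⟩ | ⟨h7, h8⟩
      · rw [← h7, h8, mul_signPerm_signPerm]
      · rw [← h7, h8, signPerm_signPerm_mul]
    · exact (hσ (neg_injective (h4.symm.trans h6))).elim
  · rw [h1 i hi]
    exact ⟨rfl, rfl⟩

theorem IsThirdMove.not_under_hi {σ : ℝ} (H : L.IsThirdMove L' φ J σ) (i : Fin 3) :
    ¬ L.under (J i).comp (J i).hi := by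
  intro h
  obtain ⟨ε₀, ε₁, μ, t₀, v₀, s, t, u, v, -, -, -, -, -, -, hA, -, hP, -⟩ := H.exists_data
  have hhi : (J i).hi ∈ Icc (J i).lo (J i).hi := ⟨(J i).lo_lt_hi.le, le_rfl⟩
  obtain rfl | rfl | rfl := fin_three_cases i
  · exact hA.mem_zero.2.ne' (hA.under_zero _ hhi h)
  · exact hA.mem_one.2.ne' (hA.under_one _ hhi h)
  · exact (hP.under _ hhi h).elim hP.mem_s.2.ne' hP.mem_t.2.ne'

theorem IsThirdMove.eq_of_isLocalColoring {σ : ℝ} (H : L.IsThirdMove L' φ J σ) {X : Type}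
    [Quandle X] {g g' : Fin 3 → ℝ → X} (hg : L.IsLocalColoring J g) (hg' : L.IsLocalColoring J g')
    (hlo : ∀ i, g i (J i).lo = g' i (J i).lo) :
    ∀ i, ∀ t ∈ Icc (J i).lo (J i).hi, g i t = g' i t := by
  obtain ⟨ε₀, ε₁, μ, t₀, v₀, s, t, u, v, -, -, -, -, -, -, hA, -, hP, -⟩ := H.exists_data
  have hlow : ∀ rank : Fin 3 → ℕ, rank 0 < rank 2 → rank 1 < rank 2 →
      ∀ x ∈ Icc (J 2).lo (J 2).hi, L.under (J 2).comp x → ∃ j, ∃ w ∈ Icc (J j).lo (J j).hi,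
      L.curve (J j).comp w = L.curve (J 2).comp x ∧ rank j < rank 2 := by
    intro rank h0 h1 x hx hu
    rcases hP.under x hx hu with rfl | rfl
    · exact ⟨0, u, hP.mem_u, hP.curve_s, h0⟩
    · exact ⟨1, v, hP.mem_v, hP.curve_t, h1⟩
  by_cases hun : L.under (J 0).comp t₀
  · refine hg.eq_of_rank ![1, 0, 2] (fun i x hx hu => ?_) hg' hlo
    obtain rfl | rfl | rfl := fin_three_cases i
    · have := hA.under_zero x hx hu
      subst this
      exact ⟨1, v₀, Ioo_subset_Icc_self hA.mem_one, hA.curve, by decide⟩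
    · have := hA.under_one x hx hu
      subst this
      exact (hA.under_iff.1 hun hu).elim
    · exact hlow _ (by decide) (by decide) x hx hu
  · refine hg.eq_of_rank ![0, 1, 2] (fun i x hx hu => ?_) hg' hlo
    obtain rfl | rfl | rfl := fin_three_cases i
    · have := hA.under_zero x hx hu
      subst this
      exact (hun hu).elim
    · have := hA.under_one x hx hu
      subst this
      exact ⟨0, t₀, Ioo_subset_Icc_self hA.mem_zero, hA.curve.symm, by decide⟩
    · exact hlow _ (by decide) (by decide) x hx hu

theorem ReidemeisterThree.isIsomorphic (h : L.ReidemeisterThree L') :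
    L.fundamentalPointedQuandle.IsIsomorphic L'.fundamentalPointedQuandle := by
  obtain ⟨φ, J, hD, hemb, h0, h1, hp, hp'⟩ := h
  -- Allowing either side `σ` makes the situation symmetric, so each statement about `L` also
  -- applies to `L'` through `H.symm`.
  have H : L.IsThirdMove L' φ J 1 := ⟨hD, hemb, h0, h1, one_ne_zero, hp, hp'⟩
  exact hD.isIsomorphic H.not_under_hi H.symm.not_under_hi
    (fun X _ g hg => H.exists_isLocalColoring hg) (fun X _ g hg => H.symm.exists_isLocalColoring hg)
    (fun X _ g g' => H.eq_of_isLocalColoring) (fun X _ g g' => H.symm.eq_of_isLocalColoring)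

/-! ### From single moves to equivalence of diagrams -/

theorem Move.isIsomorphic (h : Move L L') :
    L.fundamentalPointedQuandle.IsIsomorphic L'.fundamentalPointedQuandle := by
  cases h with
  | isotopy h => exact h.isIsomorphic
  | one h => exact h.isIsomorphic
  | two h => exact h.isIsomorphic
  | three h => exact h.isIsomorphic
  | spherical h => exact h.isIsomorphic

end LinkoidDiagram

namespace PointedQuandle.IsIsomorphic

variable {N : ℕ} {X Y Z : PointedQuandle N}

theorem refl (X : PointedQuandle N) : X.IsIsomorphic X :=
  ⟨⟨id, fun _ _ => rfl, fun _ => rfl⟩, ⟨id, fun _ _ => rfl, fun _ => rfl⟩, fun _ => rfl, fun _ => rfl⟩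

theorem symm (h : X.IsIsomorphic Y) : Y.IsIsomorphic X := by
  obtain ⟨f, g, h1, h2⟩ := h
  exact ⟨g, f, h2, h1⟩

theorem trans (h : X.IsIsomorphic Y) (h' : Y.IsIsomorphic Z) : X.IsIsomorphic Z := by
  obtain ⟨f, g, h1, h2⟩ := h
  obtain ⟨f', g', h3, h4⟩ := h'
  exact ⟨⟨f'.toFun ∘ f.toFun, fun x y => by simp [f.map_act, f'.map_act],
      fun i => by simp [f.map_basepoint, f'.map_basepoint]⟩,
    ⟨g.toFun ∘ g'.toFun, fun x y => by simp [g.map_act, g'.map_act],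
      fun i => by simp [g.map_basepoint, g'.map_basepoint]⟩,
    fun x => (congrArg g.toFun (h3 (f.toFun x))).trans (h1 x),
    fun z => (congrArg f'.toFun (h2 (g'.toFun z))).trans (h4 z)⟩

end PointedQuandle.IsIsomorphic

theorem mainTheorem2 {n m : ℕ} (L L' : LinkoidDiagram n m) (h : L.Equivalent L') :
    L.fundamentalPointedQuandle.IsIsomorphic L'.fundamentalPointedQuandle := by
  induction h with
  | rel _ _ h => exact h.isIsomorphic
  | refl _ => exact .refl _
  | symm _ _ _ ih => exact ih.symm
  | trans _ _ _ _ _ ih ih' => exact ih.trans ih'
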